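/- **Setting.** Let $\mathcal R$ be a first-order structure with universe $R$, in a vocabulary of constant symbols and of function and relation symbols of positive arity (any of these sets may be infinite). Assume that $\mathcal R$ is *bipointed*: there are two distinguished constant symbols $0,1$ with different interpretations, also written $0 \neq 1$, in $R$. **Machines.** An $\mathcal R$-machine has $R$-registers $Z[0],Z[1],\dots$, finitely many index registers $I[0],\dots,I[m]$ with values in $\mathbb N$, and a finite program of instructions labelled $0,1,\dots,\ell_{\mathcal P}$, of which exactly the last one is `stop`. The other instructions are $Z[j_0]:=c$; $Z[j_0]:=f(Z[j_1],\dots,Z[j_k])$; $Z[I[j_0]]:=Z[I[j_1]]$; $I[j_0]:=I[j_0]+1$; $I[j_0]:=\max(I[j_0]-1,0)$; and branchings to one of two labels according to whether $Z[j_1]=Z[j_2]$, whether $P(Z[j_1],\dots,Z[j_k])$ holds, or whether $I[j_1]=I[j_2]$. Here $c$, $f$, $P$ are symbols of the vocabulary. A machine with an oracle $Q\subseteq R^*=\bigcup_n R^n$ may also branch according to whether $(Z[0],\dots,Z[I[0]])\in Q$. On input $x\in R^n$ the machine starts at label $0$ with $x$ in $Z[0],\dots,Z[n-1]$, with $0$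 in the other $R$-registers, with $I[0]=n$, and with $0$ in the other index registers. If it reaches `stop`, its output $M(x)$ is $(Z[0],\dots,Z[I[0]-1])$. It is *polynomial-time* if for some polynomial $p$ it reaches `stop` after at most $p(|x|)$ instructions on every $x\in R^*$. It is *constant-free* if the only constant symbols in its program are $0$ and $1$. A tuple $(v,w_1,\dots,w_k)$ with $k\ge 1$ is given to a machine as the string obtained by concatenating $v,w_1,\dots,w_k$ and putting in front of each symbol a tag, which is $1$ for the first symbol of each $w_i$ and $0$ for all other symbols; for $k=0$ the input is $v$ itself. **Classes.** For $k\in\mathbb N$, $\Sigma_k\mathcal R^0$ is the class of all $L\subseteq R^*$ for which there are a polynomial $q$ with coefficients in $\mathbb N$ and a constant-free polynomial-time $\mathcal R$-machine $M$ (without oracle) such that for all $v\in R^*$ $$v\in L\iff (Q_1w_1\in R^{q(|v|)})\cdots(Q_kw_k\in R^{q(|v|)})\; M(v,w_1,\dots,w_k)=1,$$ where the quantifiers alternate and $Q_1=\exists$. The class $\Pi_k\mathcal R^0$ is defined in the same way with $Q_1=\forall$. The class $\exists_k\mathcal R$ consists of all $L\cap\{0,1\}^*$ with $L\in\Sigma_k\mathcal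 R^0$, and $\forall_k\mathcal R$ consists of all $L\cap\{0,1\}^*$ with $L\in\Pi_k\mathcal R^0$. For a class $\mathcal D$ of subsets of $R^*$, the classes $\exists\mathcal R^{\mathcal D}$ and $\forall\mathcal R^{\mathcal D}$ are defined like $\exists_1\mathcal R$ and $\forall_1\mathcal R$, except that $M$ is a constant-free machine with an oracle $Q\in\mathcal D$ that is polynomial-time with this oracle. **Statement.** For every bipointed structure $\mathcal R$ and every $k\in\mathbb N$ (including $k=0$), $$\exists_{k+1}\mathcal R=\exists\mathcal R^{\Sigma_k\mathcal R^0}\qquad\text{and}\qquad \forall_{k+1}\mathcal R=\forall\mathcal R^{\Sigma_k\mathcal R^0}.$$ -/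

import Mathlib

universe u v w

namespace RMachine

/-- A bipointed structure: the vocabulary has two distinguished constant symbols `0` and `1`
whose interpretations in the universe `R` are different. -/
class Bipointed (L : FirstOrder.Language.{u, v}) (R : Type w) [L.Structure R] where
  zeroSym : L.Constants
  oneSym : L.Constants
  zero_ne_one : (FirstOrder.Language.constantMap zeroSym : R) ≠ FirstOrder.Language.constantMap oneSym

/-- Instructions over a vocabulary. Constant symbols are the nullary function symbols of `L`;
function and relation symbols usable by machines have positive arity `n + 1`.
`Z[j]` are the registers over `R`, `I[j]` the index registers.
The instruction `stop` is not listed: it is the implicit last line of every program. -/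
inductive Instr (L : FirstOrder.Language.{u, v}) : Type (max u v)
  /-- `Z[j₀] := c` -/
  | const (j₀ : ℕ) (c : L.Constants)
  /-- `Z[j₀] := f (Z[j 0], …, Z[j n])` -/
  | func (j₀ : ℕ) {n : ℕ} (f : L.Functions (n + 1)) (j : Fin (n + 1) → ℕ)
  /-- `if Z[j₁] = Z[j₂] then goto ℓ₁ else goto ℓ₂` -/
  | branchEq (j₁ j₂ ℓ₁ ℓ₂ : ℕ)
  /-- `if P (Z[j 0], …, Z[j n]) then goto ℓ₁ else goto ℓ₂` -/
  | branchRel {n : ℕ} (P : L.Relations (n + 1)) (j : Fin (n + 1) → ℕ) (ℓ₁ ℓ₂ : ℕ)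
  /-- `Z[I[j₀]] := Z[I[j₁]]` -/
  | copy (j₀ j₁ : ℕ)
  /-- `I[j₀] := I[j₀] + 1` -/
  | incr (j₀ : ℕ)
  /-- `I[j₀] := I[j₀] - 1`, truncated at `0` -/
  | decr (j₀ : ℕ)
  /-- `if I[j₁] = I[j₂] then goto ℓ₁ else goto ℓ₂` -/
  | branchIdx (j₁ j₂ ℓ₁ ℓ₂ : ℕ)
  /-- `if (Z[0], …, Z[I[0]]) ∈ Q then goto ℓ₁ else goto ℓ₂`, for the oracle `Q` -/
  | query (ℓ₁ ℓ₂ : ℕ)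

/-- A program `0 : instr₀; …; ℓ - 1 : instr_(ℓ-1); ℓ : stop`, given by the list of its
instructions other than the final `stop`, whose label `ℓ` is the length of the list. -/
abbrev Program (L : FirstOrder.Language.{u, v}) : Type (max u v) := List (Instr L)

/-- A program without query instructions, that is, the program of a machine without oracle. -/
def Program.QueryFree {L : FirstOrder.Language.{u, v}} (P : Program L) : Prop :=
  ∀ ℓ₁ ℓ₂ : ℕ, Instr.query ℓ₁ ℓ₂ ∉ P

/-- No machine constants: the only constant symbols in the program are `0` and `1`. -/
def Program.ConstantFree {L : FirstOrder.Language.{u, v}} (R : Type w) [L.Structure R] [Bipointed L R]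
    (P : Program L) : Prop :=
  ∀ (j₀ : ℕ) (c : L.Constants), Instr.const j₀ c ∈ P →
    c = Bipointed.zeroSym R ∨ c = Bipointed.oneSym R

/-- Configurations: the current label, the index registers and the `R`-registers.
A program mentions only finitely many index registers; the others keep their initial values and
have no effect. -/
structure Config (R : Type w) where
  label : ℕ
  idx : ℕ → ℕ
  reg : ℕ → R

/-- The string stored in a configuration: the first `I[0]` many `R`-registers. -/
def Config.output {R : Type w} (c : Config R) : List R :=
  List.ofFn fun i : Fin (c.idx 0) => c.reg i

/-- The query string `(Z[0], …, Z[I[0]])`. -/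
def Config.queryString {R : Type w} (c : Config R) : List R :=
  List.ofFn fun i : Fin (c.idx 0 + 1) => c.reg i

section Semantics

variable {L : FirstOrder.Language.{u, v}} {R : Type w} [L.Structure R]

open Classical in
/-- The effect of an instruction, for a machine with oracle `Q`. -/
noncomputable def Instr.exec (Q : Set (List R)) (c : Config R) : Instr L → Config R
  | .const j₀ a =>
      ⟨c.label + 1, c.idx, Function.update c.reg j₀ (FirstOrder.Language.constantMap a)⟩
  | .func j₀ f j =>
      ⟨c.label + 1, c.idx,
        Function.update c.reg j₀ (FirstOrder.Language.Structure.funMap f fun i => c.reg (j i))⟩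
  | .branchEq j₁ j₂ ℓ₁ ℓ₂ =>
      ⟨if c.reg j₁ = c.reg j₂ then ℓ₁ else ℓ₂, c.idx, c.reg⟩
  | .branchRel P j ℓ₁ ℓ₂ =>
      ⟨if FirstOrder.Language.Structure.RelMap P (fun i => c.reg (j i)) then ℓ₁ else ℓ₂, c.idx, c.reg⟩
  | .copy j₀ j₁ =>
      ⟨c.label + 1, c.idx, Function.update c.reg (c.idx j₀) (c.reg (c.idx j₁))⟩
  | .incr j₀ =>
      ⟨c.label + 1, Function.update c.idx j₀ (c.idx j₀ + 1), c.reg⟩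
  | .decr j₀ =>
      ⟨c.label + 1, Function.update c.idx j₀ (c.idx j₀ - 1), c.reg⟩
  | .branchIdx j₁ j₂ ℓ₁ ℓ₂ =>
      ⟨if c.idx j₁ = c.idx j₂ then ℓ₁ else ℓ₂, c.idx, c.reg⟩
  | .query ℓ₁ ℓ₂ =>
      ⟨if c.queryString ∈ Q then ℓ₁ else ℓ₂, c.idx, c.reg⟩

/-- The transition function of a machine with oracle `Q`. It is undefined at the label
`P.length` of `stop`, and at larger labels, which are not labels of the program: a computation
that jumps to one of those gets stuck without halting. -/
noncomputable def step (Q : Set (List R)) (P : Program L) (c : Config R) : Option (Config R) :=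
  P[c.label]?.map (Instr.exec Q c)

variable [Bipointed L R]

variable (L) in
/-- The element `0` of a bipointed structure. -/
def zeroElt : R := FirstOrder.Language.constantMap (Bipointed.zeroSym (L := L) R)

variable (L) in
/-- The element `1` of a bipointed structure. -/
def oneElt : R := FirstOrder.Language.constantMap (Bipointed.oneSym (L := L) R)

variable (L) in
/-- The initial configuration on `x = (r₁, …, rₙ)`: label `0`, index registers `n, 0, 0, …`,
`R`-registers `r₁, …, rₙ, 0, 0, …`. -/
def initConfig (x : List R) : Config R :=
  ⟨0, fun j => if j = 0 then x.length else 0, fun i => x.getD i (zeroElt L)⟩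

/-- The configuration after exactly `t` steps on input `x`, if the computation gets that far. -/
noncomputable def configAfter (Q : Set (List R)) (P : Program L) (x : List R) :
    ℕ → Option (Config R)
  | 0 => some (initConfig L x)
  | t + 1 => (configAfter Q P x t).bind (step Q P)

/-- On input `x` the machine halts in time exactly `t`, in the stop configuration `c`. -/
def HaltsAt (Q : Set (List R)) (P : Program L) (x : List R) (t : ℕ) (c : Config R) : Prop :=
  configAfter Q P x t = some c ∧ c.label = P.length

/-- The machine halts on all inputs, in time polynomial in the length of the input. -/
def PolyTime (Q : Set (List R)) (P : Program L) : Prop :=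
  ∃ p : Polynomial ℕ, ∀ x : List R, ∃ t ≤ p.eval x.length, ∃ c, HaltsAt Q P x t c

/-- The machine halts on input `x` with output `1`. -/
def Accepts (Q : Set (List R)) (P : Program L) (x : List R) : Prop :=
  ∃ t c, HaltsAt Q P x t c ∧ c.output = [oneElt L]

variable (L) in
/-- Puts a tag in front of each symbol of a string: `b` for the first one, `0` for the others. -/
def tagString (b : R) : List R → List R
  | [] => []
  | r :: x => b :: r :: x.flatMap fun s => [zeroElt L, s]

variable (L) in
/-- The input string that represents the tuple `(x, w₁, …, wₖ)`. For `k = 0` it is `x`, and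
otherwise it is `(0, x₁, …, 0, xₙ, 1, w₁₁, 0, w₁₂, …, 1, wₖ₁, 0, wₖ₂, …)`: a `1` at an even
position is where the next entry begins. -/
def tupleString (x : List R) : List (List R) → List R
  | [] => x
  | ws => tagString L (zeroElt L) x ++ ws.flatMap (tagString L (oneElt L))

end Semantics

/-- The two kinds of quantifiers. -/
inductive Quant
  | ex
  | all

/-- `(Q₁ w₁ ∈ R^m) … (Q_k w_k ∈ R^m) φ (w₁, …, w_k)` with alternating quantifiers, starting with
the given one. -/
def Alternates {R : Type w} (m : ℕ) : Quant → ℕ → (List (List R) → Prop) → Prop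
  | _, 0, φ => φ []
  | .ex, k + 1, φ =>
      ∃ y : List R, y.length = m ∧ Alternates m .all k fun ws => φ (y :: ws)
  | .all, k + 1, φ =>
      ∀ y : List R, y.length = m → Alternates m .ex k fun ws => φ (y :: ws)

section Classes

variable (L : FirstOrder.Language.{u, v}) (R : Type w) [L.Structure R] [Bipointed L R]

/-- The problem `A` is defined by `k` alternating quantifiers, starting with `q₀`, over witnesses
of length given by a polynomial in the size of the input, in front of the acceptance condition of
the polynomial-time machine with program `P` and oracle `Q`. -/
def DefinedBy (q₀ : Quant) (k : ℕ) (Q : Set (List R)) (P : Program L) (A : Set (List R)) : Prop :=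
  PolyTime Q P ∧ ∃ q : Polynomial ℕ, ∀ x : List R,
    x ∈ A ↔ Alternates (q.eval x.length) q₀ k fun ws => Accepts Q P (tupleString L x ws)

/-- The constant-free class `Σ_k R⁰` (for `q₀ = ex`) or `Π_k R⁰` (for `q₀ = all`): machines
without oracle and without machine constants. Query-free programs ignore the oracle argument. -/
def constantFreeLevel (q₀ : Quant) (k : ℕ) : Set (Set (List R)) :=
  {A | ∃ P : Program L, P.QueryFree ∧ P.ConstantFree R ∧ DefinedBy L R q₀ k ∅ P A}

/-- The same class for constant-free machines with an oracle from the class `D`. -/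
def constantFreeOracleLevel (q₀ : Quant) (k : ℕ) (D : Set (Set (List R))) :
    Set (Set (List R)) :=
  {A | ∃ Q ∈ D, ∃ P : Program L, P.ConstantFree R ∧ DefinedBy L R q₀ k Q P A}

/-- The Boolean part of a problem: its strings over `{0, 1}`. -/
def booleanPart (A : Set (List R)) : Set (List R) :=
  {x | x ∈ A ∧ ∀ r ∈ x, r = zeroElt L ∨ r = oneElt L}

/-- The constant-free, non-Boolean class `Σ_k R⁰`. -/
def SigmaZero (k : ℕ) : Set (Set (List R)) := constantFreeLevel L R .ex k

/-- The class `∃_k R`, the constant-free Boolean part of `Σ_k R`. -/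
def ExistsLevel (k : ℕ) : Set (Set (List R)) :=
  booleanPart L R '' constantFreeLevel L R .ex k

/-- The class `∀_k R`, the constant-free Boolean part of `Π_k R`. -/
def ForallLevel (k : ℕ) : Set (Set (List R)) :=
  booleanPart L R '' constantFreeLevel L R .all k

/-- The oracle class `∃_k R^D`; `∃R^D` is the case `k = 1`. -/
def ExistsLevelOracle (k : ℕ) (D : Set (Set (List R))) : Set (Set (List R)) :=
  booleanPart L R '' constantFreeOracleLevel L R .ex k D

/-- The oracle class `∀_k R^D`; `∀R^D` is the case `k = 1`. -/
def ForallLevelOracle (k : ℕ) (D : Set (Set (List R))) : Set (Set (List R)) :=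
  booleanPart L R '' constantFreeOracleLevel L R .all k D

end Classes

end RMachine

set_option linter.unusedSectionVars false

/-! The equality already holds before Boolean parts are taken, for either leading quantifier: this
is `constantFreeLevel_succ`, whose two inclusions are proved by unrelated arguments.

From quantifiers to an oracle (`constantFreeLevel_succ_subset`): fix `v` and the first witness `w`.
For a leading `∃` the rest of the formula is a `Π_k` condition on the string that encodes `(v, w)`,
so its complement is a `Σ_k` problem. For a leading `∀` the rest is itself `Σ_k`. One query
therefore decides it, and the answer is negated in the first case. The obstacle is that the witness
length `q(|v|)` need not be a polynomial in the length of the query. The oracle problem therefore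
uses witnesses as long as the query, and its machine truncates them to `|w|` (`exists_truncating`).
By `Alternates.take` this does not change the truth value.

From an oracle to quantifiers (`constantFreeOracleLevel_subset_succ`): guess and check. The first
witness `y` stores `w`, and for every time `t` a guessed answer and a string `z_t`. A guess "yes" is
correct iff `∃ z ∀ … `, with `k` blocks, holds for the query at time `t`; its first witness is
`z_t`, and the other blocks start with `∀`. A guess "no" is correct iff a `Π_k` condition holds,
which starts with `∀` as well. Hence `y` followed by `k` blocks suffices. Each block is cut into
disjoint slices, one for every `t`, so the conditions for the different times are independent and
can share the blocks (`Alternates.forall_map`, `alternates_consistent`, `alternates_simulation`).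
For a leading `∀` the same formula is applied to the complement, and a wrong guess leads to
acceptance.

Both directions need explicit polynomial-time machines. They are written in a small structured
language whose loops all run `N = |x| + 2` times, so that nested loops give the bounds `N ^ d`, and
termination and polynomial time are automatic. `Stmt.compile_correct` translates the programs on one
array to machine code, `Layout.Rep.exec` reduces several arrays to one, and `exists_program`
combines the two. Machines are simulated in this language by `Slot.step`. -/

namespace RMachine

/-! ### Computations from arbitrary configurations, and their continuation past halting. -/

section Runs

variable {L : FirstOrder.Language.{u, v}} {R : Type w} [L.Structure R]

/-- The configuration after exactly `t` steps from `c`, if the computation gets that far. -/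
noncomputable def runFrom (Q : Set (List R)) (P : Program L) (c : Config R) :
    ℕ → Option (Config R)
  | 0 => some c
  | t + 1 => (runFrom Q P c t).bind (step Q P)

/-- `c'` is reached from `c` in at most `t` steps. -/
def ReachLE (Q : Set (List R)) (P : Program L) (t : ℕ) (c c' : Config R) : Prop :=
  ∃ s ≤ t, runFrom Q P c s = some c'

variable {Q : Set (List R)} {P : Program L}

theorem runFrom_add (c : Config R) (s t : ℕ) :
    runFrom Q P c (s + t) = (runFrom Q P c s).bind fun d => runFrom Q P d t := by
  induction t with
  | zero => cases h : runFrom Q P c s <;> simp [runFrom]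
  | succ t ih =>
    rw [← add_assoc, runFrom, ih, Option.bind_assoc]
    rfl

theorem ReachLE.refl (c : Config R) (t : ℕ) : ReachLE Q P t c c := ⟨0, Nat.zero_le _, rfl⟩

theorem ReachLE.trans {s t : ℕ} {c d e : Config R} (h₁ : ReachLE Q P s c d)
    (h₂ : ReachLE Q P t d e) : ReachLE Q P (s + t) c e := by
  obtain ⟨a, ha, h₁⟩ := h₁
  obtain ⟨b, hb, h₂⟩ := h₂
  exact ⟨a + b, add_le_add ha hb, by rw [runFrom_add, h₁]; exact h₂⟩

theorem ReachLE.mono {s t : ℕ} {c d : Config R} (h : ReachLE Q P s c d) (hst : s ≤ t) :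
    ReachLE Q P t c d := by
  obtain ⟨a, ha, h⟩ := h
  exact ⟨a, ha.trans hst, h⟩

theorem ReachLE.of_step {c d : Config R} (h : step Q P c = some d) : ReachLE Q P 1 c d :=
  ⟨1, le_rfl, by simpa [runFrom] using h⟩

/-- The transition function, made total by idling where it is undefined. -/
noncomputable def stay (Q : Set (List R)) (P : Program L) (c : Config R) : Config R :=
  (step Q P c).getD c

theorem step_eq_none {c : Config R} (h : c.label = P.length) : step Q P c = none := by
  simp [step, h]

theorem stay_iterate_of_runFrom {c d : Config R} {s : ℕ} (h : runFrom Q P c s = some d) :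
    (stay Q P)^[s] c = d := by
  induction s generalizing d with
  | zero => simpa [runFrom] using h
  | succ s ih =>
    rw [runFrom, Option.bind_eq_some_iff] at h
    obtain ⟨e, he, h⟩ := h
    rw [Function.iterate_succ_apply', ih he, stay, h]
    rfl

theorem stay_iterate_of_halted {c : Config R} (h : c.label = P.length) (t : ℕ) :
    (stay Q P)^[t] c = c :=
  Function.iterate_fixed (by simp [stay, step_eq_none h]) t

variable [Bipointed L R]

theorem configAfter_eq_runFrom (x : List R) (t : ℕ) :
    configAfter Q P x t = runFrom Q P (initConfig L x) t := by
  induction t with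
  | zero => rfl
  | succ t ih => rw [configAfter, runFrom, ih]

/-- A halted configuration is a fixed point of `stay`, so a simulation may run for any step budget
that exceeds the halting time, without detecting the halt. -/
theorem HaltsAt.stay_iterate {x : List R} {s t : ℕ} {c : Config R} (h : HaltsAt Q P x s c)
    (hst : s ≤ t) : (stay Q P)^[t] (initConfig L x) = c := by
  obtain ⟨r, rfl⟩ := Nat.exists_eq_add_of_le' hst
  rw [Function.iterate_add_apply,
    stay_iterate_of_runFrom ((configAfter_eq_runFrom x s).symm.trans h.1),
    stay_iterate_of_halted h.2]

theorem HaltsAt.unique {x : List R} {s t : ℕ} {c d : Config R} (h : HaltsAt Q P x s c)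
    (h' : HaltsAt Q P x t d) : c = d := by
  rw [← h.stay_iterate (le_max_left s t), h'.stay_iterate (le_max_right s t)]

theorem HaltsAt.accepts_iff {x : List R} {s : ℕ} {c : Config R} (h : HaltsAt Q P x s c) :
    Accepts Q P x ↔ c.output = [oneElt L] := by
  constructor
  · rintro ⟨t, d, hd, ho⟩
    rwa [h.unique hd]
  · exact fun ho => ⟨s, c, h, ho⟩

theorem ReachLE.haltsAt {x : List R} {t : ℕ} {c : Config R}
    (h : ReachLE Q P t (initConfig L x) c) (hc : c.label = P.length) :
    ∃ s ≤ t, HaltsAt Q P x s c := by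
  obtain ⟨s, hs, h⟩ := h
  exact ⟨s, hs, by rw [configAfter_eq_runFrom]; exact h, hc⟩

theorem zeroElt_ne_oneElt : zeroElt L (R := R) ≠ oneElt L := Bipointed.zero_ne_one

end Runs

/-! ### A structured language -/

/-- Structured programs over arrays named by `A` and index variables named by `V`. The statement
`loop S` repeats `S` a number of times that is fixed for the whole computation. -/
inductive Stmt (L : FirstOrder.Language.{u, v}) (A V : Type) : Type (max u v)
  | skip
  | const (z : A × ℕ) (b : Bool)
  | func (z : A × ℕ) {n : ℕ} (f : L.Functions (n + 1)) (j : Fin (n + 1) → A × ℕ)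
  | copy (a : A) (i : V) (b : A) (j : V)
  | incr (i : V)
  | decr (i : V)
  | seq (S T : Stmt L A V)
  | ifEq (y z : A × ℕ) (S T : Stmt L A V)
  | ifRel {n : ℕ} (P : L.Relations (n + 1)) (j : Fin (n + 1) → A × ℕ) (S T : Stmt L A V)
  | ifIdx (i j : V) (S T : Stmt L A V)
  | loop (S : Stmt L A V)

/-- The memory of a structured program. -/
@[ext]
structure Mem (A V : Type) (R : Type w) where
  arr : A → ℕ → R
  var : V → ℕ

section Exec

variable {L : FirstOrder.Language.{u, v}} {R : Type w} {A V : Type} [DecidableEq A] [DecidableEq V]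

def Mem.setVar (m : Mem A V R) (i : V) (x : ℕ) : Mem A V R :=
  ⟨m.arr, Function.update m.var i x⟩

def Mem.setCell (m : Mem A V R) (a : A) (i : ℕ) (r : R) : Mem A V R :=
  ⟨Function.update m.arr a (Function.update (m.arr a) i r), m.var⟩

variable [L.Structure R] [Bipointed L R]

variable (L) in
/-- The two distinguished elements. -/
def boolElt (b : Bool) : R := if b then oneElt L else zeroElt L

open Classical in
/-- The effect of a structured program whose loops are repeated `N` times. -/
noncomputable def Stmt.exec (N : ℕ) : Stmt L A V → Mem A V R → Mem A V R
  | .skip, m => m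
  | .const z b, m => m.setCell z.1 z.2 (boolElt L b)
  | .func z f j, m =>
      m.setCell z.1 z.2
        (FirstOrder.Language.Structure.funMap f fun i => m.arr (j i).1 (j i).2)
  | .copy a i b j, m => m.setCell a (m.var i) (m.arr b (m.var j))
  | .incr i, m => m.setVar i (m.var i + 1)
  | .decr i, m => m.setVar i (m.var i - 1)
  | .seq S T, m => T.exec N (S.exec N m)
  | .ifEq y z S T, m => if m.arr y.1 y.2 = m.arr z.1 z.2 then S.exec N m else T.exec N m
  | .ifRel P j S T, m =>
      if FirstOrder.Language.Structure.RelMap P (fun i => m.arr (j i).1 (j i).2)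
        then S.exec N m else T.exec N m
  | .ifIdx i j S T, m => if m.var i = m.var j then S.exec N m else T.exec N m
  | .loop S, m => (S.exec N)^[N] m

end Exec

/-! ### Compilation -/

section Compile

variable {L : FirstOrder.Language.{u, v}} {R : Type w} [L.Structure R] [Bipointed L R]

/-- An unconditional jump. -/
def Instr.goto (ℓ : ℕ) : Instr L := .branchIdx 1 1 ℓ ℓ

variable (R) in
/-- The constant symbols `0` and `1`. -/
def boolSym (b : Bool) : L.Constants := if b then Bipointed.oneSym R else Bipointed.zeroSym R

variable (R) in
/-- Machine code at label `o` for a structured program inside of `d` nested loops. The number of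
repetitions of loops is in `I[0]`, the register `I[1]` contains `0`, loop counters are the
registers `I[2 + 2 d]`, and variables are the registers `I[3 + 2 i]`. -/
def Stmt.compile : ℕ → ℕ → Stmt L Unit ℕ → List (Instr L)
  | _, _, .skip => []
  | _, _, .const z b => [.const z.2 (boolSym R b)]
  | _, _, .func z f j => [.func z.2 f fun i => (j i).2]
  | _, _, .copy _ i _ j => [.copy (3 + 2 * i) (3 + 2 * j)]
  | _, _, .incr i => [.incr (3 + 2 * i)]
  | _, _, .decr i => [.decr (3 + 2 * i)]
  | d, o, .seq S T =>
      let s := S.compile d o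
      s ++ T.compile d (o + s.length)
  | d, o, .ifEq y z S T =>
      let s := S.compile d (o + 1)
      let t := T.compile d (o + s.length + 2)
      .branchEq y.2 z.2 (o + 1) (o + s.length + 2) ::
        (s ++ .goto (o + s.length + 2 + t.length) :: t)
  | d, o, .ifRel P j S T =>
      let s := S.compile d (o + 1)
      let t := T.compile d (o + s.length + 2)
      .branchRel P (fun i => (j i).2) (o + 1) (o + s.length + 2) ::
        (s ++ .goto (o + s.length + 2 + t.length) :: t)
  | d, o, .ifIdx i j S T =>
      let s := S.compile d (o + 1)
      let t := T.compile d (o + s.length + 2)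
      .branchIdx (3 + 2 * i) (3 + 2 * j) (o + 1) (o + s.length + 2) ::
        (s ++ .goto (o + s.length + 2 + t.length) :: t)
  | d, o, .loop S =>
      let s := S.compile (d + 1) (o + 1)
      .branchIdx (2 + 2 * d) 0 (o + s.length + 3) (o + 1) ::
        (s ++ [.incr (2 + 2 * d), .goto o,
          .branchIdx (2 + 2 * d) 1 (o + s.length + 6) (o + s.length + 4),
          .decr (2 + 2 * d), .goto (o + s.length + 3)])

/-- A bound on the number of steps of the machine code, as a function of the number of
repetitions of loops. -/
noncomputable def Stmt.cost {A V : Type} : Stmt L A V → Polynomial ℕ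
  | .skip => 0
  | .seq S T => S.cost + T.cost
  | .ifEq _ _ S T => S.cost + T.cost + 2
  | .ifRel _ _ S T => S.cost + T.cost + 2
  | .ifIdx _ _ S T => S.cost + T.cost + 2
  | .loop S => Polynomial.X * (S.cost + 3) + (3 * Polynomial.X + 2)
  | _ => 1

/-- The code `s` stands at label `o` of the program `P`. -/
def CodeAt (P : Program L) (o : ℕ) (s : List (Instr L)) : Prop :=
  ∀ i (h : i < s.length), P[o + i]? = some s[i]

theorem CodeAt.head {P : Program L} {o : ℕ} {a : Instr L} {s : List (Instr L)}
    (h : CodeAt P o (a :: s)) : P[o]? = some a :=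
  h 0 (by simp)

theorem CodeAt.tail {P : Program L} {o : ℕ} {a : Instr L} {s : List (Instr L)}
    (h : CodeAt P o (a :: s)) : CodeAt P (o + 1) s := by
  intro i hi
  have := h (i + 1) (by simpa using hi)
  simpa [add_assoc, add_comm 1 i] using this

theorem CodeAt.left {P : Program L} {o : ℕ} {s t : List (Instr L)}
    (h : CodeAt P o (s ++ t)) : CodeAt P o s := by
  intro i hi
  have := h i (by simp; omega)
  rwa [List.getElem_append_left hi] at this

theorem CodeAt.right {P : Program L} {o : ℕ} {s t : List (Instr L)}
    (h : CodeAt P o (s ++ t)) : CodeAt P (o + s.length) t := by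
  intro i hi
  have := h (s.length + i) (by simp; omega)
  rw [List.getElem_append_right (by omega)] at this
  simpa [add_assoc] using this

/-- The index registers of the machine that executes a structured program. -/
def machineIdx (N : ℕ) (cnt var : ℕ → ℕ) (r : ℕ) : ℕ :=
  if r = 0 then N else if r = 1 then 0 else if r % 2 = 0 then cnt (r / 2 - 1) else var (r / 2 - 1)

theorem machineIdx_zero (N : ℕ) (cnt var : ℕ → ℕ) : machineIdx N cnt var 0 = N := rfl

theorem machineIdx_one (N : ℕ) (cnt var : ℕ → ℕ) : machineIdx N cnt var 1 = 0 := rfl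

theorem machineIdx_cnt (N : ℕ) (cnt var : ℕ → ℕ) (d : ℕ) :
    machineIdx N cnt var (2 + 2 * d) = cnt d := by
  rw [machineIdx, if_neg (by omega), if_neg (by omega), if_pos (by omega)]
  congr 1
  omega

theorem machineIdx_var (N : ℕ) (cnt var : ℕ → ℕ) (i : ℕ) :
    machineIdx N cnt var (3 + 2 * i) = var i := by
  rw [machineIdx, if_neg (by omega), if_neg (by omega), if_neg (by omega)]
  congr 1
  omega

theorem machineIdx_update_cnt (N : ℕ) (cnt var : ℕ → ℕ) (d x : ℕ) :
    Function.update (machineIdx N cnt var) (2 + 2 * d) x =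
      machineIdx N (Function.update cnt d x) var := by
  funext r
  simp only [Function.update_apply, machineIdx]
  split_ifs <;> first | rfl | omega

theorem machineIdx_update_var (N : ℕ) (cnt var : ℕ → ℕ) (i x : ℕ) :
    Function.update (machineIdx N cnt var) (3 + 2 * i) x =
      machineIdx N cnt (Function.update var i x) := by
  funext r
  simp only [Function.update_apply, machineIdx]
  split_ifs <;> first | rfl | omega

/-- The configuration of the machine that executes a structured program. -/
def machineConfig (o N : ℕ) (cnt : ℕ → ℕ) (m : Mem Unit ℕ R) : Config R :=
  ⟨o, machineIdx N cnt m.var, m.arr ()⟩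

omit [Bipointed L R] in
theorem step_of_getElem? {Q : Set (List R)} {P : Program L} {c : Config R} {a : Instr L}
    (h : P[c.label]? = some a) : step Q P c = some (a.exec Q c) := by
  simp [step, h]

omit [Bipointed L R] in
theorem ReachLE.of_instr {Q : Set (List R)} {P : Program L} {c c' : Config R} {a : Instr L}
    (h : P[c.label]? = some a) (h' : a.exec Q c = c') : ReachLE Q P 1 c c' :=
  .of_step (by rw [step_of_getElem? h, h'])

omit [Bipointed L R] in
theorem ReachLE.goto {Q : Set (List R)} {P : Program L} {N : ℕ} {cnt : ℕ → ℕ}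
    {m : Mem Unit ℕ R} {o ℓ : ℕ} (h : P[o]? = some (.goto ℓ)) :
    ReachLE Q P 1 (machineConfig o N cnt m) (machineConfig ℓ N cnt m) :=
  .of_instr h (by simp [Instr.goto, Instr.exec, machineConfig])

omit [Bipointed L R] in
/-- The code that decreases an index register to `0`. -/
theorem ReachLE.countdown {Q : Set (List R)} {P : Program L} {j o : ℕ} {reg : ℕ → R}
    (hj : j ≠ 1) (h : CodeAt P o [.branchIdx j 1 (o + 3) (o + 1), .decr j, .goto o]) (x : ℕ)
    (idx : ℕ → ℕ) (hx : idx j = x) (h₁ : idx 1 = 0) :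
    ReachLE Q P (3 * x + 1) ⟨o, idx, reg⟩ ⟨o + 3, Function.update idx j 0, reg⟩ := by
  induction x generalizing idx with
  | zero =>
    refine .of_instr h.head ?_
    simp only [Instr.exec, hx, h₁, if_true, Config.mk.injEq, true_and, and_true]
    exact (Function.update_eq_self_iff.2 hx.symm).symm
  | succ x ih =>
    have a₁ : ReachLE Q P 1 ⟨o, idx, reg⟩ ⟨o + 1, idx, reg⟩ :=
      .of_instr h.head (by simp [Instr.exec, hx, h₁])
    have a₂ : ReachLE Q P 1 ⟨o + 1, idx, reg⟩ ⟨o + 2, Function.update idx j x, reg⟩ :=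
      .of_instr h.tail.head (by simp [Instr.exec, hx])
    have a₃ : ReachLE Q P 1 ⟨o + 2, Function.update idx j x, reg⟩
        ⟨o, Function.update idx j x, reg⟩ :=
      .of_instr h.tail.tail.head (by simp [Instr.exec, Instr.goto])
    have a₄ := ih (Function.update idx j x) (by simp) (by rwa [Function.update_of_ne hj.symm])
    rw [Function.update_idem] at a₄
    exact (((a₁.trans a₂).trans a₃).trans a₄).mono (by omega)

theorem constantMap_boolSym (b : Bool) :
    (FirstOrder.Language.constantMap (boolSym (L := L) R b) : R) = boolElt L b := by
  cases b <;> rfl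

theorem update_unit (f : Unit → ℕ → R) (g : ℕ → R) : Function.update f () g = fun _ => g := by
  funext a; simp [Function.update]

-- The three conditionals compile to the same layout: a test, the first branch, a jump over the
-- second branch, the second branch. Only the test `i` and its proposition `p` differ.
omit [Bipointed L R] in
theorem ReachLE.branch {Q : Set (List R)} {P : Program L} {N a b o : ℕ} {cnt : ℕ → ℕ}
    {m m₁ m₂ : Mem Unit ℕ R} {i : Instr L} {s t : List (Instr L)} {p : Prop} [Decidable p]
    (h : CodeAt P o (i :: (s ++ .goto (o + s.length + 2 + t.length) :: t)))
    (hi : i.exec Q (machineConfig o N cnt m) =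
      machineConfig (if p then o + 1 else o + s.length + 2) N cnt m)
    (hs : CodeAt P (o + 1) s →
      ReachLE Q P a (machineConfig (o + 1) N cnt m) (machineConfig (o + 1 + s.length) N cnt m₁))
    (ht : CodeAt P (o + s.length + 2) t →
      ReachLE Q P b (machineConfig (o + s.length + 2) N cnt m)
        (machineConfig (o + s.length + 2 + t.length) N cnt m₂)) :
    ReachLE Q P (a + b + 2) (machineConfig o N cnt m)
      (machineConfig (o + (i :: (s ++ Instr.goto (o + s.length + 2 + t.length) :: t)).length) N cnt
        (if p then m₁ else m₂)) := by
  have e : o + (i :: (s ++ Instr.goto (o + s.length + 2 + t.length) :: t)).length =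
      o + s.length + 2 + t.length := by
    simp; ring
  have a₁ := ReachLE.of_instr (Q := Q) (c := machineConfig o N cnt m) h.head hi
  have hT := h.tail.right.tail
  rw [show o + 1 + s.length + 1 = o + s.length + 2 by ring] at hT
  rw [e]
  by_cases hp : p
  · rw [if_pos hp] at a₁ ⊢
    exact ((a₁.trans (hs h.tail.left)).trans (.goto h.tail.right.head)).mono (by omega)
  · rw [if_neg hp] at a₁ ⊢
    exact (a₁.trans (ht hT)).mono (by omega)

-- Induction on the statement. The loop counters of depth `d` and beyond must be zero on entry. As
-- `cnt` reappears unchanged in the conclusion, they are zero again on exit, so a loop can be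
-- entered repeatedly from an outer loop. The time bound depends on `N` only.
open Classical in
theorem Stmt.compile_correct {Q : Set (List R)} {P : Program L} {N : ℕ} (S : Stmt L Unit ℕ) :
    ∀ (d o : ℕ) (cnt : ℕ → ℕ) (m : Mem Unit ℕ R), (∀ i, d ≤ i → cnt i = 0) →
      CodeAt P o (S.compile R d o) →
      ReachLE Q P (S.cost.eval N) (machineConfig o N cnt m)
        (machineConfig (o + (S.compile R d o).length) N cnt (S.exec N m)) := by
  induction S with
  | skip => exact fun d o cnt m _ _ => .refl _ _
  | const z b =>
    intro d o cnt m _ h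
    simp only [Stmt.cost, Polynomial.eval_one]
    refine .of_instr h.head ?_
    simp [Instr.exec, machineConfig, Stmt.exec, Stmt.compile, Mem.setCell,
      constantMap_boolSym]
  | func z f j =>
    intro d o cnt m _ h
    simp only [Stmt.cost, Polynomial.eval_one]
    refine .of_instr h.head ?_
    simp [Instr.exec, machineConfig, Stmt.exec, Stmt.compile, Mem.setCell]
  | copy a i b j =>
    intro d o cnt m _ h
    simp only [Stmt.cost, Polynomial.eval_one]
    refine .of_instr h.head ?_
    simp [Instr.exec, machineConfig, Stmt.exec, Stmt.compile, Mem.setCell,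
      machineIdx_var]
  | incr i =>
    intro d o cnt m _ h
    simp only [Stmt.cost, Polynomial.eval_one]
    refine .of_instr h.head ?_
    simp [Instr.exec, machineConfig, Stmt.exec, Stmt.compile, Mem.setVar,
      machineIdx_var, machineIdx_update_var]
  | decr i =>
    intro d o cnt m _ h
    simp only [Stmt.cost, Polynomial.eval_one]
    refine .of_instr h.head ?_
    simp [Instr.exec, machineConfig, Stmt.exec, Stmt.compile, Mem.setVar,
      machineIdx_var, machineIdx_update_var]
  | seq S T ihS ihT =>
    intro d o cnt m hc h
    have a := (ihS d o cnt m hc h.left).trans (ihT d _ cnt _ hc h.right)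
    simpa [Stmt.cost, Stmt.compile, Stmt.exec, add_assoc] using a
  | ifEq y z S T ihS ihT =>
    intro d o cnt m hc h
    have a := ReachLE.branch h (p := m.arr y.1 y.2 = m.arr z.1 z.2) (hi := rfl)
      (ihS d _ cnt m hc) (ihT d _ cnt m hc)
    simpa [Stmt.cost, Stmt.exec, Stmt.compile] using a
  | ifRel A j S T ihS ihT =>
    intro d o cnt m hc h
    have a := ReachLE.branch h
      (p := FirstOrder.Language.Structure.RelMap A fun i => m.arr (j i).1 (j i).2) (hi := rfl)
      (ihS d _ cnt m hc) (ihT d _ cnt m hc)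
    simpa [Stmt.cost, Stmt.exec, Stmt.compile] using a
  | ifIdx i j S T ihS ihT =>
    intro d o cnt m hc h
    have a := ReachLE.branch h (p := m.var i = m.var j)
      (by simp only [Instr.exec, machineConfig, machineIdx_var]) (ihS d _ cnt m hc)
      (ihT d _ cnt m hc)
    simpa [Stmt.cost, Stmt.exec, Stmt.compile] using a
  | loop S ih =>
    intro d o cnt m hc h
    have hS := h.tail.left
    have hr := h.tail.right
    set s := S.compile R (d + 1) (o + 1) with hs
    have hr' : CodeAt P (o + s.length + 3)
        [.branchIdx (2 + 2 * d) 1 (o + s.length + 6) (o + s.length + 4), .decr (2 + 2 * d),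
          .goto (o + s.length + 3)] := by
      have := hr.tail.tail
      rwa [show o + 1 + s.length + 1 + 1 = o + s.length + 3 by ring] at this
    -- Loop invariant: after `x` rounds the counter of depth `d` contains `x`. Three instructions
    -- per round are overhead: the test, the increment and the jump back.
    have body : ∀ x ≤ N, ReachLE Q P (x * (S.cost.eval N + 3)) (machineConfig o N cnt m)
        (machineConfig o N (Function.update cnt d x) ((S.exec N)^[x] m)) := by
      intro x
      induction x with
      | zero =>
        intro _
        rw [(Function.update_eq_self_iff (f := cnt)).2 (hc d le_rfl).symm]
        exact .refl _ _
      | succ x ihx =>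
        intro hx
        refine ((ihx (by omega)).trans (t := S.cost.eval N + 3) ?_).mono (by linarith)
        set c' := Function.update cnt d x with hc'
        set m' := (S.exec N)^[x] m with hm'
        have a₁ : ReachLE Q P 1 (machineConfig o N c' m') (machineConfig (o + 1) N c' m') := by
          refine .of_instr h.head ?_
          simp only [Instr.exec, machineConfig, machineIdx_cnt, machineIdx_zero]
          rw [if_neg (by simp [hc']; omega)]
        have a₂ := ih (d + 1) (o + 1) c' m'
          (fun i hi => by rw [hc', Function.update_of_ne (by omega)]; exact hc i (by omega)) hS
        have a₃ : ReachLE Q P 1 (machineConfig (o + 1 + s.length) N c' (S.exec N m'))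
            (machineConfig (o + 1 + s.length + 1) N (Function.update cnt d (x + 1))
              (S.exec N m')) := by
          refine .of_instr hr.head ?_
          simp [Instr.exec, machineConfig, machineIdx_cnt, machineIdx_update_cnt, hc']
        rw [Function.iterate_succ_apply', ← hm']
        exact (((a₁.trans a₂).trans a₃).trans (.goto hr.tail.head)).mono (by omega)
    have a₁ := body N le_rfl
    have a₂ : ReachLE Q P 1
        (machineConfig o N (Function.update cnt d N) ((S.exec N)^[N] m))
        (machineConfig (o + s.length + 3) N (Function.update cnt d N) ((S.exec N)^[N] m)) := by
      refine .of_instr h.head ?_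
      simp [Instr.exec, machineConfig, machineIdx_cnt, machineIdx_zero, hs]
    have a₃ := ReachLE.countdown (Q := Q) (reg := ((S.exec N)^[N] m).arr ()) (by omega) hr' N
      (machineIdx N (Function.update cnt d N) ((S.exec N)^[N] m).var)
      (by simp [machineIdx_cnt]) (machineIdx_one _ _ _)
    rw [machineIdx_update_cnt, Function.update_idem, (Function.update_eq_self_iff
      (f := cnt)).2 (hc d le_rfl).symm] at a₃
    have a := (a₁.trans a₂).trans a₃
    have e : o + (Stmt.compile R d o (.loop S)).length = o + s.length + 3 + 3 := by
      simp [Stmt.compile, hs]; ring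
    rw [e]
    exact a.mono (by simp [Stmt.cost]; omega)

/-! ### Deciding a problem by a structured program on a single array -/

variable (R) in
/-- A machine that executes a structured program: it initializes the number of repetitions of loops
by the length of the input plus `2`, and outputs one symbol. -/
def Stmt.toProgram (S : Stmt L Unit ℕ) : Program L :=
  let s := S.compile R 0 2
  [.incr 0, .incr 0] ++ (s ++ [.branchIdx 0 1 (2 + s.length + 3) (2 + s.length + 1), .decr 0,
    .goto (2 + s.length), .incr 0])

theorem codeAt_zero (s : List (Instr L)) : CodeAt s 0 s := by
  intro i hi
  simp [hi]

/-- The memory at the start of the computation on `x`: the array `a` contains `x`, and everything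
else is zero. -/
def initMem {A V : Type} [DecidableEq A] (L : FirstOrder.Language.{u, v}) [L.Structure R]
    [Bipointed L R] (a : A) (x : List R) : Mem A V R :=
  ⟨fun b i => if b = a then x.getD i (zeroElt L) else zeroElt L, fun _ => 0⟩

theorem Stmt.toProgram_reach (S : Stmt L Unit ℕ) (Q : Set (List R)) (x : List R) :
    ReachLE Q (S.toProgram R) ((S.cost + 3 * Polynomial.X + 4).eval (x.length + 2))
      (initConfig L x) ⟨(S.toProgram R).length,
        Function.update (machineIdx 0 0 (S.exec (x.length + 2) (initMem L () x)).var) 0 1,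
        (S.exec (x.length + 2) (initMem L () x)).arr ()⟩ := by
  set N := x.length + 2 with hN
  set s := S.compile R 0 2 with hs
  set m : Mem Unit ℕ R := initMem L () x with hm
  have h₀ : CodeAt (S.toProgram R) 0 _ := codeAt_zero _
  have h₁ := h₀.left
  have h₂ := h₀.right
  have h₃ : CodeAt (S.toProgram R) (2 + s.length)
      [.branchIdx 0 1 (2 + s.length + 3) (2 + s.length + 1), .decr 0, .goto (2 + s.length),
        .incr 0] := by
    convert h₂.right using 1
    simp [hs]
  have hl : (S.toProgram R).length = s.length + 6 := by
    simp [Stmt.toProgram, hs]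
  have a₁ : ReachLE Q (S.toProgram R) 1 (initConfig L x)
      ⟨1, machineIdx (x.length + 1) 0 0, m.arr ()⟩ := by
    refine .of_instr h₁.head ?_
    simp only [Instr.exec, initConfig, hm, initMem, Config.mk.injEq, if_true, and_true, true_and]
    funext r
    simp only [Function.update_apply, machineIdx]
    split_ifs <;> rfl
  have a₂ : ReachLE Q (S.toProgram R) 1 ⟨1, machineIdx (x.length + 1) 0 0, m.arr ()⟩
      (machineConfig 2 N 0 m) := by
    refine .of_instr h₁.tail.head ?_
    simp only [Instr.exec, machineConfig, Config.mk.injEq, and_true, true_and]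
    funext r
    simp only [Function.update_apply, machineIdx]
    split_ifs <;> rfl
  have a₃ := S.compile_correct (Q := Q) (N := N) 0 2 0 m (fun _ _ => rfl) h₂.left
  have a₄ := ReachLE.countdown (Q := Q) (P := S.toProgram R) (j := 0) (o := 2 + s.length)
    (reg := (S.exec N m).arr ()) (by omega) (CodeAt.left (t := [.incr 0]) h₃) N
      (machineIdx N 0 (S.exec N m).var) rfl rfl
  have a₅ : ReachLE Q (S.toProgram R) 1
      ⟨2 + s.length + 3, Function.update (machineIdx N 0 (S.exec N m).var) 0 0,
        (S.exec N m).arr ()⟩ ⟨(S.toProgram R).length,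
        Function.update (machineIdx 0 0 (S.exec N m).var) 0 1, (S.exec N m).arr ()⟩ := by
    refine .of_instr h₃.tail.tail.tail.head ?_
    simp only [Instr.exec, Config.mk.injEq, and_true]
    refine ⟨by rw [hl]; ring, ?_⟩
    funext r
    simp only [Function.update_apply, machineIdx]
    split_ifs <;> simp
  refine ((((a₁.trans a₂).trans a₃).trans a₄).trans a₅).mono ?_
  simp
  omega

theorem Stmt.compile_queryFree (S : Stmt L Unit ℕ) (ℓ₁ ℓ₂ : ℕ) :
    ∀ d o, Instr.query ℓ₁ ℓ₂ ∉ S.compile R d o := by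
  induction S <;> intro d o <;> simp_all [Stmt.compile, Instr.goto]

theorem Stmt.compile_constantFree (S : Stmt L Unit ℕ) (j : ℕ) (c : L.Constants) :
    ∀ d o, Instr.const j c ∈ S.compile R d o →
      c = Bipointed.zeroSym R ∨ c = Bipointed.oneSym R := by
  induction S with
  | const z b => cases b <;> simp +contextual [Stmt.compile, boolSym]
  | seq S T ihS ihT =>
    intro d o h
    simp only [Stmt.compile, List.mem_append] at h
    exact h.elim (ihS _ _) (ihT _ _)
  | ifEq y z S T ihS ihT =>
    intro d o h
    simp only [Stmt.compile, Instr.goto, List.mem_cons, List.mem_append, reduceCtorEq, false_or] at h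
    exact h.elim (ihS _ _) (ihT _ _)
  | ifRel A z S T ihS ihT =>
    intro d o h
    simp only [Stmt.compile, Instr.goto, List.mem_cons, List.mem_append, reduceCtorEq, false_or] at h
    exact h.elim (ihS _ _) (ihT _ _)
  | ifIdx y z S T ihS ihT =>
    intro d o h
    simp only [Stmt.compile, Instr.goto, List.mem_cons, List.mem_append, reduceCtorEq, false_or] at h
    exact h.elim (ihS _ _) (ihT _ _)
  | loop S ih =>
    intro d o h
    simp only [Stmt.compile, Instr.goto, List.mem_cons, List.mem_append, reduceCtorEq, false_or,
      List.not_mem_nil, or_false] at h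
    exact ih _ _ h
  | _ => simp [Stmt.compile]

theorem output_eq_singleton {idx : ℕ → ℕ} {reg : ℕ → R} {ℓ : ℕ} {r : R} (h : idx 0 = 1) :
    (Config.output ⟨ℓ, idx, reg⟩ = [r]) ↔ reg 0 = r := by
  have : Config.output ⟨ℓ, idx, reg⟩ = List.ofFn fun i : Fin 1 => reg i := by
    unfold Config.output
    exact List.ofFn_congr h _
  simp [this]

/-- A problem that is decided by a structured program is decided in polynomial time by a
constant-free machine without oracle. -/
theorem Stmt.exists_program (S : Stmt L Unit ℕ) :
    ∃ P : Program L, P.QueryFree ∧ P.ConstantFree R ∧ PolyTime (R := R) ∅ P ∧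
      ∀ x : List R, Accepts ∅ P x ↔
        (S.exec (x.length + 2) (initMem L () x)).arr () 0 = oneElt L := by
  refine ⟨S.toProgram R, ?_, ?_, ⟨(S.cost + 3 * Polynomial.X + 4).comp (Polynomial.X + 2), ?_⟩, ?_⟩
  · intro ℓ₁ ℓ₂
    simp [Stmt.toProgram, Instr.goto, S.compile_queryFree]
  · intro j c h
    simp only [Stmt.toProgram, Instr.goto, List.mem_append, List.mem_cons, reduceCtorEq, false_or,
      or_false, List.not_mem_nil] at h
    exact S.compile_constantFree j c _ _ h
  · intro x
    obtain ⟨t, ht, h⟩ := (S.toProgram_reach ∅ x).haltsAt rfl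
    exact ⟨t, by simpa using ht, _, h⟩
  · intro x
    obtain ⟨t, ht, h⟩ := (S.toProgram_reach ∅ x).haltsAt rfl
    rw [h.accepts_iff, output_eq_singleton (by simp)]

end Compile

/-! ### Fixed repetitions of statements, and rules for updating variables. -/

section Times

variable {L : FirstOrder.Language.{u, v}} {R : Type w} {A V : Type} [DecidableEq A] [DecidableEq V]

/-- The sequence of the statements of a list. -/
def Stmt.seqs : List (Stmt L A V) → Stmt L A V
  | [] => .skip
  | S :: l => .seq S (seqs l)

/-- A statement repeated `n` times. -/
def Stmt.times : ℕ → Stmt L A V → Stmt L A V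
  | 0, _ => .skip
  | n + 1, S => .seq S (times n S)

theorem Mem.setVar_setVar (m : Mem A V R) (i : V) (x y : ℕ) :
    (m.setVar i x).setVar i y = m.setVar i y := by
  simp [Mem.setVar]

theorem Mem.setVar_var (m : Mem A V R) (i : V) : m.setVar i (m.var i) = m := by
  simp [Mem.setVar]

theorem Mem.setVar_var_self (m : Mem A V R) (i : V) (x : ℕ) : (m.setVar i x).var i = x := by
  simp [Mem.setVar]

theorem Mem.setVar_var_of_ne (m : Mem A V R) {i j : V} (h : j ≠ i) (x : ℕ) :
    (m.setVar i x).var j = m.var j := by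
  simp [Mem.setVar, h]

theorem Mem.setVar_comm (m : Mem A V R) {i j : V} (h : i ≠ j) (x y : ℕ) :
    (m.setVar i x).setVar j y = (m.setVar j y).setVar i x := by
  simp only [Mem.setVar, Function.update_comm h]

variable [L.Structure R] [Bipointed L R] {N : ℕ}

theorem Stmt.exec_ifEq_pos {y z : A × ℕ} {m : Mem A V R} (h : m.arr y.1 y.2 = m.arr z.1 z.2)
    (S T : Stmt L A V) : (Stmt.ifEq y z S T).exec N m = S.exec N m := by
  simp only [exec]
  rw [if_pos h]

theorem Stmt.exec_ifEq_neg {y z : A × ℕ} {m : Mem A V R} (h : m.arr y.1 y.2 ≠ m.arr z.1 z.2)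
    (S T : Stmt L A V) : (Stmt.ifEq y z S T).exec N m = T.exec N m := by
  simp only [exec]
  rw [if_neg h]

theorem Stmt.exec_times (n : ℕ) (S : Stmt L A V) (m : Mem A V R) :
    (Stmt.times n S).exec N m = (S.exec N)^[n] m := by
  induction n generalizing m with
  | zero => rfl
  | succ n ih => rw [times, exec, ih, Function.iterate_succ_apply]

theorem Stmt.exec_times_incr (n : ℕ) (i : V) (m : Mem A V R) :
    (Stmt.times n (.incr i : Stmt L A V)).exec N m = m.setVar i (m.var i + n) := by
  induction n generalizing m with
  | zero => simp [times, exec, Mem.setVar_var]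
  | succ n ih =>
    rw [times, exec, ih]
    simp only [exec, Mem.setVar_setVar, Mem.setVar_var_self]
    congr 1
    omega

theorem Stmt.exec_times_decr (n : ℕ) (i : V) (m : Mem A V R) :
    (Stmt.times n (.decr i : Stmt L A V)).exec N m = m.setVar i (m.var i - n) := by
  induction n generalizing m with
  | zero => simp [times, exec, Mem.setVar_var]
  | succ n ih =>
    rw [times, exec, ih]
    simp only [exec, Mem.setVar_setVar, Mem.setVar_var_self]
    congr 1
    omega

end Times

/-! ### Several arrays interleaved in one register sequence. -/

/-- An embedding of several arrays into one array, and of named variables into numbered ones. -/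
structure Layout (A V : Type) where
  stride : ℕ
  stride_pos : 0 < stride
  slot : A → ℕ
  slot_injective : Function.Injective slot
  slot_lt : ∀ a, slot a < stride
  name : V → ℕ
  name_injective : Function.Injective name

namespace Layout

theorem nonempty (A V : Type) [Finite A] [Countable V] : Nonempty (Layout A V) := by
  obtain ⟨n, ⟨e⟩⟩ := Finite.exists_equiv_fin A
  obtain ⟨f, hf⟩ := exists_injective_nat V
  exact ⟨⟨n + 1, n.succ_pos, fun a => e a, fun a b h => e.injective (Fin.ext h),
    fun a => (e a).2.trans n.lt_succ_self, f, hf⟩⟩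

variable {L : FirstOrder.Language.{u, v}} {R : Type w} {A V : Type} [DecidableEq A] [DecidableEq V]
  (Λ : Layout A V)

/-- The position of a cell; position `0` is kept for temporary storage. -/
def pos (a : A) (i : ℕ) : ℕ := Λ.stride * i + (1 + Λ.slot a)

/-- The number of a variable; the variable `0` is always zero. -/
def num (x : V) : ℕ := Λ.name x + 4

/-- Slots are smaller than the stride, so slot and index are remainder and quotient of a division by
the stride. -/
theorem pos_inj {a b : A} {i j : ℕ} : Λ.pos a i = Λ.pos b j ↔ a = b ∧ i = j := by
  constructor
  · intro h
    have ha := Λ.slot_lt a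
    have hb := Λ.slot_lt b
    have h' : Λ.stride * i + Λ.slot a = Λ.stride * j + Λ.slot b := by
      unfold pos at h; omega
    have h₁ := congrArg (· / Λ.stride) h'
    have h₂ := congrArg (· % Λ.stride) h'
    have hs : 0 < Λ.stride := by omega
    simp only [Nat.mul_add_div hs, Nat.div_eq_of_lt ha, Nat.div_eq_of_lt hb, Nat.mul_add_mod,
      Nat.mod_eq_of_lt ha, Nat.mod_eq_of_lt hb, add_zero] at h₁ h₂
    exact ⟨Λ.slot_injective h₂, h₁⟩
  · rintro ⟨rfl, rfl⟩
    rfl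

theorem num_inj {x y : V} : Λ.num x = Λ.num y ↔ x = y := by
  simp [num, Λ.name_injective.eq_iff]

/-- The translation of programs on several arrays. -/
def trans : Stmt L A V → Stmt L Unit ℕ
  | .skip => .skip
  | .const z b => .const ((), Λ.pos z.1 z.2) b
  | .func z f j => .func ((), Λ.pos z.1 z.2) f fun i => ((), Λ.pos (j i).1 (j i).2)
  | .copy a i b j => .seqs
      [.times (1 + Λ.slot b) (.incr (Λ.num j)), .copy () 0 () (Λ.num j),
        .times (1 + Λ.slot b) (.decr (Λ.num j)), .times (1 + Λ.slot a) (.incr (Λ.num i)),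
        .copy () (Λ.num i) () 0, .times (1 + Λ.slot a) (.decr (Λ.num i))]
  | .incr i => .times Λ.stride (.incr (Λ.num i))
  | .decr i => .times Λ.stride (.decr (Λ.num i))
  | .seq S T => .seq (trans S) (trans T)
  | .ifEq y z S T => .ifEq ((), Λ.pos y.1 y.2) ((), Λ.pos z.1 z.2) (trans S) (trans T)
  | .ifRel P j S T => .ifRel P (fun i => ((), Λ.pos (j i).1 (j i).2)) (trans S) (trans T)
  | .ifIdx i j S T => .ifIdx (Λ.num i) (Λ.num j) (trans S) (trans T)
  | .loop S => .loop (trans S)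

/-- The memory `σ` represents the memory `m`. -/
structure Rep (σ : Mem Unit ℕ R) (m : Mem A V R) : Prop where
  arr : ∀ a i, σ.arr () (Λ.pos a i) = m.arr a i
  var : ∀ x, σ.var (Λ.num x) = Λ.stride * m.var x
  zero : σ.var 0 = 0

variable {Λ}

theorem Rep.setCell {σ : Mem Unit ℕ R} {m : Mem A V R} (h : Λ.Rep σ m) (a : A) (i : ℕ) (r : R) :
    Λ.Rep (σ.setCell () (Λ.pos a i) r) (m.setCell a i r) where
  arr b j := by
    have := h.arr b j
    simp only [Mem.setCell, update_unit, Function.update_apply, Λ.pos_inj]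
    by_cases hb : b = a
    · subst hb
      simp [Function.update_apply, this]
    · simp [hb, this]
  var := h.var
  zero := h.zero

theorem Rep.setVar {σ : Mem Unit ℕ R} {m : Mem A V R} (h : Λ.Rep σ m) (x : V) (y : ℕ) :
    Λ.Rep (σ.setVar (Λ.num x) (Λ.stride * y)) (m.setVar x y) where
  arr := h.arr
  var z := by
    simp only [Mem.setVar, Function.update_apply, Λ.num_inj]
    split_ifs
    · rfl
    · exact h.var z
  zero := by simpa [Mem.setVar, num] using h.zero

theorem Rep.setCell_zero {σ : Mem Unit ℕ R} {m : Mem A V R} (h : Λ.Rep σ m) (r : R) :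
    Λ.Rep (σ.setCell () 0 r) m where
  arr b j := by
    simp only [Mem.setCell, update_unit]
    rw [Function.update_of_ne (by unfold pos; omega)]
    exact h.arr b j
  var := h.var
  zero := h.zero

variable [L.Structure R] [Bipointed L R]

/-- Variables are stored multiplied by the stride. This scaling preserves equality tests since the
stride is positive, and commutes with truncated decrement. An access to the array `a` only has to
add `1 + slot a` to a variable temporarily. -/
theorem Rep.exec {N : ℕ} (S : Stmt L A V) :
    ∀ {σ : Mem Unit ℕ R} {m : Mem A V R}, Λ.Rep σ m →
      Λ.Rep ((Λ.trans S).exec N σ) (S.exec N m) := by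
  induction S with
  | skip => exact fun h => h
  | const z b => exact fun h => h.setCell _ _ _
  | func z f j =>
    intro σ m h
    simp only [trans, Stmt.exec, h.arr]
    exact h.setCell _ _ _
  | copy a i b j =>
    intro σ m h
    simp only [trans, Stmt.exec, Stmt.seqs, Stmt.exec_times_incr, Stmt.exec_times_decr]
    -- Two displaced pointers cannot be used at once if `i = j`, so the symbol travels through the
    -- free position `0`.
    have h₁ : Λ.Rep (σ.setCell () 0 (m.arr b (m.var j))) m := h.setCell_zero _
    have h₂ := h₁.setCell a (m.var i) (m.arr b (m.var j))
    convert h₂ using 1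
    have e₁ : σ.var (Λ.num j) + (1 + Λ.slot b) = Λ.pos b (m.var j) := by rw [h.var]; rfl
    have e₂ : σ.var (Λ.num i) + (1 + Λ.slot a) = Λ.pos a (m.var i) := by rw [h.var]; rfl
    have hz : ∀ x, Λ.num x ≠ 0 := fun x => by simp [num]
    have e₃ : Λ.pos b (m.var j) - (1 + Λ.slot b) = σ.var (Λ.num j) := by omega
    have e₄ : Λ.pos a (m.var i) - (1 + Λ.slot a) = σ.var (Λ.num i) := by omega
    simp only [Mem.setCell, Mem.setVar, update_unit, Function.update_self, Function.update_idem,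
      Function.update_eq_self, e₁, e₂, e₃, e₄, h.arr, h.zero,
      Function.update_of_ne (hz _).symm]
  | incr i =>
    intro σ m h
    simp only [trans, Stmt.exec, Stmt.exec_times_incr, h.var]
    exact h.setVar i (m.var i + 1)
  | decr i =>
    intro σ m h
    simp only [trans, Stmt.exec, Stmt.exec_times_decr, h.var]
    convert h.setVar i (m.var i - 1) using 2
    rw [Nat.mul_sub, mul_one]
  | seq S T ihS ihT => exact fun h => ihT (ihS h)
  | ifEq y z S T ihS ihT =>
    intro σ m h
    simp only [trans, Stmt.exec]
    by_cases e : m.arr y.1 y.2 = m.arr z.1 z.2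
    · rw [if_pos e, if_pos (by rwa [h.arr, h.arr])]
      exact ihS h
    · rw [if_neg e, if_neg (by rwa [h.arr, h.arr])]
      exact ihT h
  | ifRel P j S T ihS ihT =>
    intro σ m h
    simp only [trans, Stmt.exec]
    by_cases e : FirstOrder.Language.Structure.RelMap P fun i => m.arr (j i).1 (j i).2
    · rw [if_pos e, if_pos (by simpa only [h.arr] using e)]
      exact ihS h
    · rw [if_neg e, if_neg (by simpa only [h.arr] using e)]
      exact ihT h
  | ifIdx i j S T ihS ihT =>
    intro σ m h
    simp only [trans, Stmt.exec, h.var]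
    by_cases e : m.var i = m.var j
    · rw [if_pos e, if_pos (by rw [e])]
      exact ihS h
    · rw [if_neg e, if_neg (by simpa [Λ.stride_pos.ne'] using e)]
      exact ihT h
  | loop S ih =>
    intro σ m h
    simp only [trans, Stmt.exec]
    have : ∀ n, Λ.Rep (((Λ.trans S).exec N)^[n] σ) ((S.exec N)^[n] m) := by
      intro n
      induction n with
      | zero => exact h
      | succ n ihn =>
        rw [Function.iterate_succ_apply', Function.iterate_succ_apply']
        exact ih ihn
    exact this N

variable (Λ)

/-- The program that moves the input to its place as the array `a`. -/
def spread (a : A) : Stmt L Unit ℕ := .seqs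
  [.loop (.seqs [.incr 1, .times Λ.stride (.incr 2), .times Λ.stride (.incr 3)]),
    .times (1 + Λ.slot a) (.incr 2), .times (Λ.stride + 1) (.incr 3),
    .loop (.seqs [.decr 1, .times Λ.stride (.decr 2), .copy () 2 () 1, .copy () 1 () 3])]

-- The input occupies an initial segment of the registers and has to be spread out in place. It is
-- moved from the highest index downwards, and each source cell is overwritten by a zero after its
-- symbol has been copied. The variables `1`, `2`, `3` hold the source, the target and the address
-- of a zero cell. All numbers `num x` are at least `4`, so leftovers in these variables do no harm.
open Classical in
theorem spread_rep (a : A) (x : List R) :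
    Λ.Rep (((Λ.spread a : Stmt L Unit ℕ)).exec (x.length + 2) (initMem L () x))
      (initMem L a x : Mem A V R) := by
  obtain ⟨N, hN⟩ : ∃ N, N = x.length + 2 := ⟨_, rfl⟩
  rw [← hN]
  have hs : 1 ≤ Λ.stride := by have := Λ.slot_lt a; omega
  let g (f : ℕ → R) (p q z : ℕ) : Mem Unit ℕ R :=
    ⟨fun _ => f, fun i => if i = 1 then p else if i = 2 then q else if i = 3 then z else 0⟩
  have update₁ : ∀ f p q z p', (g f p q z).setVar 1 p' = g f p' q z := by
    intro f p q z p'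
    simp only [Mem.setVar, g, Mem.mk.injEq, true_and]
    funext i
    simp only [Function.update_apply]
    split_ifs <;> rfl
  have update₂ : ∀ f p q z p', (g f p q z).setVar 2 p' = g f p p' z := by
    intro f p q z p'
    simp only [Mem.setVar, g, Mem.mk.injEq, true_and]
    funext i
    simp only [Function.update_apply]
    split_ifs <;> first | rfl | omega
  have update₃ : ∀ f p q z p', (g f p q z).setVar 3 p' = g f p q p' := by
    intro f p q z p'
    simp only [Mem.setVar, g, Mem.mk.injEq, true_and]
    funext i
    simp only [Function.update_apply]
    split_ifs <;> first | rfl | omega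
  have v₁ : ∀ f p q z, (g f p q z).var 1 = p := fun _ _ _ _ => rfl
  have v₂ : ∀ f p q z, (g f p q z).var 2 = q := fun _ _ _ _ => rfl
  have v₃ : ∀ f p q z, (g f p q z).var 3 = z := fun _ _ _ _ => rfl
  have cell : ∀ f p q z i r, (g f p q z).setCell () i r = g (Function.update f i r) p q z := by
    intro f p q z i r
    simp [Mem.setCell, g, update_unit]
  have arr : ∀ f p q z, (g f p q z).arr () = f := fun _ _ _ _ => rfl
  set x' : ℕ → R := fun i => x.getD i (zeroElt L) with hx'
  have hx₀ : ∀ i, x.length ≤ i → x' i = zeroElt L := by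
    intro i hi
    simp [hx', List.getElem?_eq_none hi]
  have init : (initMem L () x : Mem Unit ℕ R) = g x' 0 0 0 := by
    simp only [initMem, g, if_true, Mem.mk.injEq]
    refine ⟨rfl, ?_⟩
    funext i
    split_ifs <;> rfl
  have phase₁ : ∀ t, ((Stmt.seqs [.incr 1, .times Λ.stride (.incr 2),
      .times Λ.stride (.incr 3)] : Stmt L Unit ℕ).exec N)^[t] (g x' 0 0 0) =
      g x' t (Λ.stride * t) (Λ.stride * t) := by
    intro t
    induction t with
    | zero => rfl
    | succ t ih =>
      rw [Function.iterate_succ_apply', ih]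
      simp only [Stmt.seqs, Stmt.exec, Stmt.exec_times_incr, update₁, update₂, update₃, v₁, v₂, v₃]
      rfl
  -- The register contents when precisely the entries with index at least `k` have been moved.
  let F (k : ℕ) (r : ℕ) : R := if r < k then x' r else
    if ∃ i, k ≤ i ∧ r = Λ.pos a i then x' ((r - 1) / Λ.stride) else zeroElt L
  have hdiv : ∀ i, (Λ.pos a i - 1) / Λ.stride = i := by
    intro i
    have := Λ.slot_lt a
    rw [pos, show Λ.stride * i + (1 + Λ.slot a) - 1 = Λ.stride * i + Λ.slot a by omega,
      Nat.mul_add_div (by omega), Nat.div_eq_of_lt this, add_zero]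
  -- A target lies strictly above its source, so no symbol is overwritten before it has been moved.
  have hpos : ∀ i, i < Λ.pos a i := by
    intro i
    unfold pos
    nlinarith
  -- All entries with index at least `N` are zero because `N` exceeds the length of the input; hence
  -- the untouched input is the case `k = N`.
  have hF₀ : F N = x' := by
    funext r
    simp only [F]
    split_ifs with h₁ h₂
    · rfl
    · obtain ⟨i, hi, rfl⟩ := h₂
      rw [hdiv, hx₀ i (by omega), hx₀ _ (by have := hpos i; omega)]
    · rw [hx₀ r (by omega)]
  -- The cell addressed by variable `3` lies beyond everything that is moved, and remains zero
  -- throughout.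
  have hFz : ∀ k ≤ N, F k (Λ.stride * N + (Λ.stride + 1)) = zeroElt L := by
    intro k hk
    simp only [F]
    rw [if_neg (by nlinarith)]
    split_ifs with h₂
    · have : (Λ.stride * N + (Λ.stride + 1) - 1) / Λ.stride = N + 1 := by
        rw [show Λ.stride * N + (Λ.stride + 1) - 1 = Λ.stride * (N + 1) by
          rw [mul_add, mul_one]; omega]
        exact Nat.mul_div_cancel_left _ hs
      rw [this, hx₀ _ (by omega)]
    · rfl
  have phase₂ : ∀ t ≤ N, ((Stmt.seqs [.decr 1, .times Λ.stride (.decr 2), .copy () 2 () 1,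
      .copy () 1 () 3] : Stmt L Unit ℕ).exec N)^[t]
        (g x' N (Λ.pos a N) (Λ.stride * N + (Λ.stride + 1))) =
      g (F (N - t)) (N - t) (Λ.pos a (N - t)) (Λ.stride * N + (Λ.stride + 1)) := by
    intro t
    induction t with
    | zero => intro _; simp [hF₀]
    | succ t ih =>
      intro ht
      rw [Function.iterate_succ_apply', ih (by omega)]
      obtain ⟨k, hk⟩ : ∃ k, N - t = k + 1 := ⟨N - t - 1, by omega⟩
      have hk' : N - (t + 1) = k := by omega
      have hp : Λ.pos a (k + 1) - Λ.stride = Λ.pos a k := by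
        unfold pos
        rw [mul_add, mul_one]
        omega
      rw [hk, hk']
      simp only [Stmt.seqs, Stmt.exec, Stmt.exec_times_decr, update₁, update₂, v₁, v₂, v₃, cell,
        arr, Nat.add_sub_cancel, hp]
      refine congrArg (fun f => g f k (Λ.pos a k) (Λ.stride * N + (Λ.stride + 1))) ?_
      have hne : Λ.stride * N + (Λ.stride + 1) ≠ Λ.pos a k := by
        have := Λ.slot_lt a
        unfold pos
        have : Λ.stride * k ≤ Λ.stride * N := Nat.mul_le_mul_left _ (by omega)
        omega
      rw [Function.update_of_ne hne, hFz _ (by omega)]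
      funext r
      simp only [Function.update_apply]
      by_cases h₁ : r = k
      · subst h₁
        have : ¬ ∃ i, r ≤ i ∧ r = Λ.pos a i := by
          rintro ⟨i, hi, h⟩
          have := hpos i
          omega
        simp [F, this]
      · rw [if_neg h₁]
        by_cases h₂ : r = Λ.pos a k
        · rw [if_pos h₂]
          have h₃ : ∃ i, k ≤ i ∧ r = Λ.pos a i := ⟨k, le_rfl, h₂⟩
          have h₄ := hpos k
          simp only [F]
          rw [if_pos (by omega), if_neg (by omega), if_pos h₃, h₂, hdiv]
        · rw [if_neg h₂]
          have : (∃ i, k ≤ i ∧ r = Λ.pos a i) ↔ ∃ i, k + 1 ≤ i ∧ r = Λ.pos a i := by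
            constructor
            · rintro ⟨i, hi, h⟩
              refine ⟨i, ?_, h⟩
              rcases hi.lt_or_eq with h' | rfl
              · exact h'
              · exact absurd h h₂
            · rintro ⟨i, hi, h⟩
              exact ⟨i, by omega, h⟩
          simp only [F, this]
          have : r < k + 1 ↔ r < k := by omega
          simp only [this]
  have final : (Λ.spread a : Stmt L Unit ℕ).exec N (initMem L () x) =
      g (F 0) 0 (Λ.pos a 0) (Λ.stride * N + (Λ.stride + 1)) := by
    have h₂ := phase₂ N le_rfl
    rw [Nat.sub_self] at h₂
    rw [← h₂, init]
    change (Stmt.exec N _)^[N] ((Stmt.times _ (.incr 3)).exec N ((Stmt.times _ (.incr 2)).exec N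
      ((Stmt.exec N _)^[N] (g x' 0 0 0)))) = _
    simp only [phase₁ N, Stmt.exec_times_incr, v₂, update₂, v₃, update₃]
    rfl
  rw [final]
  refine ⟨fun b i => ?_, fun y => ?_, rfl⟩
  · simp only [arr, F, initMem, Nat.not_lt_zero, if_false, Λ.pos_inj]
    by_cases hb : b = a
    · subst hb
      simp [hdiv, hx']
    · simp [hb]
  · simp [g, num, initMem]

end Layout

/-- A problem that is decided by a structured program is decided in polynomial time by a
constant-free machine without oracle. -/
theorem exists_program {L : FirstOrder.Language.{u, v}} {R : Type w} [L.Structure R]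
    [Bipointed L R] {A V : Type} [DecidableEq A] [DecidableEq V] [Finite A] [Countable V]
    (a b : A) (S : Stmt L A V) :
    ∃ P : Program L, P.QueryFree ∧ P.ConstantFree R ∧ PolyTime (R := R) ∅ P ∧
      ∀ x : List R, Accepts ∅ P x ↔
        (S.exec (x.length + 2) (initMem L a x)).arr b 0 = oneElt L := by
  -- The result must end up in register `0`, which represents no cell of any array. It is set to
  -- `1`, compared with the answer cell, and set to `0` if they differ.
  obtain ⟨Λ⟩ := Layout.nonempty A V
  obtain ⟨P, h₁, h₂, h₃, h₄⟩ := Stmt.exists_program (R := R) (.seqs [Λ.spread a, Λ.trans S,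
    .const ((), 0) true, .ifEq ((), 0) ((), Λ.pos b 0) .skip (.const ((), 0) false)])
  refine ⟨P, h₁, h₂, h₃, fun x => ?_⟩
  rw [h₄]
  have h := (Layout.Rep.exec (N := x.length + 2) S (Λ.spread_rep (L := L) (V := V) a x)).arr b 0
  rw [← h]
  set σ := (Λ.trans S).exec (x.length + 2)
    ((Λ.spread a : Stmt L Unit ℕ).exec (x.length + 2) (initMem L () x))
  have h0 : Λ.pos b 0 ≠ 0 := by simp [Layout.pos]
  have e₀ : (σ.setCell () 0 (boolElt L true)).arr () 0 = oneElt L := by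
    simp [Mem.setCell, boolElt]
  have e₁ : (σ.setCell () 0 (boolElt L true)).arr () (Λ.pos b 0) = σ.arr () (Λ.pos b 0) := by
    simp [Mem.setCell, h0]
  change ((Stmt.ifEq ((), 0) ((), Λ.pos b 0) Stmt.skip (Stmt.const ((), 0) false)).exec _
    (σ.setCell () 0 (boolElt L true))).arr () 0 = _ ↔ _
  by_cases e : oneElt L = σ.arr () (Λ.pos b 0)
  · rw [Stmt.exec_ifEq_pos (by rw [e₀, e₁, e]), Stmt.exec, e₀, ← e]
  · rw [Stmt.exec_ifEq_neg (by rwa [e₀, e₁])]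
    simpa [Stmt.exec, Mem.setCell, boolElt, zeroElt_ne_oneElt (L := L)] using fun h => e h.symm


/-! ### Bounded loops, polynomials, and simulation of machines by structured programs -/

section Routines

variable {L : FirstOrder.Language.{u, v}} {R : Type w} {A V : Type} [DecidableEq A] [DecidableEq V]

namespace Stmt

/-- A statement repeated `N ^ d` times. -/
def pow : ℕ → Stmt L A V → Stmt L A V
  | 0, S => S
  | d + 1, S => .loop (pow d S)

/-- A statement repeated until two variables agree. -/
def untilEq (d : ℕ) (i j : V) (S : Stmt L A V) : Stmt L A V := .pow d (.ifIdx i j .skip S)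

/-- Sets a variable to zero. -/
def clear (d : ℕ) (i : V) : Stmt L A V := .pow d (.decr i)

/-- A statement repeated for the values `0, …, n - 1` of the variable `i`, where `n` is the value
of the variable `j`. -/
def upTo (d : ℕ) (i j : V) (S : Stmt L A V) : Stmt L A V :=
  .seq (.untilEq d i j (.seq S (.incr i))) (.clear d i)

/-- Adds `c * s ^ e` to the variable `y`, where `s` is the value of the variable `x`. -/
def addMonomial (d : ℕ) (cnt : ℕ → V) (x y : V) : ℕ → ℕ → Stmt L A V
  | 0, c => .times c (.incr y)
  | e + 1, c => .upTo d (cnt e) x (addMonomial d cnt x y e c)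

/-- Adds `p s` to the variable `y`, where `s` is the value of the variable `x`. -/
noncomputable def addPoly (d : ℕ) (cnt : ℕ → V) (x y : V) (p : Polynomial ℕ) : Stmt L A V :=
  .seqs ((List.range (p.natDegree + 1)).map fun e => .addMonomial d cnt x y e (p.coeff e))

/-- Executes the statement of a list whose number is the value of the variable `x`. -/
def dispatch (t x : V) : ℕ → List (Stmt L A V) → Stmt L A V
  | n, [] => .times n (.decr t)
  | n, S :: l => .ifIdx x t (.seq (.times n (.decr t)) S) (.seq (.incr t) (dispatch t x (n + 1) l))

end Stmt

variable [L.Structure R] [Bipointed L R] {N : ℕ}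

namespace Stmt

theorem exec_pow (d : ℕ) (S : Stmt L A V) :
    (pow d S).exec (R := R) N = (S.exec N)^[N ^ d] := by
  induction d with
  | zero => rfl
  | succ d ih =>
    funext m
    rw [pow, exec, ih, ← Function.iterate_mul, pow_succ]

theorem exec_seqs_cons (S : Stmt L A V) (l : List (Stmt L A V)) (m : Mem A V R) :
    (seqs (S :: l)).exec N m = (seqs l).exec N (S.exec N m) := rfl

theorem exec_seqs_nil (m : Mem A V R) : (seqs ([] : List (Stmt L A V))).exec N m = m := rfl

theorem exec_seqs_concat (l : List (Stmt L A V)) (S : Stmt L A V) (m : Mem A V R) :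
    (seqs (l ++ [S])).exec N m = S.exec N ((seqs l).exec N m) := by
  induction l generalizing m with
  | nil => rfl
  | cons T l ih => exact ih _

theorem exec_skip (m : Mem A V R) : (skip : Stmt L A V).exec N m = m := rfl

theorem exec_incr (i : V) (m : Mem A V R) :
    (incr i : Stmt L A V).exec N m = m.setVar i (m.var i + 1) := rfl

theorem exec_decr (i : V) (m : Mem A V R) :
    (decr i : Stmt L A V).exec N m = m.setVar i (m.var i - 1) := rfl

theorem exec_copy (a : A) (i : V) (b : A) (j : V) (m : Mem A V R) :
    (copy a i b j : Stmt L A V).exec N m = m.setCell a (m.var i) (m.arr b (m.var j)) := rfl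

theorem exec_ifIdx_pos {i j : V} {m : Mem A V R} (h : m.var i = m.var j) (S T : Stmt L A V) :
    (Stmt.ifIdx i j S T).exec N m = S.exec N m := by
  simp only [exec]
  rw [if_pos h]

theorem exec_ifIdx_neg {i j : V} {m : Mem A V R} (h : m.var i ≠ m.var j) (S T : Stmt L A V) :
    (Stmt.ifIdx i j S T).exec N m = T.exec N m := by
  simp only [exec]
  rw [if_neg h]

/-- A trajectory that reaches a fixed point after `k` steps stays there, so a loop with a larger
fixed number of rounds behaves like one with `k` rounds. -/
theorem iterate_trajectory {α : Type*} {f : α → α} {G : ℕ → α} {n k : ℕ} (hk : k ≤ n)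
    (h : ∀ i < k, f (G i) = G (i + 1)) (hG : f (G k) = G k) : f^[n] (G 0) = G k := by
  have h₁ : ∀ i ≤ k, f^[i] (G 0) = G i := by
    intro i
    induction i with
    | zero => exact fun _ => rfl
    | succ i ih =>
      intro hi
      rw [Function.iterate_succ_apply', ih (by omega), h i (by omega)]
  obtain ⟨r, rfl⟩ := Nat.exists_eq_add_of_le' hk
  rw [Function.iterate_add_apply, h₁ k le_rfl]
  exact Function.iterate_fixed hG r

/-- Once the two variables agree, the remaining rounds do nothing; `G` lists the intermediate
memories. -/
theorem exec_untilEq {d : ℕ} {i j : V} {S : Stmt L A V} (G : ℕ → Mem A V R) {k : ℕ}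
    (hk : k ≤ N ^ d) (hne : ∀ l < k, (G l).var i ≠ (G l).var j)
    (heq : (G k).var i = (G k).var j) (hS : ∀ l < k, S.exec N (G l) = G (l + 1)) :
    (untilEq d i j S).exec N (G 0) = G k := by
  rw [untilEq, exec_pow]
  refine iterate_trajectory hk (fun l hl => ?_) ?_
  · rw [exec_ifIdx_neg (hne l hl), hS l hl]
  · rw [exec_ifIdx_pos heq]
    rfl

theorem exec_clear {d : ℕ} {i : V} {m : Mem A V R} (h : m.var i ≤ N ^ d) :
    (clear d i : Stmt L A V).exec N m = m.setVar i 0 := by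
  rw [clear, exec_pow, ← exec_times, exec_times_decr, Nat.sub_eq_zero_of_le h]

/-- The effect of a `for` loop, given the sequence of the memory contents `G 0, …, G k`, up to the
value of the loop variable. -/
theorem exec_upTo {d : ℕ} {i j : V} {S : Stmt L A V} (G : ℕ → Mem A V R) {k : ℕ}
    (hk : k ≤ N ^ d) (hij : j ≠ i) (hi : ∀ l, (G l).var i = 0) (hj : ∀ l, (G l).var j = k)
    (hS : ∀ l < k, S.exec N ((G l).setVar i l) = (G (l + 1)).setVar i l) :
    (upTo d i j S).exec N (G 0) = G k := by
  have h : (untilEq d i j (.seq S (.incr i))).exec N ((G 0).setVar i 0) = (G k).setVar i k := by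
    refine exec_untilEq (fun l => (G l).setVar i l) hk (fun l hl => ?_) ?_ (fun l hl => ?_)
    · rw [Mem.setVar_var_self, Mem.setVar_var_of_ne _ hij, hj]
      exact hl.ne
    · rw [Mem.setVar_var_self, Mem.setVar_var_of_ne _ hij, hj]
    · simp only [exec, hS l hl, Mem.setVar_setVar, Mem.setVar_var_self]
  have h0 : ∀ l, (G l).setVar i 0 = G l := by
    intro l
    conv_lhs => rw [← hi l]
    exact Mem.setVar_var _ _
  rw [h0] at h
  rw [upTo, exec, h, exec_clear (by rwa [Mem.setVar_var_self]), Mem.setVar_setVar, h0]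

/-- A power is the number of rounds of `e` nested `for` loops, each of length `m.var x` and with its
own counter. The counters inside must be zero on entry, and `upTo` leaves them zero. -/
theorem exec_addMonomial {d : ℕ} {cnt : ℕ → V} (hcnt : Function.Injective cnt) {x y : V}
    (hx : ∀ e, x ≠ cnt e) (hy : ∀ e, y ≠ cnt e) (hxy : x ≠ y) (e c : ℕ) :
    ∀ (m : Mem A V R), m.var x ≤ N ^ d → (∀ i < e, m.var (cnt i) = 0) →
      (addMonomial d cnt x y e c : Stmt L A V).exec N m =
        m.setVar y (m.var y + c * m.var x ^ e) := by
  induction e with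
  | zero =>
    intro m _ _
    simp [addMonomial, exec_times_incr]
  | succ e ih =>
    intro m hm h0
    have key := exec_upTo (N := N) (d := d) (i := cnt e) (j := x)
      (S := (addMonomial d cnt x y e c : Stmt L A V))
      (fun l => m.setVar y (m.var y + l * (c * m.var x ^ e))) hm (hx e)
      (fun l => by rw [Mem.setVar_var_of_ne _ (hy e).symm, h0 e (by omega)])
      (fun l => by rw [Mem.setVar_var_of_ne _ hxy]) (fun l hl => by
        rw [ih]
        · rw [Mem.setVar_var_of_ne _ (hy e), Mem.setVar_var_of_ne _ (hx e),
            Mem.setVar_var_of_ne _ hxy, Mem.setVar_var_self, Mem.setVar_comm _ (hy e).symm,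
            Mem.setVar_setVar]
          congr 2
          ring
        · rwa [Mem.setVar_var_of_ne _ (hx e), Mem.setVar_var_of_ne _ hxy]
        · intro i hi
          rw [Mem.setVar_var_of_ne _ (hcnt.ne hi.ne), Mem.setVar_var_of_ne _ (hy i).symm,
            h0 i (by omega)])
    simp only [zero_mul, add_zero, Mem.setVar_var] at key
    rw [addMonomial, key]
    congr 2
    ring

theorem exec_addPoly {d : ℕ} {cnt : ℕ → V} (hcnt : Function.Injective cnt) {x y : V}
    (hx : ∀ e, x ≠ cnt e) (hy : ∀ e, y ≠ cnt e) (hxy : x ≠ y) (p : Polynomial ℕ)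
    {m : Mem A V R} (hm : m.var x ≤ N ^ d) (h0 : ∀ i, m.var (cnt i) = 0) :
    (addPoly d cnt x y p : Stmt L A V).exec N m = m.setVar y (m.var y + p.eval (m.var x)) := by
  have key : ∀ n, (seqs ((List.range n).map fun e =>
      addMonomial d cnt x y e (p.coeff e)) : Stmt L A V).exec N m =
      m.setVar y (m.var y + ∑ e ∈ Finset.range n, p.coeff e * m.var x ^ e) := by
    intro n
    induction n with
    | zero => simp [seqs, exec, Mem.setVar_var]
    | succ n ih =>
      rw [List.range_succ, List.map_append, List.map_singleton, exec_seqs_concat, ih,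
        exec_addMonomial hcnt hx hy hxy _ _ _ (by rwa [Mem.setVar_var_of_ne _ hxy])
          (fun i _ => by rw [Mem.setVar_var_of_ne _ (hy i).symm, h0]),
        Mem.setVar_setVar, Mem.setVar_var_self, Mem.setVar_var_of_ne _ hxy, Finset.sum_range_succ,
        add_assoc]
  rw [addPoly, key, Polynomial.eval_eq_sum_range]

/-- The auxiliary variable `t` counts list positions until it equals `x`. It is then lowered to zero
before the chosen statement runs, which therefore sees the original memory. Values of `x` beyond the
end of the list leave the memory unchanged, just as `stay` idles at undefined labels. -/
theorem exec_dispatch {t x : V} (htx : x ≠ t) (l : List (Stmt L A V)) :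
    ∀ (n : ℕ) (m : Mem A V R), m.var t = 0 → n ≤ m.var x →
      (dispatch t x n l).exec N (m.setVar t n) =
        match l[m.var x - n]? with
        | none => m
        | some S => S.exec N m := by
  induction l with
  | nil =>
    intro n m ht _
    simp only [dispatch, exec_times_decr, Mem.setVar_var_self, Nat.sub_self, Mem.setVar_setVar,
      List.getElem?_nil]
    rw [← ht, Mem.setVar_var]
  | cons S l ih =>
    intro n m ht hn
    have h0 : m.setVar t 0 = m := by
      conv_lhs => rw [← ht]
      exact Mem.setVar_var _ _
    rw [dispatch]
    rcases hn.eq_or_lt with h | h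
    · rw [exec_ifIdx_pos (by rw [Mem.setVar_var_self, Mem.setVar_var_of_ne _ htx, h]), exec,
        exec_times_decr, Mem.setVar_var_self, Nat.sub_self, Mem.setVar_setVar, h0, h, Nat.sub_self]
      rfl
    · rw [exec_ifIdx_neg (by rw [Mem.setVar_var_self, Mem.setVar_var_of_ne _ htx]; exact h.ne')]
      simp only [exec, Mem.setVar_var_self, Mem.setVar_setVar]
      rw [ih (n + 1) m ht h]
      rw [show m.var x - n = m.var x - (n + 1) + 1 by omega, List.getElem?_cons_succ]

end Stmt

/-- Where the configuration of a simulated machine is stored. -/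
structure Slot (A V : Type) where
  tape : A
  ix : ℕ → V
  pc : V

variable (R) in
open Classical in
/-- The simulation of the instruction with label `ℓ`; queries are simulated by `q`. -/
noncomputable def Slot.instr (s : Slot A V) (q : Stmt L A V → Stmt L A V → Stmt L A V) (ℓ : ℕ) :
    Instr L → Stmt L A V
  | .const j c => .seq (.const (s.tape, j) (decide (c = Bipointed.oneSym R))) (.incr s.pc)
  | .func j f js => .seq (.func (s.tape, j) f fun i => (s.tape, js i)) (.incr s.pc)
  | .branchEq j₁ j₂ ℓ₁ ℓ₂ => .ifEq (s.tape, j₁) (s.tape, j₂)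
      (.seq (.times ℓ (.decr s.pc)) (.times ℓ₁ (.incr s.pc)))
      (.seq (.times ℓ (.decr s.pc)) (.times ℓ₂ (.incr s.pc)))
  | .branchRel P js ℓ₁ ℓ₂ => .ifRel P (fun i => (s.tape, js i))
      (.seq (.times ℓ (.decr s.pc)) (.times ℓ₁ (.incr s.pc)))
      (.seq (.times ℓ (.decr s.pc)) (.times ℓ₂ (.incr s.pc)))
  | .copy j₀ j₁ => .seq (.copy s.tape (s.ix j₀) s.tape (s.ix j₁)) (.incr s.pc)
  | .incr j => .seq (.incr (s.ix j)) (.incr s.pc)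
  | .decr j => .seq (.decr (s.ix j)) (.incr s.pc)
  | .branchIdx j₁ j₂ ℓ₁ ℓ₂ => .ifIdx (s.ix j₁) (s.ix j₂)
      (.seq (.times ℓ (.decr s.pc)) (.times ℓ₁ (.incr s.pc)))
      (.seq (.times ℓ (.decr s.pc)) (.times ℓ₂ (.incr s.pc)))
  | .query ℓ₁ ℓ₂ => q (.seq (.times ℓ (.decr s.pc)) (.times ℓ₁ (.incr s.pc)))
      (.seq (.times ℓ (.decr s.pc)) (.times ℓ₂ (.incr s.pc)))

variable (R) in
/-- The simulation of one step of a machine; `t` is an auxiliary variable. -/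
noncomputable def Slot.step (s : Slot A V) (t : V)
    (q : Stmt L A V → Stmt L A V → Stmt L A V) (P : Program L) : Stmt L A V :=
  .dispatch t s.pc 0 (P.mapIdx fun ℓ i => s.instr R q ℓ i)

/-- The memory contents `mk c` store the configuration `c`. -/
structure Slot.IsView (s : Slot A V) (mk : Config R → Mem A V R) : Prop where
  arr : ∀ c, (mk c).arr s.tape = c.reg
  idx : ∀ c i, (mk c).var (s.ix i) = c.idx i
  label : ∀ c, (mk c).var s.pc = c.label
  setCell : ∀ c i r, (mk c).setCell s.tape i r = mk ⟨c.label, c.idx, Function.update c.reg i r⟩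
  setIdx : ∀ c i x, (mk c).setVar (s.ix i) x = mk ⟨c.label, Function.update c.idx i x, c.reg⟩
  setPc : ∀ c x, (mk c).setVar s.pc x = mk ⟨x, c.idx, c.reg⟩

variable {s : Slot A V} {mk : Config R → Mem A V R}

/-- The label of the instruction is known when the simulating program is written, so subtracting it
clears the program counter without a loop. -/
theorem Slot.IsView.exec_jump (h : s.IsView mk) (c : Config R) (ℓ : ℕ) :
    (.seq (.times c.label (.decr s.pc)) (.times ℓ (.incr s.pc)) : Stmt L A V).exec N (mk c) =
      mk ⟨ℓ, c.idx, c.reg⟩ := by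
  simp only [Stmt.exec, Stmt.exec_times_decr, Stmt.exec_times_incr, h.label, h.setPc, Nat.sub_self,
    zero_add]

open Classical in
theorem Slot.IsView.exec_instr (h : s.IsView mk) (q : Stmt L A V → Stmt L A V → Stmt L A V)
    (Q : Set (List R)) (c : Config R) (i : Instr L)
    (hc : ∀ j a, i = .const j a → a = Bipointed.zeroSym R ∨ a = Bipointed.oneSym R)
    (hq : ∀ ℓ₁ ℓ₂, i ≠ .query ℓ₁ ℓ₂) :
    (s.instr R q c.label i).exec N (mk c) = mk (i.exec Q c) := by
  cases i with
  | const j a =>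
    have ha : (FirstOrder.Language.constantMap a : R) =
        boolElt L (decide (a = Bipointed.oneSym R)) := by
      rcases hc j a rfl with rfl | rfl
      · by_cases e : (Bipointed.zeroSym R : L.Constants) = Bipointed.oneSym R
        · simp [boolElt, e, oneElt]
        · simp [boolElt, e, zeroElt]
      · simp [boolElt, oneElt]
    simp only [instr, Stmt.exec, Instr.exec, h.setCell, h.label, h.setPc, ha]
  | func j f js =>
    simp only [instr, Stmt.exec, Instr.exec, h.setCell, h.label, h.setPc, h.arr]
  | branchEq j₁ j₂ ℓ₁ ℓ₂ =>
    rw [instr]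
    by_cases e : c.reg j₁ = c.reg j₂
    · rw [Stmt.exec_ifEq_pos (by simpa only [h.arr] using e), h.exec_jump, Instr.exec, if_pos e]
    · rw [Stmt.exec_ifEq_neg (by simpa only [h.arr] using e), h.exec_jump, Instr.exec, if_neg e]
  | branchRel P js ℓ₁ ℓ₂ =>
    simp only [instr, Stmt.exec, Instr.exec]
    by_cases e : FirstOrder.Language.Structure.RelMap P fun i => c.reg (js i)
    · rw [if_pos (by simpa only [h.arr] using e), if_pos e]
      exact h.exec_jump c _
    · rw [if_neg (by simpa only [h.arr] using e), if_neg e]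
      exact h.exec_jump c _
  | copy j₀ j₁ =>
    simp only [instr, Stmt.exec, Instr.exec, h.setCell, h.label, h.setPc, h.arr, h.idx]
  | incr j => simp only [instr, Stmt.exec, Instr.exec, h.setIdx, h.label, h.setPc, h.idx]
  | decr j => simp only [instr, Stmt.exec, Instr.exec, h.setIdx, h.label, h.setPc, h.idx]
  | branchIdx j₁ j₂ ℓ₁ ℓ₂ =>
    rw [instr]
    by_cases e : c.idx j₁ = c.idx j₂
    · rw [Stmt.exec_ifIdx_pos (by simpa only [h.idx] using e), h.exec_jump, Instr.exec, if_pos e]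
    · rw [Stmt.exec_ifIdx_neg (by simpa only [h.idx] using e), h.exec_jump, Instr.exec, if_neg e]
  | query ℓ₁ ℓ₂ => exact absurd rfl (hq ℓ₁ ℓ₂)

/-- The treatment `q` of queries is left open: it is irrelevant for query-free machines, and checks
a guessed answer for the oracle machine. -/
theorem Slot.exec_step {t : V} (ht : s.pc ≠ t) (q : Stmt L A V → Stmt L A V → Stmt L A V)
    (P : Program L) {m : Mem A V R} (h0 : m.var t = 0) :
    (s.step R t q P).exec N m =
      match P[m.var s.pc]? with
      | none => m
      | some i => (s.instr R q (m.var s.pc) i).exec N m := by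
  have h := Stmt.exec_dispatch (N := N) ht (P.mapIdx fun ℓ i => s.instr R q ℓ i) 0 m h0
    (Nat.zero_le _)
  rw [show m.setVar t 0 = m by conv_lhs => rw [← h0]; exact Mem.setVar_var _ _] at h
  rw [Slot.step, h, Nat.sub_zero, List.getElem?_mapIdx]
  cases P[m.var s.pc]? <;> rfl

theorem Slot.IsView.exec_step (h : s.IsView mk) {t : V} (ht : s.pc ≠ t)
    (h0 : ∀ c, (mk c).var t = 0) (q : Stmt L A V → Stmt L A V → Stmt L A V) {P : Program L}
    (hP : P.ConstantFree R) (hQ : P.QueryFree) (Q : Set (List R)) (c : Config R) :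
    (s.step R t q P).exec N (mk c) = mk (stay Q P c) := by
  rw [Slot.exec_step ht q P (h0 c), h.label, stay, RMachine.step]
  cases e : P[c.label]? with
  | none => rfl
  | some i =>
    have hi := List.mem_of_getElem? e
    exact h.exec_instr q Q c i (fun j a hj => hP j a (hj ▸ hi)) fun ℓ₁ ℓ₂ hj => hQ ℓ₁ ℓ₂ (hj ▸ hi)

end Routines

/-! ### Space bounds -/

section Bounds

variable {L : FirstOrder.Language.{u, v}} {R : Type w}

/-- The registers to which an instruction writes directly have numbers below `J`. -/
def Instr.WritesBelow (J : ℕ) : Instr L → Prop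
  | .const j _ => j < J
  | .func j _ _ => j < J
  | .incr j => j < J
  | .decr j => j < J
  | _ => True

theorem Program.exists_writesBelow (P : Program L) : ∃ J, 0 < J ∧ ∀ i ∈ P, i.WritesBelow J := by
  have mono : ∀ (i : Instr L) {J J' : ℕ}, J ≤ J' → i.WritesBelow J → i.WritesBelow J' := by
    intro i J J' h hi
    cases i <;> first | exact lt_of_lt_of_le hi h | trivial
  have one : ∀ i : Instr L, ∃ J, i.WritesBelow J := by
    intro i
    cases i with
    | const j _ => exact ⟨j + 1, j.lt_succ_self⟩
    | func j _ _ => exact ⟨j + 1, j.lt_succ_self⟩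
    | incr j => exact ⟨j + 1, j.lt_succ_self⟩
    | decr j => exact ⟨j + 1, j.lt_succ_self⟩
    | _ => exact ⟨0, trivial⟩
  induction P with
  | nil => exact ⟨1, one_pos, by simp⟩
  | cons i P ih =>
    obtain ⟨J, h0, hJ⟩ := ih
    obtain ⟨J', hJ'⟩ := one i
    refine ⟨max J J', by omega, ?_⟩
    simp only [List.mem_cons, forall_eq_or_imp]
    exact ⟨mono i (le_max_right _ _) hJ', fun a ha => mono a (le_max_left _ _) (hJ a ha)⟩

variable [L.Structure R] [Bipointed L R]

variable (L) in
/-- A configuration with bounded index registers and registers. -/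
structure Config.Bounded (J B : ℕ) (c : Config R) : Prop where
  idx_le : ∀ i, c.idx i ≤ B
  idx_eq : ∀ i, J ≤ i → c.idx i = 0
  reg_eq : ∀ i, J ≤ i → B < i → c.reg i = zeroElt L

variable {J B : ℕ} {c : Config R}

theorem Config.Bounded.mono (h : c.Bounded L J B) {B' : ℕ} (hB : B ≤ B') : c.Bounded L J B' :=
  ⟨fun i => (h.1 i).trans hB, h.2, fun i hi hi' => h.3 i hi (by omega)⟩

/-- An indirect write goes to an address at most `B`, a direct write to one below `J`, and an index
register grows by at most `1`. The oracle plays no role, so the bound also covers computations with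
wrong answers. -/
theorem Config.Bounded.exec (h : c.Bounded L J B) {i : Instr L} (hi : i.WritesBelow J)
    (Q : Set (List R)) : (i.exec Q c).Bounded L J (B + 1) := by
  have h' := h.mono B.le_succ
  cases i with
  | const j a =>
    refine ⟨h'.1, h'.2, fun l hl hl' => ?_⟩
    have hj : j < J := hi
    simp only [Instr.exec]
    rw [Function.update_of_ne (by omega), h'.3 l hl hl']
  | func j f js =>
    refine ⟨h'.1, h'.2, fun l hl hl' => ?_⟩
    have hj : j < J := hi
    simp only [Instr.exec]
    rw [Function.update_of_ne (by omega), h'.3 l hl hl']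
  | copy j₀ j₁ =>
    refine ⟨h'.1, h'.2, fun l hl hl' => ?_⟩
    have hj := h.1 j₀
    simp only [Instr.exec]
    rw [Function.update_of_ne (by omega), h'.3 l hl hl']
  | incr j =>
    have hj : j < J := hi
    refine ⟨fun l => ?_, fun l hl => ?_, h'.3⟩ <;> simp only [Instr.exec, Function.update_apply]
    · have := h.1 j
      have := h'.1 l
      split_ifs <;> omega
    · rw [if_neg (by omega), h.2 l hl]
  | decr j =>
    have hj : j < J := hi
    refine ⟨fun l => ?_, fun l hl => ?_, h'.3⟩ <;> simp only [Instr.exec, Function.update_apply]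
    · have := h.1 j
      have := h'.1 l
      split_ifs <;> omega
    · rw [if_neg (by omega), h.2 l hl]
  | branchEq => exact ⟨h'.1, h'.2, h'.3⟩
  | branchRel => exact ⟨h'.1, h'.2, h'.3⟩
  | branchIdx => exact ⟨h'.1, h'.2, h'.3⟩
  | query => exact ⟨h'.1, h'.2, h'.3⟩

theorem Config.Bounded.stay_iterate {P : Program L} (hP : ∀ i ∈ P, i.WritesBelow J)
    (Q : Set (List R)) (h : c.Bounded L J B) (t : ℕ) :
    ((stay Q P)^[t] c).Bounded L J (B + t) := by
  induction t with
  | zero => exact h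
  | succ t ih =>
    rw [Function.iterate_succ_apply', stay, step]
    cases e : P[((stay Q P)^[t] c).label]? with
    | none => exact ih.mono (by omega)
    | some i => exact ih.exec (hP i (List.mem_of_getElem? e)) Q

theorem initConfig_bounded (hJ : 0 < J) (x : List R) :
    (initConfig L x).Bounded L J x.length := by
  refine ⟨fun i => ?_, fun i hi => ?_, fun i _ hi => ?_⟩
  · simp only [initConfig]
    split_ifs <;> omega
  · simp only [initConfig]
    rw [if_neg (by omega)]
  · simp [initConfig, List.getElem?_eq_none hi.le]

end Bounds

/-! ### Strings that represent tuples -/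

section Tuples

variable {L : FirstOrder.Language.{u, v}} {R : Type w} [L.Structure R] [Bipointed L R]

/-- Recursion at the right end, which matches programs that write a string symbol by symbol. -/
theorem tagString_append_singleton (b : R) (l : List R) (a : R) :
    tagString L b (l ++ [a]) = tagString L b l ++ [if l = [] then b else zeroElt L, a] := by
  cases l with
  | nil => simp [tagString]
  | cons r l => simp [tagString]

theorem length_tagString (b : R) (l : List R) : (tagString L b l).length = 2 * l.length := by
  induction l using List.reverseRecOn with
  | nil => rfl
  | append_singleton l a ih =>
    rw [tagString_append_singleton]
    simp [ih]
    ring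

theorem tagString_getD (b r : R) (l : List R) {j : ℕ} (hj : j < l.length) :
    (tagString L b l).getD (2 * j) r = (if j = 0 then b else zeroElt L) ∧
      (tagString L b l).getD (2 * j + 1) r = l.getD j r := by
  induction l using List.reverseRecOn with
  | nil => simp at hj
  | append_singleton l a ih =>
    rw [tagString_append_singleton]
    have hl := length_tagString (L := L) b l
    rcases Nat.lt_or_ge j l.length with h | h
    · rw [List.getD_append _ _ _ _ (by omega), List.getD_append _ _ _ _ (by omega),
        List.getD_append _ _ _ _ h]
      exact ih h
    · have hj' : j = l.length := by simp at hj; omega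
      subst hj'
      rw [List.getD_append_right _ _ _ _ (by omega), List.getD_append_right _ _ _ _ (by omega),
        List.getD_append_right _ _ _ _ le_rfl, hl]
      simp

theorem tupleString_of_ne_nil (x : List R) {ws : List (List R)} (h : ws ≠ []) :
    tupleString L x ws = tagString L (zeroElt L) x ++ ws.flatMap (tagString L (oneElt L)) := by
  cases ws with
  | nil => exact absurd rfl h
  | cons w ws => rfl

theorem length_flatMap_tagString (b : R) {m : ℕ} {ws : List (List R)}
    (h : ∀ w ∈ ws, w.length = m) :
    (ws.flatMap (tagString L b)).length = 2 * m * ws.length := by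
  induction ws with
  | nil => simp
  | cons w ws ih =>
    simp only [List.mem_cons, forall_eq_or_imp] at h
    rw [List.flatMap_cons, List.length_append, ih h.2, length_tagString, h.1, List.length_cons]
    ring

theorem length_tupleString (x : List R) {m : ℕ} {ws : List (List R)} (h : ∀ w ∈ ws, w.length = m)
    (hws : ws ≠ []) : (tupleString L x ws).length = 2 * x.length + 2 * m * ws.length := by
  rw [tupleString_of_ne_nil x hws, List.length_append, length_tagString,
    length_flatMap_tagString _ h]

/-- Entries of equal length `m` put symbol `j` of entry `i` at an affine position, which pointers
can reach without searching for tags. -/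
theorem flatMap_tagString_getD (b r : R) {m : ℕ} {ws : List (List R)}
    (h : ∀ w ∈ ws, w.length = m) {i j : ℕ} (hi : i < ws.length) (hj : j < m) :
    (ws.flatMap (tagString L b)).getD (2 * m * i + 2 * j) r = (if j = 0 then b else zeroElt L) ∧
      (ws.flatMap (tagString L b)).getD (2 * m * i + 2 * j + 1) r = (ws.getD i []).getD j r := by
  induction ws generalizing i with
  | nil => simp at hi
  | cons w ws ih =>
    simp only [List.mem_cons, forall_eq_or_imp] at h
    have hl := length_tagString (L := L) b w
    rw [h.1] at hl
    rw [List.flatMap_cons]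
    cases i with
    | zero =>
      rw [List.getD_append _ _ _ _ (by omega), List.getD_append _ _ _ _ (by omega), mul_zero,
        zero_add]
      simpa using tagString_getD (L := L) b r w (j := j) (by omega)
    | succ i =>
      have e : 2 * m * (i + 1) = 2 * m * i + 2 * m := by ring
      rw [List.getD_append_right _ _ _ _ (by omega), List.getD_append_right _ _ _ _ (by omega), hl,
        show 2 * m * (i + 1) + 2 * j - 2 * m = 2 * m * i + 2 * j by omega,
        show 2 * m * (i + 1) + 2 * j + 1 - 2 * m = 2 * m * i + 2 * j + 1 by omega]
      simpa using ih h.2 (by simpa using hi)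

theorem tupleString_getD_left (x : List R) {ws : List (List R)} (hws : ws ≠ []) (r : R) {j : ℕ}
    (hj : j < x.length) :
    (tupleString L x ws).getD (2 * j) r = zeroElt L ∧
      (tupleString L x ws).getD (2 * j + 1) r = x.getD j r := by
  have hl := length_tagString (L := L) (zeroElt L) x
  rw [tupleString_of_ne_nil x hws, List.getD_append _ _ _ _ (by omega),
    List.getD_append _ _ _ _ (by omega)]
  simpa using tagString_getD (L := L) (zeroElt L) r x hj

theorem tupleString_getD_right (x : List R) {m : ℕ} {ws : List (List R)}
    (h : ∀ w ∈ ws, w.length = m) (hws : ws ≠ []) (r : R) {i j : ℕ} (hi : i < ws.length)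
    (hj : j < m) :
    (tupleString L x ws).getD (2 * x.length + 2 * m * i + 2 * j) r =
        (if j = 0 then oneElt L else zeroElt L) ∧
      (tupleString L x ws).getD (2 * x.length + 2 * m * i + 2 * j + 1) r =
        (ws.getD i []).getD j r := by
  have hl := length_tagString (L := L) (zeroElt L) x
  rw [tupleString_of_ne_nil x hws, List.getD_append_right _ _ _ _ (by omega),
    List.getD_append_right _ _ _ _ (by omega), hl,
    show 2 * x.length + 2 * m * i + 2 * j - 2 * x.length = 2 * m * i + 2 * j by omega,
    show 2 * x.length + 2 * m * i + 2 * j + 1 - 2 * x.length = 2 * m * i + 2 * j + 1 by omega]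
  exact flatMap_tagString_getD _ r h hi hj

end Tuples


/-! ### The memory of the simulating machines -/

/-- The arrays: the input, the constants `0` and `1`, a single cell, and the registers of two
simulated machines. -/
inductive Arr
  | inp | kon | tmp | mTape | nTape
  deriving DecidableEq

instance : Finite Arr :=
  Finite.of_injective (β := Fin 5)
    (fun | .inp => 0 | .kon => 1 | .tmp => 2 | .mTape => 3 | .nTape => 4)
    (by intro a b h; cases a <;> cases b <;> simp_all)

/-- The index variables. -/
inductive Var
  | zero | one | t | c | xl | h | g | g' | nn | mm | o | bad | rr | e
  | p (i : ℕ) | cnt (i : ℕ) | mIdx (i : ℕ) | mPc | nIdx (i : ℕ) | nPc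
  deriving DecidableEq

/-- A numbering of the variables. -/
def Var.code : Var → ℕ × ℕ
  | zero => (0, 0) | one => (1, 0) | t => (2, 0) | c => (3, 0) | xl => (4, 0) | h => (5, 0)
  | g => (6, 0) | g' => (7, 0) | nn => (8, 0) | mm => (9, 0) | o => (10, 0) | bad => (11, 0)
  | rr => (12, 0) | e => (13, 0) | p i => (14, i) | cnt i => (15, i) | mIdx i => (16, i)
  | mPc => (17, 0) | nIdx i => (18, i) | nPc => (19, 0)

instance : Countable Var :=
  Function.Injective.countable (f := Var.code) (by
    intro a b h
    cases a <;> cases b <;> simp_all [Var.code])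

/-- The contents of the memory. -/
@[ext]
structure St (R : Type w) where
  mc : Config R
  nc : Config R
  tmp : R
  p : ℕ → ℕ
  c : ℕ
  xl : ℕ
  h : ℕ
  g : ℕ
  g' : ℕ
  nn : ℕ
  mm : ℕ
  o : ℕ
  bad : ℕ
  rr : ℕ
  e : ℕ

section

variable {L : FirstOrder.Language.{u, v}} {R : Type w} [L.Structure R] [Bipointed L R]

variable (L) in
/-- The memory, on input `x`. -/
def St.toMem (x : ℕ → R) (s : St R) : Mem Arr Var R where
  arr
    | .inp => x
    | .kon => fun i => if i = 1 then oneElt L else zeroElt L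
    | .tmp => fun i => if i = 0 then s.tmp else zeroElt L
    | .mTape => s.mc.reg
    | .nTape => s.nc.reg
  var
    | .zero => 0 | .one => 1 | .t => 0 | .c => s.c | .xl => s.xl | .h => s.h | .g => s.g
    | .g' => s.g' | .nn => s.nn | .mm => s.mm | .o => s.o | .bad => s.bad | .rr => s.rr
    | .e => s.e | .p i => s.p i | .cnt _ => 0 | .mIdx i => s.mc.idx i | .mPc => s.mc.label
    | .nIdx i => s.nc.idx i | .nPc => s.nc.label

namespace St

variable (x : ℕ → R) (s : St R)

@[simp] theorem var_zero : (s.toMem L x).var .zero = 0 := rfl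
@[simp] theorem var_one : (s.toMem L x).var .one = 1 := rfl
@[simp] theorem var_t : (s.toMem L x).var .t = 0 := rfl
@[simp] theorem var_c : (s.toMem L x).var .c = s.c := rfl
@[simp] theorem var_xl : (s.toMem L x).var .xl = s.xl := rfl
@[simp] theorem var_h : (s.toMem L x).var .h = s.h := rfl
@[simp] theorem var_g : (s.toMem L x).var .g = s.g := rfl
@[simp] theorem var_g' : (s.toMem L x).var .g' = s.g' := rfl
@[simp] theorem var_nn : (s.toMem L x).var .nn = s.nn := rfl
@[simp] theorem var_mm : (s.toMem L x).var .mm = s.mm := rfl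
@[simp] theorem var_o : (s.toMem L x).var .o = s.o := rfl
@[simp] theorem var_bad : (s.toMem L x).var .bad = s.bad := rfl
@[simp] theorem var_rr : (s.toMem L x).var .rr = s.rr := rfl
@[simp] theorem var_e : (s.toMem L x).var .e = s.e := rfl
@[simp] theorem var_p (i : ℕ) : (s.toMem L x).var (.p i) = s.p i := rfl
@[simp] theorem var_cnt (i : ℕ) : (s.toMem L x).var (.cnt i) = 0 := rfl
@[simp] theorem var_mIdx (i : ℕ) : (s.toMem L x).var (.mIdx i) = s.mc.idx i := rfl
@[simp] theorem var_mPc : (s.toMem L x).var .mPc = s.mc.label := rfl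
@[simp] theorem var_nIdx (i : ℕ) : (s.toMem L x).var (.nIdx i) = s.nc.idx i := rfl
@[simp] theorem var_nPc : (s.toMem L x).var .nPc = s.nc.label := rfl
@[simp] theorem arr_inp (i : ℕ) : (s.toMem L x).arr .inp i = x i := rfl
@[simp] theorem arr_kon_zero : (s.toMem L x).arr .kon 0 = zeroElt L := rfl
@[simp] theorem arr_kon_one : (s.toMem L x).arr .kon 1 = oneElt L := rfl
@[simp] theorem arr_tmp_zero : (s.toMem L x).arr .tmp 0 = s.tmp := rfl
@[simp] theorem arr_mTape (i : ℕ) : (s.toMem L x).arr .mTape i = s.mc.reg i := rfl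
@[simp] theorem arr_nTape (i : ℕ) : (s.toMem L x).arr .nTape i = s.nc.reg i := rfl

@[simp] theorem setVar_c (n : ℕ) :
    (s.toMem L x).setVar .c n = toMem L x { s with c := n } := by
  ext v <;> cases v <;> rfl
@[simp] theorem setVar_xl (n : ℕ) :
    (s.toMem L x).setVar .xl n = toMem L x { s with xl := n } := by
  ext v <;> cases v <;> rfl
@[simp] theorem setVar_h (n : ℕ) :
    (s.toMem L x).setVar .h n = toMem L x { s with h := n } := by
  ext v <;> cases v <;> rfl
@[simp] theorem setVar_g (n : ℕ) :
    (s.toMem L x).setVar .g n = toMem L x { s with g := n } := by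
  ext v <;> cases v <;> rfl
@[simp] theorem setVar_g' (n : ℕ) :
    (s.toMem L x).setVar .g' n = toMem L x { s with g' := n } := by
  ext v <;> cases v <;> rfl
@[simp] theorem setVar_nn (n : ℕ) :
    (s.toMem L x).setVar .nn n = toMem L x { s with nn := n } := by
  ext v <;> cases v <;> rfl
@[simp] theorem setVar_mm (n : ℕ) :
    (s.toMem L x).setVar .mm n = toMem L x { s with mm := n } := by
  ext v <;> cases v <;> rfl
@[simp] theorem setVar_o (n : ℕ) :
    (s.toMem L x).setVar .o n = toMem L x { s with o := n } := by
  ext v <;> cases v <;> rfl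
@[simp] theorem setVar_bad (n : ℕ) :
    (s.toMem L x).setVar .bad n = toMem L x { s with bad := n } := by
  ext v <;> cases v <;> rfl
@[simp] theorem setVar_rr (n : ℕ) :
    (s.toMem L x).setVar .rr n = toMem L x { s with rr := n } := by
  ext v <;> cases v <;> rfl
@[simp] theorem setVar_e (n : ℕ) :
    (s.toMem L x).setVar .e n = toMem L x { s with e := n } := by
  ext v <;> cases v <;> rfl
@[simp] theorem setVar_p (i n : ℕ) :
    (s.toMem L x).setVar (.p i) n = toMem L x { s with p := Function.update s.p i n } := by
  ext v <;> cases v <;> simp [Mem.setVar, Function.update_apply, toMem]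
@[simp] theorem setVar_mIdx (i n : ℕ) : (s.toMem L x).setVar (.mIdx i) n =
    toMem L x { s with mc := ⟨s.mc.label, Function.update s.mc.idx i n, s.mc.reg⟩ } := by
  ext v <;> cases v <;> simp [Mem.setVar, Function.update_apply, toMem]
@[simp] theorem setVar_mPc (n : ℕ) : (s.toMem L x).setVar .mPc n =
    toMem L x { s with mc := ⟨n, s.mc.idx, s.mc.reg⟩ } := by
  ext v <;> cases v <;> rfl
@[simp] theorem setVar_nIdx (i n : ℕ) : (s.toMem L x).setVar (.nIdx i) n =
    toMem L x { s with nc := ⟨s.nc.label, Function.update s.nc.idx i n, s.nc.reg⟩ } := by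
  ext v <;> cases v <;> simp [Mem.setVar, Function.update_apply, toMem]
@[simp] theorem setVar_nPc (n : ℕ) : (s.toMem L x).setVar .nPc n =
    toMem L x { s with nc := ⟨n, s.nc.idx, s.nc.reg⟩ } := by
  ext v <;> cases v <;> rfl
@[simp] theorem setCell_tmp (r : R) : (s.toMem L x).setCell .tmp 0 r =
    toMem L x { s with tmp := r } := by
  ext a i
  · cases a <;> simp [Mem.setCell, Function.update_apply, toMem]
    split_ifs <;> rfl
  · rfl
@[simp] theorem setCell_mTape (i : ℕ) (r : R) : (s.toMem L x).setCell .mTape i r =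
    toMem L x { s with mc := ⟨s.mc.label, s.mc.idx, Function.update s.mc.reg i r⟩ } := by
  ext a
  · cases a <;> simp [Mem.setCell, toMem]
  · rfl
@[simp] theorem setCell_nTape (i : ℕ) (r : R) : (s.toMem L x).setCell .nTape i r =
    toMem L x { s with nc := ⟨s.nc.label, s.nc.idx, Function.update s.nc.reg i r⟩ } := by
  ext a
  · cases a <;> simp [Mem.setCell, toMem]
  · rfl

end St

/-- The first simulated machine. -/
def mSlot : Slot Arr Var := ⟨.mTape, .mIdx, .mPc⟩

/-- The second simulated machine. -/
def nSlot : Slot Arr Var := ⟨.nTape, .nIdx, .nPc⟩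

theorem mSlot_isView (x : ℕ → R) (s : St R) :
    mSlot.IsView fun c => St.toMem L x { s with mc := c } := by
  constructor <;> intros <;> simp [mSlot]; rfl

theorem nSlot_isView (x : ℕ → R) (s : St R) :
    nSlot.IsView fun c => St.toMem L x { s with nc := c } := by
  constructor <;> intros <;> simp [nSlot]; rfl

namespace Stmt

/-! ### Routines -/

/-- Appends a symbol to the input of the second machine. -/
def append (a : Arr) (i : Var) : Stmt L Arr Var :=
  .seqs [.copy .nTape (.nIdx 0) a i, .incr (.nIdx 0)]

/-- Appends a string, taken from every second position of the input starting at the pointer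
number `i`. -/
def block (d i : ℕ) : Stmt L Arr Var := .seqs
  [.upTo d .c .rr (.seqs [.ifIdx .c .zero (append .kon .one) (append .kon .zero),
      append .inp (.p i), .incr (.p i), .incr (.p i)]),
    .upTo d .c .rr (.seqs [.decr (.p i), .decr (.p i)])]

/-- Moves the pointers with numbers below `K`. -/
def shift (K : ℕ) (a : ℕ → ℕ) : Stmt L Arr Var :=
  .seqs ((List.range K).map fun i => .times (a i) (.incr (.p i)))

/-- Initializes the constants, and puts the length of the input into the variable `xl`. -/
def startup : Stmt L Arr Var :=
  .seqs [.const (.kon, 1) true, .incr .one, .loop (.incr .xl), .decr .xl, .decr .xl]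

/-- Reads one tag of the input. -/
def parseBody (K : ℕ) : Stmt L Arr Var := .seqs
  [.copy .tmp .zero .inp .h,
    .ifEq (.tmp, 0) (.kon, 1) (.ifIdx .g .zero (.incr .g) (.incr .g')) .skip,
    .ifIdx .g .zero (.seqs [.incr .nn, shift K fun _ => 2])
      (.ifIdx .g' .zero (.seqs [.incr .mm, shift K fun i => 2 * i]) .skip),
    .incr .h, .incr .h]

/-- Finds the lengths and the positions of the entries of a tuple. -/
def parse (K : ℕ) : Stmt L Arr Var :=
  .seqs [startup, .untilEq 1 .h .xl (parseBody K), shift K fun _ => 1]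

variable {N : ℕ} (x : ℕ → R) (s : St R)

/-- Writing at the end of the input and increasing `I[0]` leads from one initial configuration to
another; this is the invariant while the input of a simulated machine is built. -/
theorem initConfig_append_singleton (l : List R) (a : R) :
    initConfig L (l ++ [a]) = ⟨0, Function.update (initConfig L l).idx 0 (l.length + 1),
      Function.update (initConfig L l).reg l.length a⟩ := by
  simp only [initConfig, Config.mk.injEq, true_and]
  constructor
  · funext j
    by_cases h : j = 0 <;> simp [h]
  · funext i
    rcases lt_trichotomy i l.length with h | h | h
    · rw [Function.update_of_ne h.ne, List.getD_append _ _ _ _ h]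
    · subst h
      simp
    · rw [Function.update_of_ne h.ne', List.getD_eq_default _ _ (by simp; omega),
        List.getD_eq_default _ _ h.le]

theorem exec_append {l : List R} (hs : s.nc = initConfig L l) (a : Arr) (i : Var) :
    (append a i : Stmt L Arr Var).exec N (s.toMem L x) = St.toMem L x
      { s with nc := initConfig L (l ++ [(s.toMem L x).arr a ((s.toMem L x).var i)]) } := by
  have h0 : (initConfig L l).idx 0 = l.length := rfl
  simp only [append, exec_seqs_cons, exec_seqs_nil, exec, St.var_nIdx, St.setCell_nTape,
    St.setVar_nIdx, initConfig_append_singleton, hs, h0]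
  rfl

theorem exec_shift (K : ℕ) (a : ℕ → ℕ) :
    (shift K a : Stmt L Arr Var).exec N (s.toMem L x) =
      St.toMem L x { s with p := fun i => if i < K then s.p i + a i else s.p i } := by
  rw [shift]
  induction K with
  | zero => simp [exec_seqs_nil]
  | succ K ih =>
    rw [List.range_succ, List.map_append, List.map_singleton, exec_seqs_concat, ih, exec_times_incr,
      St.setVar_p]
    congr 2
    funext i
    simp only [Function.update_apply, St.var_p, lt_irrefl, if_false]
    split_ifs <;> first | rfl | omega | (subst_vars; rfl)

theorem exec_block {d i : ℕ} {l : List R} (hc : s.c = 0) (hr : s.rr ≤ N ^ d)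
    (hs : s.nc = initConfig L l) :
    (block d i : Stmt L Arr Var).exec N (s.toMem L x) = St.toMem L x
      { s with nc := initConfig L (l ++ tagString L (oneElt L)
        ((List.range s.rr).map fun j => x (s.p i + 2 * j))) } := by
  obtain ⟨r, hr'⟩ : ∃ r, s.rr = r := ⟨_, rfl⟩
  rw [hr'] at hr
  let nc (j : ℕ) : Config R := initConfig L (l ++ tagString L (oneElt L)
    ((List.range j).map fun j => x (s.p i + 2 * j)))
  have h₁ := exec_upTo (N := N) (d := d) (i := Var.c) (j := Var.rr) (k := r)
    (S := (.seqs [.ifIdx .c .zero (append .kon .one) (append .kon .zero),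
      append .inp (.p i), .incr (.p i), .incr (.p i)] : Stmt L Arr Var))
    (fun j => St.toMem L x
      { s with nc := nc j, p := Function.update s.p i (s.p i + 2 * j) }) hr (by simp)
    (fun _ => hc) (fun _ => hr') (by
      intro j hj
      have e : (Stmt.ifIdx .c .zero (append .kon .one) (append .kon .zero) :
          Stmt L Arr Var).exec N (St.toMem L x
            { s with nc := nc j, p := Function.update s.p i (s.p i + 2 * j), c := j }) =
          St.toMem L x
            { s with nc := initConfig L (l ++ tagString L (oneElt L)
                ((List.range j).map fun j => x (s.p i + 2 * j)) ++
                  [if j = 0 then oneElt L else zeroElt L])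
                     p := Function.update s.p i (s.p i + 2 * j), c := j } := by
        by_cases h : j = 0
        · rw [exec_ifIdx_pos (by simpa using h), exec_append _ _ rfl]
          simp [h]
        · rw [exec_ifIdx_neg (by simpa using h), exec_append _ _ rfl]
          simp [h]
      simp only [St.setVar_c, exec_seqs_cons, e]
      rw [exec_append _ _ rfl]
      simp only [exec_seqs_nil, exec, St.var_p, St.setVar_p, Function.update_self,
        Function.update_idem, nc, St.arr_inp]
      rw [List.range_succ, List.map_append, List.map_singleton, tagString_append_singleton]
      simp [add_assoc, mul_add])
  -- The pointer is moved back, so the same entry can be read again from the same place.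
  have h₂ := exec_upTo (N := N) (d := d) (i := Var.c) (j := Var.rr) (k := r)
    (S := (.seqs [.decr (.p i), .decr (.p i)] : Stmt L Arr Var))
    (fun j => St.toMem L x
      { s with nc := nc r, p := Function.update s.p i (s.p i + 2 * (r - j)) }) hr (by simp)
    (fun _ => hc) (fun _ => hr') (by
      intro j hj
      simp only [St.setVar_c, exec_seqs_cons, exec_seqs_nil, exec, St.var_p, St.setVar_p,
        Function.update_self, Function.update_idem]
      rw [show s.p i + 2 * (r - j) - 1 - 1 = s.p i + 2 * (r - (j + 1)) by omega])
  simp only [Nat.sub_self, Nat.sub_zero, mul_zero, add_zero, Function.update_eq_self] at h₁ h₂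
  have h0 : nc 0 = s.nc := by simp [nc, hs, tagString]
  rw [h0] at h₁
  simp only [block, exec_seqs_cons, exec_seqs_nil]
  rw [h₁, h₂]
  simp only [nc, hr']

end Stmt

variable (L) in
/-- The state at the start of a computation on an input of length `n`. -/
def St.init (n : ℕ) : St R where
  mc := initConfig L []
  nc := initConfig L []
  tmp := zeroElt L
  p := fun _ => 0
  c := 0
  xl := n
  h := 0
  g := 0
  g' := 0
  nn := 0
  mm := 0
  o := 0
  bad := 0
  rr := 0
  e := 0

namespace Stmt

theorem exec_startup (x : List R) :
    (startup : Stmt L Arr Var).exec (x.length + 2) (initMem L .inp x) =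
      (St.init L x.length).toMem L fun i => x.getD i (zeroElt L) := by
  have h₁ : (Stmt.incr .one : Stmt L Arr Var).exec (x.length + 2)
      ((Stmt.const (.kon, 1) true : Stmt L Arr Var).exec (x.length + 2) (initMem L .inp x)) =
      (St.init L 0).toMem L fun i => x.getD i (zeroElt L) := by
    ext a
    · cases a <;>
      simp [exec, Mem.setVar, Mem.setCell, initMem, St.toMem, St.init, Function.update_apply,
        boolElt, initConfig]
    · cases a <;>
      simp [exec, Mem.setVar, Mem.setCell, initMem, St.toMem, St.init, initConfig]
  have h₂ : (Stmt.loop (.incr .xl) : Stmt L Arr Var).exec (x.length + 2)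
      ((St.init L 0).toMem L fun i => x.getD i (zeroElt L)) =
      (St.init L (x.length + 2)).toMem L fun i => x.getD i (zeroElt L) := by
    rw [exec, ← exec_times, exec_times_incr]
    simp [St.init]
  simp only [startup, exec_seqs_cons, exec_seqs_nil, h₁, h₂]
  simp [exec, St.init]

/-- All `K` pointers are computed during one scan, without multiplication. For each symbol of the
first entry every pointer moves by `2`, and for each symbol of the next entry pointer `i` moves by
`2 * i`, which adds up to `2 * n + 2 * m * i` since the entries have equal length `m`. The final
shift by `1` skips the tag. The variable `g` records whether a tag `1` has been seen, and `g'`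
counts the further ones. The assumption `0 < m` makes every entry visible through its tag. -/
theorem exec_parse {K n m : ℕ} (hm : 0 < m) (hK : 0 < K) (x : List R)
    (hx : x.length = 2 * (n + m * K))
    (htag : ∀ j < n + m * K,
      x.getD (2 * j) (zeroElt L) = oneElt L ↔ n ≤ j ∧ (j - n) % m = 0) :
    ∃ tmp g',
      (parse K : Stmt L Arr Var).exec (x.length + 2) (initMem L .inp x) =
        St.toMem L (fun i => x.getD i (zeroElt L))
          { (St.init L x.length : St R) with
            tmp := tmp
            g' := g'
            g := 1
            h := x.length
            nn := n
            mm := m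
            p := fun i => if i < K then 2 * n + 2 * m * i + 1 else 0 } := by
  set x' : ℕ → R := fun i => x.getD i (zeroElt L) with hx'
  -- The memory after `j` tagged symbols. The counters `nn` and `mm` saturate at `n` and `m`, and
  -- truncated subtraction keeps `g'` and `mm` at zero up to `j = n`.
  let G (j : ℕ) : Mem Arr Var R := St.toMem L x'
    { (St.init L x.length : St R) with
      tmp := if j = 0 then zeroElt L else x' (2 * (j - 1))
      g' := (j - n - 1) / m
      g := if j ≤ n then 0 else 1
      h := 2 * j
      nn := min j n
      mm := min (j - n) m
      p := fun i => if i < K then 2 * min j n + 2 * i * min (j - n) m else 0 }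
  have h0 : (startup : Stmt L Arr Var).exec (x.length + 2) (initMem L .inp x) = G 0 := by
    rw [exec_startup]
    simp [G, St.init]
    rfl
  have h₁ := exec_untilEq (N := x.length + 2) (d := 1) (i := Var.h) (j := Var.xl)
    (S := (parseBody K : Stmt L Arr Var)) G (k := n + m * K) (by rw [hx, pow_one]; omega)
    (by
      intro j hj
      simp only [G, St.var_h, St.var_xl, St.init]
      omega)
    (by
      simp only [G, St.var_h, St.var_xl, St.init]
      omega)
    (by
      intro j hj
      obtain ⟨s, hs⟩ : ∃ s, s = { (St.init L x.length : St R) with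
        tmp := x' (2 * j)
        g' := (j - n - 1) / m
        g := if j ≤ n then 0 else 1
        h := 2 * j
        nn := min j n
        mm := min (j - n) m
        p := fun i => if i < K then 2 * min j n + 2 * i * min (j - n) m else 0 } := ⟨_, rfl⟩
      have h₁ : (copy .tmp .zero .inp .h : Stmt L Arr Var).exec (x.length + 2) (G j) =
          s.toMem L x' := by
        simp only [G, exec, St.var_zero, St.setCell_tmp, St.arr_inp, St.var_h, hs]
      have h₂ : ∀ g g' g₁ g₁' : ℕ, (x' (2 * j) = oneElt L → g = 0 → g₁ = 1 ∧ g₁' = g') →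
          (x' (2 * j) = oneElt L → g ≠ 0 → g₁ = g ∧ g₁' = g' + 1) →
          (x' (2 * j) ≠ oneElt L → g₁ = g ∧ g₁' = g') →
          (ifEq (.tmp, 0) (.kon, 1) (.ifIdx .g .zero (.incr .g) (.incr .g')) .skip :
            Stmt L Arr Var).exec (x.length + 2) (St.toMem L x' { s with g := g, g' := g' }) =
          St.toMem L x' { s with g := g₁, g' := g₁' } := by
        intro g g' g₁ g₁' a₁ a₂ a₃
        by_cases e : x' (2 * j) = oneElt L
        · rw [exec_ifEq_pos (by simpa [hs] using e)]
          by_cases e' : g = 0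
          · rw [exec_ifIdx_pos (by simpa using e')]
            simp [exec, a₁ e e', e']
          · rw [exec_ifIdx_neg (by simpa using e')]
            simp [exec, a₂ e e']
        · rw [exec_ifEq_neg (by simpa [hs] using e)]
          simp [exec, a₃ e]
      have htag' : x' (2 * j) = oneElt L ↔ n ≤ j ∧ (j - n) % m = 0 := htag j hj
      have h₃ := h₂ (if j ≤ n then 0 else 1) ((j - n - 1) / m) (if j + 1 ≤ n then 0 else 1)
        ((j + 1 - n - 1) / m) (by
          rintro h h'
          have : j = n := by
            have := (htag'.1 h).1
            by_contra
            rw [if_neg (by omega)] at h'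
            exact one_ne_zero h'
          subst this
          simp) (by
          rintro h h'
          obtain ⟨a₁, a₂⟩ := htag'.1 h
          have a₃ : n < j := by
            by_contra
            exact h' (if_pos (by omega))
          refine ⟨by rw [if_neg (by omega), if_neg (by omega)], ?_⟩
          obtain ⟨q, hq⟩ : ∃ q, j - n = q + 1 := ⟨j - n - 1, by omega⟩
          rw [show j + 1 - n - 1 = q + 1 by omega, show j - n - 1 = q by omega, Nat.succ_div,
            if_pos (hq ▸ Nat.dvd_of_mod_eq_zero a₂)]) (by
          intro h
          have a₁ : j ≠ n := by
            rintro rfl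
            exact h (htag'.2 (by simp))
          rcases lt_or_gt_of_ne a₁ with a₂ | a₂
          · rw [if_pos (by omega), if_pos (by omega)]
            exact ⟨rfl, by congr 1; omega⟩
          · refine ⟨by rw [if_neg (by omega), if_neg (by omega)], ?_⟩
            obtain ⟨q, hq⟩ : ∃ q, j - n = q + 1 := ⟨j - n - 1, by omega⟩
            rw [show j + 1 - n - 1 = q + 1 by omega, show j - n - 1 = q by omega, Nat.succ_div,
              if_neg (fun h' => h (htag'.2 ⟨a₂.le, hq ▸ Nat.mod_eq_zero_of_dvd h'⟩)), add_zero])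
      have e₁ : ({ s with g := if j ≤ n then 0 else 1, g' := (j - n - 1) / m } : St R) = s := by
        rw [hs]
      rw [e₁] at h₃
      have h₄ : (ifIdx .g .zero (.seqs [.incr .nn, shift K fun _ => 2])
          (.ifIdx .g' .zero (.seqs [.incr .mm, shift K fun i => 2 * i]) .skip) :
            Stmt L Arr Var).exec (x.length + 2) (St.toMem L x'
              { s with g := if j + 1 ≤ n then 0 else 1, g' := (j + 1 - n - 1) / m }) =
          St.toMem L x' { s with
            g := if j + 1 ≤ n then 0 else 1
            g' := (j + 1 - n - 1) / m
            nn := min (j + 1) n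
            mm := min (j + 1 - n) m
            p := fun i => if i < K then
              2 * min (j + 1) n + 2 * i * min (j + 1 - n) m else 0 } := by
        by_cases c₁ : j + 1 ≤ n
        · rw [exec_ifIdx_pos (by simp [c₁])]
          simp only [exec_seqs_cons, exec_seqs_nil, exec, exec_shift, St.setVar_nn, St.var_nn, hs]
          congr 2
          · funext i
            rw [show min (j + 1) n = min j n + 1 by omega, show j + 1 - n = j - n by omega]
            split_ifs <;> ring
          · omega
          · congr 1; omega
        · rw [exec_ifIdx_neg (by simp [c₁])]
          by_cases c₂ : j < n + m
          · rw [exec_ifIdx_pos (by simp; omega)]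
            simp only [exec_seqs_cons, exec_seqs_nil, exec, exec_shift, St.setVar_mm, St.var_mm, hs]
            congr 2
            · funext i
              rw [show min (j + 1) n = min j n by omega,
                show min (j + 1 - n) m = min (j - n) m + 1 by omega]
              split_ifs <;> ring
            · omega
            · omega
          · rw [exec_ifIdx_neg (by
              have : m ≤ j + 1 - n - 1 := by omega
              simpa using ⟨hm.ne', this⟩)]
            simp only [exec, hs]
            congr 2
            · funext i
              rw [show min (j + 1) n = min j n by omega,
                show min (j + 1 - n) m = min (j - n) m by omega]
            · omega
            · omega
      simp only [parseBody, exec_seqs_cons, exec_seqs_nil, h₁, h₃, h₄]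
      simp only [exec, St.setVar_h, St.var_h, G, hs]
      simp [mul_add])
  have hmK : m ≤ m * K := Nat.le_mul_of_pos_right _ hK
  have hlt : ¬ n + m * K ≤ n := by omega
  refine ⟨x' (2 * (n + m * K - 1)), (m * K - 1) / m, ?_⟩
  simp only [parse, exec_seqs_cons, exec_seqs_nil, h0, h₁]
  simp only [G, exec_shift]
  have e₁ : min (n + m * K) n = n := by omega
  have e₂ : min (n + m * K - n) m = m := by omega
  have e₃ : n + m * K - n = m * K := by omega
  rw [e₁, e₂, e₃, if_neg (by omega), if_neg hlt, hx]
  congr 2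
  funext i
  split_ifs <;> first | rfl | ring

end Stmt

end


/-- A coefficient `c` is at most `2 ^ c`, and hence at most `n ^ c` for `n ≥ 2`. This is why loops
run `|x| + 2` times. -/
theorem exists_eval_le_pow (p : Polynomial ℕ) : ∃ d, ∀ n, 2 ≤ n → p.eval n ≤ n ^ d := by
  induction p using Polynomial.induction_on' with
  | add p q hp hq =>
    obtain ⟨a, ha⟩ := hp
    obtain ⟨b, hb⟩ := hq
    refine ⟨max a b + 1, fun n hn => ?_⟩
    have h₁ := (ha n hn).trans (Nat.pow_le_pow_right (by omega) (le_max_left a b))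
    have h₂ := (hb n hn).trans (Nat.pow_le_pow_right (by omega) (le_max_right a b))
    rw [Polynomial.eval_add, pow_succ]
    nlinarith
  | monomial e c =>
    refine ⟨c + e, fun n hn => ?_⟩
    rw [Polynomial.eval_monomial, pow_add]
    exact Nat.mul_le_mul_right _
      (c.lt_two_pow_self.le.trans (Nat.pow_le_pow_left hn c))

theorem eval_mono (p : Polynomial ℕ) {m n : ℕ} (h : m ≤ n) : p.eval m ≤ p.eval n := by
  rw [Polynomial.eval_eq_sum_range, Polynomial.eval_eq_sum_range]
  exact Finset.sum_le_sum fun i _ => Nat.mul_le_mul_left _ (Nat.pow_le_pow_left h i)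

/-! ### Running a query-free machine as a subroutine. -/

section

variable {L : FirstOrder.Language.{u, v}} {R : Type w} [L.Structure R] [Bipointed L R]

theorem Config.output_eq_singleton {c : Config R} {r : R} :
    c.output = [r] ↔ c.idx 0 = 1 ∧ c.reg 0 = r := by
  constructor
  · intro h
    have h' : c.idx 0 = 1 := by simpa [Config.output] using congrArg List.length h
    exact ⟨h', (RMachine.output_eq_singleton (ℓ := c.label) h').1 h⟩
  · rintro ⟨h, h'⟩
    exact (RMachine.output_eq_singleton (ℓ := c.label) h).2 h'

namespace Stmt

variable (R) in
/-- Executes the second machine. -/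
noncomputable def runN (d : ℕ) (P : Program L) : Stmt L Arr Var :=
  .pow d (nSlot.step R .t (fun _ _ => .skip) P)

/-- Branches according to whether the second machine has accepted. -/
def testN (S T : Stmt L Arr Var) : Stmt L Arr Var :=
  .ifIdx (.nIdx 0) .one (.ifEq (.nTape, 0) (.kon, 1) S T) T

/-- Appends `K` strings, taken from the pointers `σ 0, …, σ (K - 1)`. -/
def blocks (d K : ℕ) (σ : ℕ → ℕ) : Stmt L Arr Var :=
  .seqs ((List.range K).map fun i => block d (σ i))

variable {N : ℕ} (x : ℕ → R) (s : St R)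

/-- Without queries every oracle gives the same run; `N ^ d` steps are made, whether or not the
machine has halted before. -/
theorem exec_runN {d : ℕ} {P : Program L} (hP : P.ConstantFree R) (hQ : P.QueryFree) :
    (runN R d P).exec N (s.toMem L x) =
      St.toMem L x { s with nc := (stay ∅ P)^[N ^ d] s.nc } := by
  rw [runN, exec_pow]
  have h := (nSlot_isView (L := L) x s).exec_step (N := N) (t := .t) (by simp [nSlot])
    (fun _ => rfl) (fun _ _ => .skip) hP hQ ∅
  exact (Function.Semiconj.iterate_right (f := fun c => St.toMem L x { s with nc := c })
    (fun c => (h c).symm) (N ^ d) s.nc).symm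

theorem exec_testN_pos (h : s.nc.output = [oneElt L]) (S T : Stmt L Arr Var) :
    (testN S T).exec N (s.toMem L x) = S.exec N (s.toMem L x) := by
  rw [Config.output_eq_singleton] at h
  rw [testN, exec_ifIdx_pos (by simpa using h.1), exec_ifEq_pos (by simpa using h.2)]

theorem exec_testN_neg (h : s.nc.output ≠ [oneElt L]) (S T : Stmt L Arr Var) :
    (testN S T).exec N (s.toMem L x) = T.exec N (s.toMem L x) := by
  rw [Ne, Config.output_eq_singleton] at h
  rw [testN]
  by_cases h₁ : s.nc.idx 0 = 1
  · rw [exec_ifIdx_pos (by simpa using h₁), exec_ifEq_neg (by simpa using fun h₂ => h ⟨h₁, h₂⟩)]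
  · rw [exec_ifIdx_neg (by simpa using h₁)]

theorem exec_blocks {d K : ℕ} {σ : ℕ → ℕ} {l : List R} (hc : s.c = 0) (hr : s.rr ≤ N ^ d)
    (hs : s.nc = initConfig L l) :
    (blocks d K σ : Stmt L Arr Var).exec N (s.toMem L x) = St.toMem L x
      { s with nc := initConfig L (l ++ ((List.range K).map fun i =>
        (List.range s.rr).map fun j => x (s.p (σ i) + 2 * j)).flatMap
          (tagString L (oneElt L))) } := by
  rw [blocks]
  induction K with
  | zero =>
    simp [exec_seqs_nil, ← hs]
  | succ K ih =>
    rw [List.range_succ, List.map_append, List.map_singleton, exec_seqs_concat, ih,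
      exec_block _ _ (by exact hc) (by exact hr) rfl]
    simp

/-- Sets the single cell according to whether the second machine has accepted. -/
def finish (f : Bool) : Stmt L Arr Var := testN (.const (.tmp, 0) f) (.const (.tmp, 0) !f)

theorem exec_finish (f : Bool) :
    ((finish f : Stmt L Arr Var).exec N (s.toMem L x)).arr .tmp 0 = oneElt L ↔
      (s.nc.output = [oneElt L] ↔ f = true) := by
  rw [finish]
  by_cases h : s.nc.output = [oneElt L]
  · rw [exec_testN_pos _ _ h]
    cases f <;> simp [exec, boolElt, h, zeroElt_ne_oneElt (L := L)]
  · rw [exec_testN_neg _ _ h]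
    cases f <;> simp [exec, boolElt, h, zeroElt_ne_oneElt (L := L)]

/-! ### Truncation of witnesses -/

/-- Reads one symbol of the tags of `(v, w)` and counts the symbols of `w`. -/
def scanBody : Stmt L Arr Var := .seqs
  [.copy .tmp .zero .nTape .h, .ifEq (.tmp, 0) (.kon, 1) (.incr .g) .skip,
    .ifIdx .g .zero .skip (.incr .rr), .incr .h, .incr .h]

variable (R) in
/-- On input `(x, w₁, …, w_k)`, where `x` is the string that represents `(v, w₀)` followed by one
symbol, decides whether `P` accepts `(v, w₀, w₁', …, w_k')`, where `w_i'` has the length of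
`w₀`. -/
noncomputable def truncating (d k : ℕ) (P : Program L) (f : Bool) : Stmt L Arr Var := .seqs
  [parse k, .decr .nn, .incr .e, .upTo d .c .nn (.seqs [append .inp .e, .incr .e, .incr .e]),
    .clear d .h, .decr .g, .untilEq d .h .nn scanBody, blocks d k id, runN R d P, finish f]

/-- The length of `w` can be read off the encoding: counting starts at the only tag `1`. If `w` is
empty there is no such tag, and the count remains `0`, as it should. -/
theorem exec_scan {d : ℕ} {v w : List R} (hd : v.length + w.length ≤ N ^ d)
    (hn : s.nn = 2 * (v.length + w.length)) (hh : s.h = 0) (hg : s.g = 0) (hr : s.rr = 0)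
    (hs : s.nc = initConfig L (tupleString L v [w])) :
    ∃ tmp g h, (untilEq d .h .nn scanBody : Stmt L Arr Var).exec N (s.toMem L x) =
      St.toMem L x { s with tmp := tmp, g := g, h := h, rr := w.length } := by
  obtain ⟨a, ha⟩ : ∃ a, v.length = a := ⟨_, rfl⟩
  obtain ⟨b, hb⟩ : ∃ b, w.length = b := ⟨_, rfl⟩
  let f (j : ℕ) : R := s.nc.reg j
  have hf : ∀ j < a + b, f (2 * j) = oneElt L ↔ j = a := by
    intro j hj
    have hf' : ∀ j, f j = (tupleString L v [w]).getD j (zeroElt L) := by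
      intro j
      simp [f, hs, initConfig]
    rw [hf']
    rcases Nat.lt_or_ge j a with h | h
    · rw [(tupleString_getD_left (L := L) v (by simp) _ (by omega)).1]
      simp only [zeroElt_ne_oneElt (L := L), false_iff]
      omega
    · have := (tupleString_getD_right (L := L) v (ws := [w]) (m := b) (by simpa using hb) (by simp)
        (zeroElt L) (i := 0) (j := j - a) (by simp) (by omega)).1
      rw [mul_zero, add_zero, ha, ← mul_add, Nat.add_sub_cancel' h] at this
      rw [this]
      have e : j - a = 0 ↔ j = a := by omega
      by_cases h' : j = a
      · simp [h']
      · simp [h', e, zeroElt_ne_oneElt (L := L)]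
  let G (j : ℕ) : Mem Arr Var R := St.toMem L x
    { s with
      tmp := if j = 0 then s.tmp else f (2 * (j - 1))
      g := if j ≤ a then 0 else 1
      h := 2 * j
      rr := j - a }
  have h₁ := exec_untilEq (N := N) (d := d) (i := Var.h) (j := Var.nn)
    (S := (scanBody : Stmt L Arr Var)) G (k := a + b) (by omega)
    (by
      intro j hj
      simp only [G, St.var_h, St.var_nn]
      omega)
    (by
      simp only [G, St.var_h, St.var_nn]
      omega)
    (by
      intro j hj
      have h₁ : (copy .tmp .zero .nTape .h : Stmt L Arr Var).exec N (G j) =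
          St.toMem L x { s with
            tmp := f (2 * j)
            g := if j ≤ a then 0 else 1
            h := 2 * j
            rr := j - a } := by
        simp only [G, exec, St.var_zero, St.setCell_tmp, St.arr_nTape, St.var_h, f]
      simp only [scanBody, exec_seqs_cons, exec_seqs_nil, h₁]
      by_cases e : j = a
      · rw [exec_ifEq_pos (by simpa using (hf j hj).2 e)]
        simp only [exec_incr, St.var_g, St.setVar_g]
        rw [exec_ifIdx_neg (by simp [e])]
        simp [exec, G, e, mul_add]
      · rw [exec_ifEq_neg (by simpa using fun h => e ((hf j hj).1 h)), exec_skip]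
        rcases lt_or_gt_of_ne e with h | h
        · rw [exec_ifIdx_pos (by simp [h.le])]
          simp only [exec, St.setVar_h, St.var_h, G]
          rw [if_pos h.le, if_pos (show j + 1 ≤ a by omega), show j - a = 0 by omega,
            show j + 1 - a = 0 by omega]
          simp [mul_add]
        · rw [exec_ifIdx_neg (by simp [h])]
          simp only [exec, St.setVar_h, St.var_h, St.setVar_rr, St.var_rr, G]
          rw [if_neg (by omega), if_neg (show ¬ j + 1 ≤ a by omega),
            show j + 1 - a = j - a + 1 by omega]
          simp [mul_add])
  have h0 : G 0 = s.toMem L x := by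
    simp only [G]
    congr 1
    ext <;> simp [hh, hg, hr]
  rw [← h0, h₁, hb]
  refine ⟨if a + b = 0 then s.tmp else f (2 * (a + b - 1)), if a + b ≤ a then 0 else 1,
    2 * (a + b), ?_⟩
  simp only [G, Nat.add_sub_cancel_left]

/-- The machine copies the encoding of `(v, w)` without the last symbol `r`, recovers `|w|` from its
tags, appends the first `|w|` symbols of every other entry, and runs `P` on the result. The extra
symbol makes the common length `m` of all entries positive, as parsing requires. -/
theorem exec_truncating {d k : ℕ} (hk : 0 < k) (hd : 0 < d) {P : Program L}
    (hP : P.ConstantFree R) (hQ : P.QueryFree) (f : Bool) {p : Polynomial ℕ}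
    (hp : ∀ x : List R, ∃ t ≤ p.eval x.length, ∃ c, HaltsAt ∅ P x t c)
    (hpd : ∀ n, 2 ≤ n → p.eval n ≤ n ^ d) (v w : List R) (r : R) (ws : List (List R))
    (hk' : ws.length = k) (hws : ∀ y ∈ ws, y.length = (tupleString L v [w] ++ [r]).length) :
    ((truncating R d k P f).exec ((tupleString L (tupleString L v [w] ++ [r]) ws).length + 2)
      (initMem L .inp (tupleString L (tupleString L v [w] ++ [r]) ws))).arr .tmp 0 = oneElt L ↔
        (Accepts ∅ P (tupleString L v (w :: ws.map fun y => y.take w.length)) ↔ f = true) := by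
  obtain ⟨a, ha⟩ : ∃ a, v.length = a := ⟨_, rfl⟩
  obtain ⟨b, hb⟩ : ∃ b, w.length = b := ⟨_, rfl⟩
  obtain ⟨y, hy⟩ : ∃ y, y = tupleString L v [w] ++ [r] := ⟨_, rfl⟩
  have hvw : (tupleString L v [w]).length = 2 * (a + b) := by
    rw [length_tupleString v (m := b) (by simpa using hb) (by simp), ha]
    simp
    ring
  have hyl : y.length = 2 * (a + b) + 1 := by
    rw [hy, List.length_append, hvw]
    rfl
  have hne : ws ≠ [] := by
    rintro rfl
    simp at hk'
    omega
  obtain ⟨m, hm⟩ : ∃ m, m = 2 * (a + b) + 1 := ⟨_, rfl⟩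
  rw [← hy] at hws ⊢
  have hws' : ∀ z ∈ ws, z.length = m := fun z hz => by rw [hws z hz, hyl, hm]
  obtain ⟨X, hX⟩ : ∃ X, X = tupleString L y ws := ⟨_, rfl⟩
  rw [← hX]
  have hXl : X.length = 2 * (m + m * k) := by
    rw [hX, length_tupleString y hws' hne, hyl, hk', ← hm]
    ring
  have hXy : ∀ j < m, X.getD (2 * j) (zeroElt L) = zeroElt L ∧
      X.getD (2 * j + 1) (zeroElt L) = y.getD j (zeroElt L) := by
    intro j hj
    rw [hX]
    exact tupleString_getD_left y hne _ (by omega)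
  have hXw : ∀ i < k, ∀ j < m, X.getD (2 * m + 2 * m * i + 2 * j) (zeroElt L) =
      (if j = 0 then oneElt L else zeroElt L) ∧
      X.getD (2 * m + 2 * m * i + 2 * j + 1) (zeroElt L) = (ws.getD i []).getD j (zeroElt L) := by
    intro i hi j hj
    have := tupleString_getD_right (L := L) y hws' hne (zeroElt L) (i := i) (j := j) (by omega) hj
    rwa [hyl, ← hm, ← hX] at this
  have htag : ∀ j < m + m * k,
      X.getD (2 * j) (zeroElt L) = oneElt L ↔ m ≤ j ∧ (j - m) % m = 0 := by
    intro j hj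
    rcases Nat.lt_or_ge j m with h | h
    · rw [(hXy j h).1]
      simp only [zeroElt_ne_oneElt (L := L), false_iff]
      omega
    · have hq := Nat.div_add_mod (j - m) m
      have hm0 : 0 < m := by omega
      have hi : (j - m) / m < k := by
        rw [Nat.div_lt_iff_lt_mul hm0, mul_comm]
        omega
      have := (hXw _ hi _ (Nat.mod_lt (j - m) hm0)).1
      rw [mul_assoc, ← mul_add, ← mul_add, add_assoc, hq, Nat.add_sub_cancel' h] at this
      rw [this]
      by_cases h' : (j - m) % m = 0
      · simp [h', h]
      · simp [h', zeroElt_ne_oneElt (L := L)]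
  obtain ⟨tmp, g', h₁⟩ := exec_parse (K := k) (n := m) (m := m) (by omega) hk X hXl htag
  obtain ⟨x', hx'⟩ : ∃ x' : ℕ → R, x' = fun i => X.getD i (zeroElt L) := ⟨_, rfl⟩
  obtain ⟨N, hN⟩ : ∃ N, N = X.length + 2 := ⟨_, rfl⟩
  rw [← hx', ← hN] at h₁
  rw [← hN]
  have hNd : N ≤ N ^ d := Nat.le_self_pow hd.ne' N
  have hmk : m ≤ m * k := Nat.le_mul_of_pos_right _ hk
  obtain ⟨s, hs⟩ : ∃ s, s = { (St.init L X.length : St R) with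
      tmp := tmp
      g' := g'
      g := 1
      h := X.length
      nn := 2 * (a + b)
      mm := m
      e := 1
      p := fun i => if i < k then 2 * m + 2 * m * i + 1 else 0 } := ⟨_, rfl⟩
  have h₂ : (Stmt.incr .e : Stmt L Arr Var).exec N ((Stmt.decr .nn : Stmt L Arr Var).exec N
      ((parse k : Stmt L Arr Var).exec N (initMem L .inp X))) = s.toMem L x' := by
    rw [h₁]
    simp only [exec, St.var_nn, St.setVar_nn, St.var_e, St.setVar_e, hs]
    rw [hm]
    rfl
  -- The symbols of the first entry stand at odd positions, which explains the start `e = 1`. The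
  -- decrement of `nn` has excluded the last symbol.
  have h₃ := exec_upTo (N := N) (d := d) (i := Var.c) (j := Var.nn) (k := 2 * (a + b))
    (S := (.seqs [append .inp .e, .incr .e, .incr .e] : Stmt L Arr Var))
    (fun j => St.toMem L x' { s with
      nc := initConfig L ((List.range j).map fun i => x' (2 * i + 1))
      e := 2 * j + 1 }) (by omega) (by simp) (fun _ => by simp [hs, St.init])
    (fun _ => by simp [hs]) (by
      intro j hj
      simp only [St.setVar_c, exec_seqs_cons, exec_seqs_nil]
      rw [exec_append _ _ rfl]
      simp [exec, List.range_succ, mul_add])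
  have e₁ : (List.range (2 * (a + b))).map (fun i => x' (2 * i + 1)) = tupleString L v [w] := by
    refine List.ext_getElem (by simp [hvw]) fun i hi hi' => ?_
    have := (hXy i (by omega)).2
    simp only [List.getElem_map, List.getElem_range, hx']
    rw [this, hy, List.getD_append _ _ _ _ hi', List.getD_eq_getElem _ _ hi']
  have e₂ : ({ s with
      nc := initConfig L ((List.range 0).map fun i => x' (2 * i + 1))
      e := 2 * 0 + 1 } : St R) = s := by
    rw [hs]
    rfl
  simp only [e₂] at h₃
  rw [e₁] at h₃
  obtain ⟨s₁, hs₁⟩ : ∃ s₁, s₁ = { s with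
    nc := initConfig L (tupleString L v [w])
    e := 2 * (2 * (a + b)) + 1
    h := 0
    g := 0 } := ⟨_, rfl⟩
  -- Parsing leaves `h` at the end of the input and `g = 1`; both must be zero for the second scan.
  have h₄ : (Stmt.decr .g : Stmt L Arr Var).exec N ((Stmt.clear d .h : Stmt L Arr Var).exec N
      (St.toMem L x' { s with
        nc := initConfig L (tupleString L v [w])
        e := 2 * (2 * (a + b)) + 1 })) = s₁.toMem L x' := by
    rw [exec_clear (by simp only [St.var_h, hs]; omega)]
    simp only [exec_decr, St.setVar_h, St.setVar_g, St.var_g, hs₁]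
    simp [hs]
  obtain ⟨tmp', g, h, h₅⟩ := exec_scan (L := L) (N := N) (d := d) x' s₁ (v := v) (w := w) (by omega)
    (by simp [hs₁, hs, ha, hb]) (by simp [hs₁]) (by simp [hs₁]) (by simp [hs₁, hs, St.init])
    (by simp [hs₁])
  have h₆ := exec_blocks (L := L) (N := N) (d := d) (K := k) (σ := id) (l := tupleString L v [w]) x'
    { s₁ with tmp := tmp', g := g, h := h, rr := w.length } (by simp [hs₁, hs, St.init])
    (by simp only; omega) (by simp [hs₁])
  have e₃ : tupleString L v [w] ++ ((List.range k).map fun i =>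
      (List.range w.length).map fun j => x' (s₁.p (id i) + 2 * j)).flatMap
        (tagString L (oneElt L)) =
      tupleString L v (w :: ws.map fun y => y.take w.length) := by
    have : ((List.range k).map fun i =>
        (List.range w.length).map fun j => x' (s₁.p (id i) + 2 * j)) =
        ws.map fun y => y.take w.length := by
      refine List.ext_getElem (by simp [hk']) fun i hi hi' => ?_
      have hi : i < k := by simpa using hi
      have hwi : ws[i].length = m := hws' _ (List.getElem_mem _)
      simp only [List.getElem_map, List.getElem_range]
      refine List.ext_getElem (by
        rw [List.length_map, List.length_range, List.length_take, hwi, hb]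
        omega) fun j hj hj' => ?_
      have hj : j < b := by simpa [hb] using hj
      have := (hXw i hi j (by omega)).2
      simp only [List.getElem_map, List.getElem_range, List.getElem_take, hx', hs₁, hs, id, hi,
        if_true]
      rw [show 2 * m + 2 * m * i + 1 + 2 * j = 2 * m + 2 * m * i + 2 * j + 1 by ring, this,
        List.getD_eq_getElem ws _ (by omega), List.getD_eq_getElem _ _ (by omega)]
    rw [this, tupleString_of_ne_nil _ (by simp), tupleString_of_ne_nil _ (by simp)]
    simp
  simp only [e₃] at h₆
  obtain ⟨z, hz⟩ : ∃ z, z = tupleString L v (w :: ws.map fun y => y.take w.length) := ⟨_, rfl⟩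
  rw [← hz] at h₆ ⊢
  -- Truncation makes the new tuple no longer than the input, so the time bound in terms of `N`
  -- applies to it.
  have hzl : z.length ≤ N := by
    rw [hz, length_tupleString v (m := b) (by
      simp only [List.mem_cons, List.mem_map, forall_eq_or_imp, hb, true_and,
        forall_exists_index, and_imp]
      rintro _ y hy rfl
      rw [List.length_take, hws' y hy]
      omega) (by simp), ha, List.length_cons, List.length_map, hk']
    nlinarith
  obtain ⟨t, ht, c, hc⟩ := hp z
  have ht' : t ≤ N ^ d := ht.trans ((eval_mono p hzl).trans (hpd N (by omega)))
  simp only [truncating, exec_seqs_cons, exec_seqs_nil, h₂, h₃, h₄, h₅, h₆, exec_runN _ _ hP hQ]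
  rw [exec_finish, hc.accepts_iff, hc.stay_iterate ht']

end Stmt

end


/-! ### Alternating quantifiers -/

/-- The other quantifier. -/
def Quant.dual : Quant → Quant
  | .ex => .all
  | .all => .ex

section Alternates

variable {R : Type w} {m : ℕ}

/-- The matrices only have to agree on tuples of the right number and lengths of witnesses. -/
theorem Alternates.congr {k : ℕ} {q : Quant} {φ ψ : List (List R) → Prop}
    (h : ∀ ws : List (List R), ws.length = k → (∀ y ∈ ws, y.length = m) → (φ ws ↔ ψ ws)) :
    Alternates m q k φ ↔ Alternates m q k ψ := by
  induction k generalizing q φ ψ with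
  | zero => exact h [] rfl (by simp)
  | succ k ih =>
    have key : ∀ (q : Quant) (y : List R), y.length = m →
        (Alternates m q k (fun ws => φ (y :: ws)) ↔ Alternates m q k fun ws => ψ (y :: ws)) :=
      fun q y hy => ih fun ws hk hws => h _ (by simp [hk]) (by simpa [hy] using hws)
    cases q with
    | ex => exact exists_congr fun y => and_congr_right fun hy => key _ y hy
    | all => exact forall_congr' fun y => imp_congr_right fun hy => key _ y hy

theorem Alternates.not {k : ℕ} {q : Quant} {φ : List (List R) → Prop} :
    ¬ Alternates m q k φ ↔ Alternates m q.dual k fun ws => ¬ φ ws := by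
  induction k generalizing q φ with
  | zero => rfl
  | succ k ih =>
    cases q with
    | ex =>
      simp only [Alternates, Quant.dual, not_exists, not_and]
      exact forall_congr' fun y => imp_congr_right fun hy => ih
    | all =>
      simp only [Alternates, Quant.dual, not_forall, exists_prop]
      exact exists_congr fun y => and_congr_right fun hy => ih

/-- Quantifiers over strings that consist of independent parts. -/
theorem Alternates.forall_map [Nonempty R] {ι : Type*} {l : ι → ℕ} {f : ι → List R → List R}
    (hf : ∀ y : List R, y.length = m → ∀ t, (f t y).length = l t)
    (hs : ∀ z : ι → List R, (∀ t, (z t).length = l t) →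
      ∃ y : List R, y.length = m ∧ ∀ t, f t y = z t)
    {k : ℕ} {q : Quant} {φ : ι → List (List R) → Prop} :
    Alternates m q k (fun ws => ∀ t, φ t (ws.map (f t))) ↔
      ∀ t, Alternates (l t) q k (φ t) := by
  induction k generalizing q φ with
  | zero => rfl
  | succ k ih =>
    cases q with
    | ex =>
      simp only [Alternates, List.map_cons]
      constructor
      · rintro ⟨y, hy, h⟩ t
        exact ⟨f t y, hf y hy t, (ih (φ := fun t zs => φ t (f t y :: zs))).1 h t⟩
      · intro h
        -- The parts are chosen separately and assembled into one string.
        choose z hz h using h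
        obtain ⟨y, hy, hyz⟩ := hs z hz
        refine ⟨y, hy, (ih (φ := fun t zs => φ t (f t y :: zs))).2 fun t => ?_⟩
        rw [hyz]
        exact h t
    | all =>
      simp only [Alternates, List.map_cons]
      constructor
      · intro h t z hz
        obtain ⟨r⟩ := ‹Nonempty R›
        classical
        -- A universal statement about one part is obtained by padding the other parts arbitrarily.
        obtain ⟨y, hy, hyz⟩ := hs (Function.update (fun t => List.replicate (l t) r) t z) (by
          intro t'
          by_cases e : t' = t
          · subst e
            simpa using hz
          · simp [e])
        have := (ih (φ := fun t zs => φ t (f t y :: zs))).1 (h y hy) t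
        rwa [hyz, Function.update_self] at this
      · intro h y hy
        exact (ih (φ := fun t zs => φ t (f t y :: zs))).2 fun t => h t _ (hf y hy t)

/-- The case of `Alternates.forall_map` with a single part, an initial segment: every shorter string
can be padded. -/
theorem Alternates.take [Nonempty R] {l : ℕ} (hl : l ≤ m) {k : ℕ} {q : Quant}
    {φ : List (List R) → Prop} :
    Alternates m q k (fun ws => φ (ws.map (List.take l))) ↔ Alternates l q k φ := by
  obtain ⟨r⟩ := ‹Nonempty R›
  have : Nonempty R := ⟨r⟩
  have h := Alternates.forall_map (m := m) (ι := Unit) (l := fun _ => l)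
    (f := fun _ => List.take l) (fun y hy _ => by simp [hy, hl]) (fun z hz => ⟨z () ++ List.replicate (m - l) r,
      by simp [hz, hl], fun _ => by simp [← hz ()]⟩) (k := k) (q := q) (φ := fun _ => φ)
  simpa using h

theorem Alternates.const [Nonempty R] {k : ℕ} {q : Quant} {p : Prop} :
    Alternates (R := R) m q k (fun _ => p) ↔ p := by
  have h : ∃ y : List R, y.length = m := ⟨List.replicate m (Classical.arbitrary R), by simp⟩
  induction k generalizing q with
  | zero => rfl
  | succ k ih =>
    obtain ⟨y, hy⟩ := h
    cases q with
    | ex =>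
      simp only [Alternates, ih]
      exact ⟨fun ⟨_, _, h⟩ => h, fun h => ⟨y, hy, h⟩⟩
    | all =>
      simp only [Alternates, ih]
      exact ⟨fun h => h y hy, fun h _ _ => h⟩

/-- A last quantifier without effect. -/
theorem Alternates.take_succ [Nonempty R] {k : ℕ} {q : Quant} {φ : List (List R) → Prop} :
    Alternates m q (k + 1) (fun ws => φ (ws.take k)) ↔ Alternates m q k φ := by
  induction k generalizing q φ with
  | zero => exact Alternates.const (k := 1) (p := φ [])
  | succ k ih =>
    cases q with
    | ex => exact exists_congr fun y => and_congr_right fun _ => ih (φ := fun ws => φ (y :: ws))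
    | all => exact forall_congr' fun y => imp_congr_right fun _ => ih (φ := fun ws => φ (y :: ws))

end Alternates

section

variable {L : FirstOrder.Language.{u, v}} {R : Type w} [L.Structure R] [Bipointed L R]

/-! ### Deciding membership in the complement -/

namespace Stmt

variable (R) in
/-- On a nonempty input, decides whether `P` accepts the input without its last symbol. -/
noncomputable def dropLast (d : ℕ) (P : Program L) (f : Bool) : Stmt L Arr Var := .seqs
  [startup, .decr .xl, .upTo d .c .xl (append .inp .c), runN R d P, finish f]

theorem exec_dropLast {d : ℕ} (hd : 0 < d) {P : Program L}
    (hP : P.ConstantFree R) (hQ : P.QueryFree) (f : Bool) {p : Polynomial ℕ}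
    (hp : ∀ x : List R, ∃ t ≤ p.eval x.length, ∃ c, HaltsAt ∅ P x t c)
    (hpd : ∀ n, 2 ≤ n → p.eval n ≤ n ^ d) (x : List R) (r : R) :
    ((dropLast R d P f).exec ((x ++ [r]).length + 2) (initMem L .inp (x ++ [r]))).arr .tmp 0 =
      oneElt L ↔ (Accepts ∅ P x ↔ f = true) := by
  obtain ⟨N, hN⟩ : ∃ N, N = (x ++ [r]).length + 2 := ⟨_, rfl⟩
  have hNx : N = x.length + 3 := by simp [hN]
  have hNd : N ≤ N ^ d := Nat.le_self_pow hd.ne' N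
  obtain ⟨x', hx'⟩ : ∃ x' : ℕ → R, x' = fun i => (x ++ [r]).getD i (zeroElt L) := ⟨_, rfl⟩
  have h₁ := exec_startup (L := L) (x ++ [r])
  rw [← hx', ← hN] at h₁
  have h₂ : (Stmt.decr .xl : Stmt L Arr Var).exec N
      ((St.init L (x ++ [r]).length).toMem L x') = (St.init L x.length).toMem L x' := by
    rw [exec_decr, St.setVar_xl]
    simp [St.init]
  have h₃ := exec_upTo (N := N) (d := d) (i := Var.c) (j := Var.xl) (k := x.length)
    (S := (append .inp .c : Stmt L Arr Var))
    (fun j => St.toMem L x' { (St.init L x.length : St R) with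
      nc := initConfig L ((List.range j).map x') }) (by omega) (by simp)
    (fun _ => by simp [St.init]) (fun _ => by simp [St.init]) (by
      intro j hj
      simp only [St.setVar_c]
      rw [exec_append _ _ rfl]
      simp [List.range_succ])
  have e₁ : (List.range x.length).map x' = x := by
    refine List.ext_getElem (by simp) fun i hi hi' => ?_
    rw [List.getElem_map, List.getElem_range, hx']
    simp only
    rw [List.getD_append _ _ _ _ hi', List.getD_eq_getElem _ _ hi']
  have e₂ : ({ (St.init L x.length : St R) with
      nc := initConfig L ((List.range 0).map x') } : St R) = St.init L x.length := rfl
  rw [e₁] at h₃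
  simp only [e₂] at h₃
  obtain ⟨t, ht, c, hc⟩ := hp x
  have ht' : t ≤ N ^ d := ht.trans ((eval_mono p (by omega)).trans (hpd N (by omega)))
  rw [← hN]
  simp only [dropLast, exec_seqs_cons, exec_seqs_nil, h₁, h₂, h₃, exec_runN _ _ hP hQ]
  rw [exec_finish, hc.accepts_iff, hc.stay_iterate ht']

end Stmt

theorem exists_pos_eval_le_pow (p : Polynomial ℕ) :
    ∃ d, 0 < d ∧ ∀ n, 2 ≤ n → p.eval n ≤ n ^ d := by
  obtain ⟨d, hd⟩ := exists_eval_le_pow p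
  exact ⟨d + 1, d.succ_pos, fun n hn =>
    (hd n hn).trans (Nat.pow_le_pow_right (by omega) d.le_succ)⟩

/-- The case `k = 0` is separate because a tuple without witnesses is presented without tags; there
only the last symbol has to be removed. The flag `f = false` exchanges acceptance and rejection. -/
theorem exists_truncating {P : Program L} (hP : P.ConstantFree R) (hQ : P.QueryFree)
    (hp : PolyTime (R := R) ∅ P) (f : Bool) (k : ℕ) :
    ∃ P' : Program L, P'.QueryFree ∧ P'.ConstantFree R ∧ PolyTime (R := R) ∅ P' ∧
      ∀ (v w : List R) (r : R) (ws : List (List R)), ws.length = k →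
        (∀ y ∈ ws, y.length = (tupleString L v [w] ++ [r]).length) →
        (Accepts ∅ P' (tupleString L (tupleString L v [w] ++ [r]) ws) ↔
          (Accepts ∅ P (tupleString L v (w :: ws.map (List.take w.length))) ↔ f = true)) := by
  obtain ⟨p, hp⟩ := hp
  obtain ⟨d, hd, hpd⟩ := exists_pos_eval_le_pow p
  rcases Nat.eq_zero_or_pos k with rfl | hk
  · obtain ⟨P', h₁, h₂, h₃, h₄⟩ := exists_program (R := R) Arr.inp .tmp (Stmt.dropLast R d P f)
    refine ⟨P', h₁, h₂, h₃, fun v w r ws hk _ => ?_⟩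
    obtain rfl := List.length_eq_zero_iff.1 hk
    rw [h₄]
    exact Stmt.exec_dropLast hd hP hQ f hp hpd _ r
  · obtain ⟨P', h₁, h₂, h₃, h₄⟩ :=
      exists_program (R := R) Arr.inp .tmp (Stmt.truncating R d k P f)
    refine ⟨P', h₁, h₂, h₃, fun v w r ws hk' hws => ?_⟩
    rw [h₄]
    exact Stmt.exec_truncating hk hd hP hQ f hp hpd v w r ws hk' hws

/-! ### A machine that asks a single query -/

variable (L R) in
/-- Asks whether the oracle contains the input followed by `0`, and accepts if the answer is
`f`. -/
def askProgram (f : Bool) : Program L :=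
  [.query (if f then 1 else 3) (if f then 3 else 1), .const 0 (Bipointed.oneSym R), .goto 4,
    .const 0 (Bipointed.zeroSym R), .branchIdx 0 1 7 5, .decr 0, .goto 4, .incr 0]

theorem askProgram_constantFree (f : Bool) : (askProgram L R f).ConstantFree R := by
  intro j c h
  simp only [askProgram, Instr.goto, List.mem_cons, List.not_mem_nil, reduceCtorEq, false_or,
    or_false, Instr.const.injEq] at h
  rcases h with h | h
  · exact .inr h.2
  · exact .inl h.2

/-- A query includes the register `Z[I[0]]`, which contains `0` initially. This is the extra symbol
that the oracle machine has to drop. -/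
theorem queryString_initConfig (x : List R) :
    (initConfig L x).queryString = x ++ [zeroElt L] := by
  refine List.ext_getElem (by simp [Config.queryString, initConfig]) fun i hi hi' => ?_
  rw [show (initConfig L x).queryString[i] = x.getD i (zeroElt L) by
    simp only [Config.queryString, List.getElem_ofFn]
    rfl]
  rcases Nat.lt_or_ge i x.length with h | h
  · rw [List.getD_eq_getElem _ _ h, List.getElem_append_left h]
  · have : i = x.length := by
      simp at hi'
      omega
    subst this
    simp

theorem askProgram_haltsAt (Q : Set (List R)) (f : Bool) (x : List R) :
    ∃ t ≤ 3 * x.length + 5, ∃ c, HaltsAt Q (askProgram L R f) x t c ∧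
      (c.output = [oneElt L] ↔ (x ++ [zeroElt L] ∈ Q ↔ f = true)) := by
  classical
  obtain ⟨P, hP⟩ : ∃ P, P = askProgram L R f := ⟨_, rfl⟩
  obtain ⟨n, hn⟩ : ∃ n, x.length = n := ⟨_, rfl⟩
  rw [← hP]
  have hc : CodeAt P 0 P := fun i hi => by simp [hi]
  obtain ⟨idx, hidx⟩ : ∃ idx, idx = (initConfig L x).idx := ⟨_, rfl⟩
  obtain ⟨reg, hreg⟩ : ∃ reg, reg = (initConfig L x).reg := ⟨_, rfl⟩
  have h0 : idx 0 = n := by simp [hidx, initConfig, hn]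
  have h1 : idx 1 = 0 := by simp [hidx, initConfig]
  have hi : initConfig L x = ⟨0, idx, reg⟩ := by rw [hidx, hreg]; rfl
  obtain ⟨b, hb⟩ : ∃ b : Bool, b = true ↔ (x ++ [zeroElt L] ∈ Q ↔ f = true) :=
    ⟨decide _, decide_eq_true_iff⟩
  have s₁ : ReachLE Q P 1 ⟨0, idx, reg⟩ ⟨if b then 1 else 3, idx, reg⟩ := by
    refine .of_instr (a := .query (if f then 1 else 3) (if f then 3 else 1))
      (by simp [hP, askProgram]) ?_
    simp only [Instr.exec, ← hi, queryString_initConfig]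
    congr 1
    cases f <;> cases b <;> simp at hb ⊢ <;> simp [hb]
  have s₂ : ReachLE Q P 2 ⟨if b then 1 else 3, idx, reg⟩
      ⟨4, idx, Function.update reg 0 (boolElt L b)⟩ := by
    cases b with
    | false =>
      refine ReachLE.mono (.of_instr (a := .const 0 (Bipointed.zeroSym R))
        (by simp [hP, askProgram]) ?_) one_le_two
      simp [Instr.exec, boolElt, zeroElt]
    | true =>
      refine ReachLE.trans (s := 1) (t := 1)
        (d := ⟨2, idx, Function.update reg 0 (oneElt L)⟩) (.of_instr (a := .const 0 (Bipointed.oneSym R))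
        (by simp [hP, askProgram]) rfl) (.of_instr (a := .goto 4) (by simp [hP, askProgram]) ?_)
      simp [Instr.exec, Instr.goto, boolElt]
  have s₃ : ReachLE Q P (3 * n + 1) ⟨4, idx, Function.update reg 0 (boolElt L b)⟩
      ⟨7, Function.update idx 0 0, Function.update reg 0 (boolElt L b)⟩ := by
    refine .countdown zero_ne_one ?_ n idx h0 h1
    intro i hi
    simp only [List.length_cons, List.length_nil] at hi
    interval_cases i <;> simp [hP, askProgram]
  have s₄ : ReachLE Q P 1 ⟨7, Function.update idx 0 0, Function.update reg 0 (boolElt L b)⟩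
      ⟨8, Function.update idx 0 1, Function.update reg 0 (boolElt L b)⟩ :=
    .of_instr (a := .incr 0) (by simp [hP, askProgram]) (by simp [Instr.exec])
  obtain ⟨t, ht, h⟩ := (hi ▸ ((s₁.trans s₂).trans s₃).trans s₄).haltsAt (by simp [hP, askProgram])
  refine ⟨t, by omega, _, h, ?_⟩
  rw [Config.output_eq_singleton, ← hb]
  cases b <;> simp [boolElt, zeroElt_ne_oneElt (L := L)]

theorem askProgram_polyTime (Q : Set (List R)) (f : Bool) : PolyTime Q (askProgram L R f) := by
  refine ⟨Polynomial.C 3 * Polynomial.X + Polynomial.C 5, fun x => ?_⟩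
  obtain ⟨t, ht, c, hc, -⟩ := askProgram_haltsAt (L := L) Q f x
  exact ⟨t, by simpa using ht, c, hc⟩

theorem askProgram_accepts (Q : Set (List R)) (f : Bool) (x : List R) :
    Accepts Q (askProgram L R f) x ↔ (x ++ [zeroElt L] ∈ Q ↔ f = true) := by
  obtain ⟨t, ht, c, hc, h⟩ := askProgram_haltsAt (L := L) Q f x
  rw [hc.accepts_iff, h]

/-- The oracle contains the strings for `(v, w)`, followed by a symbol, for which the remaining `k`
blocks, started with `∃`, hold for the possibly negated matrix. The machine quantified over `w` only
asks one query. -/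
theorem constantFreeLevel_succ_subset (q₀ : Quant) (k : ℕ) :
    constantFreeLevel L R q₀ (k + 1) ⊆ constantFreeOracleLevel L R q₀ 1 (SigmaZero L R k) := by
  rintro A ⟨P, hQ, hP, hp, q, hA⟩
  have : Nonempty R := ⟨zeroElt L⟩
  obtain ⟨f, hf⟩ : ∃ f : Bool, f = true ↔ q₀ = .all := by
    cases q₀
    exacts [⟨false, by simp⟩, ⟨true, by simp⟩]
  obtain ⟨P', hQ', hP', hp', h⟩ := exists_truncating hP hQ hp f k
  -- Witnesses as long as the query itself: a polynomial bound in `|u|` that is at least `|w|`.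
  refine ⟨{u | Alternates u.length .ex k fun ws => Accepts ∅ P' (tupleString L u ws)},
    ⟨P', hQ', hP', hp', Polynomial.X, fun u => by simp⟩, askProgram L R f,
    askProgram_constantFree f, askProgram_polyTime _ f, q, fun x => ?_⟩
  rw [hA]
  obtain ⟨m, hm⟩ : ∃ m, q.eval x.length = m := ⟨_, rfl⟩
  rw [hm]
  have key : ∀ y : List R, y.length = m →
      ((Alternates (tupleString L x [y] ++ [zeroElt L]).length .ex k fun ws =>
          Accepts ∅ P' (tupleString L (tupleString L x [y] ++ [zeroElt L]) ws)) ↔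
        Alternates m .ex k fun ws => (Accepts ∅ P (tupleString L x (y :: ws)) ↔ f = true)) := by
    intro y hy
    rw [Alternates.congr fun ws hk hws => h x y (zeroElt L) ws hk hws, hy]
    refine Alternates.take
      (φ := fun ws => (Accepts ∅ P (tupleString L x (y :: ws)) ↔ f = true)) ?_
    rw [List.length_append, length_tupleString x (m := m) (by simpa using hy) (by simp)]
    simp
    omega
  cases q₀ with
  | ex =>
    have hf : f = false := by simpa using hf
    refine exists_congr fun y => and_congr_right fun hy => ?_
    simp only [Alternates]
    rw [askProgram_accepts, Set.mem_ofPred_eq, key y hy]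
    simp only [hf, Bool.false_eq_true, iff_false]
    -- The oracle decides the complement `∃ … ¬φ`, and the machine accepts when the answer is no;
    -- negating twice yields the block `∀ … φ`.
    rw [Alternates.not]
    simp [Quant.dual]
  | all =>
    have hf : f = true := by simpa using hf
    refine forall_congr' fun y => imp_congr_right fun hy => ?_
    simp only [Alternates]
    rw [askProgram_accepts, Set.mem_ofPred_eq, key y hy]
    simp [hf]

end


/-! ### Guessed oracle answers and the quantifier structure of their verification. -/

section

variable {L : FirstOrder.Language.{u, v}} {R : Type w} [L.Structure R]

open Classical in
/-- The computation of a machine whose query at time `t` is answered according to `b t`. -/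
noncomputable def path (P : Program L) (b : ℕ → Prop) (c : Config R) : ℕ → Config R
  | 0 => c
  | t + 1 => stay (if b t then Set.univ else ∅) P (path P b c t)

/-- The next instruction is a query. -/
def IsQuery (P : Program L) (c : Config R) : Prop :=
  ∃ ℓ₁ ℓ₂, P[c.label]? = some (.query ℓ₁ ℓ₂)

/-- A step consults the oracle only at a query, and only about the current query string. -/
theorem stay_congr {P : Program L} {c : Config R} {Q Q' : Set (List R)}
    (h : IsQuery P c → (c.queryString ∈ Q ↔ c.queryString ∈ Q')) : stay Q P c = stay Q' P c := by
  simp only [stay, step]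
  cases e : P[c.label]? with
  | none => rfl
  | some i =>
    cases i with
    | query ℓ₁ ℓ₂ =>
      have h' := h ⟨ℓ₁, ℓ₂, e⟩
      by_cases hq : c.queryString ∈ Q
      · simp [Instr.exec, hq, h'.1 hq]
      · simp [Instr.exec, hq, mt h'.2 hq]
    | _ => rfl

/-- If the answers are correct, then the computation is that of the oracle machine. -/
theorem path_eq_iterate {P : Program L} {Q : Set (List R)} {b : ℕ → Prop} {c : Config R} {T : ℕ}
    (h : ∀ t < T, IsQuery P ((stay Q P)^[t] c) →
      (b t ↔ ((stay Q P)^[t] c).queryString ∈ Q)) {t : ℕ} (ht : t ≤ T) :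
    path P b c t = (stay Q P)^[t] c := by
  induction t with
  | zero => rfl
  | succ t ih =>
    rw [path, ih (by omega), Function.iterate_succ_apply']
    refine stay_congr fun hq => ?_
    rw [← h t (by omega) hq]
    split_ifs with hb <;> simp [hb]

/-- Here correctness is assumed along the guessed computation instead of the true one. Induction on
time shows that the two cannot diverge; this is the form in which a verifier knows it. -/
theorem path_eq_iterate' {P : Program L} {Q : Set (List R)} {b : ℕ → Prop} {c : Config R} {T : ℕ}
    (h : ∀ t < T, IsQuery P (path P b c t) → (b t ↔ (path P b c t).queryString ∈ Q)) {t : ℕ}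
    (ht : t ≤ T) : path P b c t = (stay Q P)^[t] c := by
  induction t with
  | zero => rfl
  | succ t ih =>
    rw [Function.iterate_succ_apply', ← ih (by omega), path]
    refine stay_congr fun hq => ?_
    rw [← h t (by omega) hq]
    split_ifs with hb <;> simp [hb]

variable [Bipointed L R]

variable (L) in
/-- The part of a string of the given length that starts at the given position. -/
def slice (a l : ℕ) (y : List R) : List R := (List.range l).map fun j => y.getD (a + j) (zeroElt L)

theorem length_slice (a l : ℕ) (y : List R) : (slice L a l y).length = l := by simp [slice]

theorem slice_map_range {a l m : ℕ} (h : a + l ≤ m) (F : ℕ → R) :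
    slice L a l ((List.range m).map F) = (List.range l).map fun j => F (a + j) := by
  refine List.map_congr_left fun j hj => ?_
  have hj := List.mem_range.1 hj
  rw [List.getD_eq_getElem _ _ (by simp; omega)]
  simp

theorem map_range_getD (y : List R) :
    (List.range y.length).map (fun j => y.getD j (zeroElt L)) = y :=
  List.ext_getElem (by simp) fun i hi hi' => by
    rw [List.getElem_map, List.getElem_range, List.getD_eq_getElem _ _ hi']

/-- A string with prescribed parts, for parts in disjoint places. -/
theorem exists_slices {m q ρ T : ℕ} (hm : q + T * (1 + ρ) ≤ m) (w : List R) (hw : w.length = q)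
    (b : ℕ → R) (z : ℕ → List R) (hz : ∀ t < T, (z t).length ≤ ρ) :
    ∃ y : List R, y.length = m ∧ slice L 0 q y = w ∧
      ∀ t < T, y.getD (q + t * (1 + ρ)) (zeroElt L) = b t ∧
        slice L (q + t * (1 + ρ) + 1) (z t).length y = z t := by
  -- After `w`, the string is divided into blocks of length `1 + ρ`: an answer symbol, followed by
  -- room for a witness.
  let F (i : ℕ) : R := if i < q then w.getD i (zeroElt L) else
    if (i - q) % (1 + ρ) = 0 then b ((i - q) / (1 + ρ)) else
      (z ((i - q) / (1 + ρ))).getD ((i - q) % (1 + ρ) - 1) (zeroElt L)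
  have hT : ∀ t < T, q + t * (1 + ρ) + (1 + ρ) ≤ m := by
    intro t ht
    have := Nat.mul_le_mul_right (1 + ρ) (Nat.succ_le_of_lt ht)
    rw [Nat.succ_mul] at this
    omega
  refine ⟨(List.range m).map F, by simp, ?_, fun t ht => ⟨?_, ?_⟩⟩
  · rw [slice_map_range (by omega)]
    conv_rhs => rw [← map_range_getD (L := L) w]
    rw [hw]
    refine List.map_congr_left fun j hj => ?_
    have hj := List.mem_range.1 hj
    simp [F, hj]
  · rw [List.getD_eq_getElem _ _ (by have := hT t ht; simp; omega)]
    simp [F]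
  · have := hT t ht
    have := hz t ht
    rw [slice_map_range (by omega)]
    conv_rhs => rw [← map_range_getD (L := L) (z t)]
    refine List.map_congr_left fun j hj => ?_
    have hj := List.mem_range.1 hj
    have e : q + t * (1 + ρ) + 1 + j - q = (1 + j) + t * (1 + ρ) := by omega
    have e₁ : ((1 + j) + t * (1 + ρ)) % (1 + ρ) = 1 + j := by
      rw [Nat.add_mul_mod_self_right, Nat.mod_eq_of_lt (by omega)]
    have e₂ : ((1 + j) + t * (1 + ρ)) / (1 + ρ) = t := by
      rw [Nat.add_mul_div_right _ _ (by omega), Nat.div_eq_of_lt (by omega), zero_add]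
    simp only [F]
    rw [if_neg (by omega), e, e₁, e₂, if_neg (by omega), Nat.add_sub_cancel_left]

variable (L) in
/-- The answers that are guessed in the string `y`. -/
def guess (q ρ : ℕ) (y : List R) (t : ℕ) : Prop :=
  y.getD (q + t * (1 + ρ)) (zeroElt L) = oneElt L

variable (L) in
/-- The configuration at time `t` of a computation with the guessed answers. -/
noncomputable def guessedConfig (P : Program L) (start : List R → Config R) (q ρ : ℕ)
    (y : List R) (t : ℕ) : Config R :=
  path P (guess L q ρ y) (start (slice L 0 q y)) t

open Classical in
/-- The guessed answer at time `t` agrees with that of the machine `P'`, for the witnesses that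
are stored in the strings `y` and `ws`. -/
def Consistent (P P' : Program L) (r : Polynomial ℕ) (k : ℕ) (start : List R → Config R)
    (q ρ : ℕ) (y : List R) (ws : List (List R)) (t : ℕ) : Prop :=
  let c := guessedConfig L P start q ρ y t
  IsQuery P c →
    (Accepts ∅ P' (tupleString L c.queryString
      ((if guess L q ρ y t then (y :: ws).take k else ws).map
        (slice L (q + t * (1 + ρ) + 1) (r.eval c.queryString.length)))) ↔ guess L q ρ y t)

variable {P P' : Program L} {r : Polynomial ℕ} {k : ℕ} {start : List R → Config R}
  {q ρ m T : ℕ} {Q : Set (List R)}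

/-- For fixed `y` the guessed computation is fixed as well, and the check for time `t` reads only
the slices of the later witnesses that belong to `t`. These slices are disjoint and arbitrary, so
`Alternates.forall_map` splits one common alternation into a separate one for every `t`. -/
theorem alternates_consistent (hm : q + T * (1 + ρ) ≤ m) (y : List R)
    (hρ : ∀ t < T, r.eval (guessedConfig L P start q ρ y t).queryString.length ≤ ρ) :
    (Alternates m .all k fun ws => ∀ t < T, Consistent P P' r k start q ρ y ws t) ↔
      ∀ t < T, IsQuery P (guessedConfig L P start q ρ y t) →
        ((guess L q ρ y t → Alternates (r.eval (guessedConfig L P start q ρ y t).queryString.length)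
          .all k fun zs => Accepts ∅ P' (tupleString L (guessedConfig L P start q ρ y t).queryString
            ((slice L (q + t * (1 + ρ) + 1)
              (r.eval (guessedConfig L P start q ρ y t).queryString.length) y :: zs).take k))) ∧
        (¬ guess L q ρ y t → Alternates
          (r.eval (guessedConfig L P start q ρ y t).queryString.length)
          .all k fun zs => ¬ Accepts ∅ P'
            (tupleString L (guessedConfig L P start q ρ y t).queryString zs))) := by
  have : Nonempty R := ⟨zeroElt L⟩
  obtain ⟨c, hc⟩ : ∃ c : ℕ → Config R, c = guessedConfig L P start q ρ y := ⟨_, rfl⟩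
  obtain ⟨l, hl⟩ : ∃ l : ℕ → ℕ, l = fun t => r.eval (c t).queryString.length := ⟨_, rfl⟩
  obtain ⟨f, hf⟩ : ∃ f : ℕ → List R → List R,
    f = fun t => slice L (q + t * (1 + ρ) + 1) (l t) := ⟨_, rfl⟩
  have h := Alternates.forall_map (m := m) (ι := Fin T) (l := fun t => l t) (f := fun t => f t)
    (by simp [hf, length_slice]) (fun z hz => by
      obtain ⟨y, hy, -, h⟩ := exists_slices (L := L) hm (List.replicate q (zeroElt L)) (by simp)
        (fun _ => zeroElt L) (fun t => if h : t < T then z ⟨t, h⟩ else []) (by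
          intro t ht
          simp only [ht, dif_pos, hz]
          simpa [hl, hc] using hρ t ht)
      refine ⟨y, hy, fun t => ?_⟩
      have := (h t t.2).2
      simpa [hz, hf] using this) (k := k) (q := .all)
    (φ := fun t zs => IsQuery P (c t) →
      ((guess L q ρ y t → Accepts ∅ P' (tupleString L (c t).queryString ((f t y :: zs).take k))) ∧
      (¬ guess L q ρ y t → ¬ Accepts ∅ P' (tupleString L (c t).queryString zs))))
  rw [← hc]
  have e : ∀ t, r.eval (c t).queryString.length = l t := by simp [hl]
  simp only [e]
  have e' : ∀ t, slice L (q + t * (1 + ρ) + 1) (l t) = f t := by simp [hf]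
  simp only [e']
  -- The kind of check depends on the guess, hence on `y` alone, so the case distinction can be
  -- moved outside of the quantifiers.
  refine Iff.trans (Alternates.congr fun ws _ _ => ?_) (h.trans ?_)
  · rw [Fin.forall_iff]
    refine forall_congr' fun t => forall_congr' fun ht => ?_
    simp only [Consistent, ← hc, e, e']
    refine imp_congr_right fun _ => ?_
    by_cases hg : guess L q ρ y t
    · simp [hg]
    · simp [hg]
  · rw [Fin.forall_iff]
    refine forall_congr' fun t => forall_congr' fun ht => ?_
    by_cases hq : IsQuery P (c t)
    · by_cases hg : guess L q ρ y t
      · simp [hg, hq]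
      · simp [hg, hq]
    · simp [hq, Alternates.const]

/-- A consistent guess forces the true oracle computation. Conversely, the true answers, with a
first witness for every positive one, form a consistent guess. -/
theorem alternates_simulation (hm : q + T * (1 + ρ) ≤ m)
    (hρ : ∀ w : List R, w.length = q → ∀ b, ∀ t < T,
      r.eval (path P b (start w) t).queryString.length ≤ ρ)
    (hQ : ∀ u, u ∈ Q ↔ Alternates (r.eval u.length) .ex k fun zs =>
      Accepts ∅ P' (tupleString L u zs)) (g : Config R → Prop) :
    (Alternates m .ex (k + 1) fun ws => g (guessedConfig L P start q ρ (ws.headD []) T) ∧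
      ∀ t < T, Consistent P P' r k start q ρ (ws.headD []) ws.tail t) ↔
      ∃ w : List R, w.length = q ∧ g ((stay Q P)^[T] (start w)) := by
  have : Nonempty R := ⟨zeroElt L⟩
  -- A last quantifier without effect turns the `k` blocks for a positive answer into `k + 1`. After
  -- the first witness, both kinds of answers then need `k` blocks starting with `∀`, also for `k =
  -- 0`.
  have hQ' : ∀ u, u ∈ Q ↔ ∃ z : List R, z.length = r.eval u.length ∧
      Alternates (r.eval u.length) .all k fun zs =>
        Accepts ∅ P' (tupleString L u ((z :: zs).take k)) := fun u => by
    rw [hQ, ← Alternates.take_succ]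
    rfl
  have hQn : ∀ u, u ∉ Q ↔ Alternates (r.eval u.length) .all k fun zs =>
      ¬ Accepts ∅ P' (tupleString L u zs) := fun u => by
    rw [hQ, Alternates.not]
    rfl
  have hρ' : ∀ y, ∀ t < T, r.eval (guessedConfig L P start q ρ y t).queryString.length ≤ ρ :=
    fun y => hρ _ (length_slice _ _ _) _
  -- The condition `g` depends only on the first witness and can be pulled out of the later
  -- quantifiers.
  have key : ∀ y : List R, (Alternates m .all k fun ws =>
      g (guessedConfig L P start q ρ y T) ∧ ∀ t < T, Consistent P P' r k start q ρ y ws t) ↔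
      g (guessedConfig L P start q ρ y T) ∧
        Alternates m .all k fun ws => ∀ t < T, Consistent P P' r k start q ρ y ws t := by
    intro y
    by_cases h : g (guessedConfig L P start q ρ y T)
    · simp [h]
    · simp [h, Alternates.const]
  simp only [Alternates, List.headD_cons, List.tail_cons, key]
  constructor
  · rintro ⟨y, hy, hg, h⟩
    rw [alternates_consistent hm y (hρ' y)] at h
    refine ⟨slice L 0 q y, length_slice _ _ _, ?_⟩
    rw [guessedConfig, path_eq_iterate' (fun t ht hq => ?_) le_rfl] at hg
    · exact hg
    · obtain ⟨h₁, h₂⟩ := h t ht hq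
      constructor
      · exact fun hb => (hQ' _).2 ⟨_, length_slice _ _ _, h₁ hb⟩
      · intro hu
        by_contra hb
        exact (hQn _).2 (h₂ hb) hu
  · rintro ⟨w, hw, hg⟩
    obtain ⟨c, hc⟩ : ∃ c : ℕ → Config R, c = fun t => (stay Q P)^[t] (start w) := ⟨_, rfl⟩
    have hz : ∀ t, ∃ z : List R, z.length = r.eval (c t).queryString.length ∧
        ((c t).queryString ∈ Q → Alternates (r.eval (c t).queryString.length) .all k fun zs =>
          Accepts ∅ P' (tupleString L (c t).queryString ((z :: zs).take k))) := by
      intro t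
      by_cases h : (c t).queryString ∈ Q
      · obtain ⟨z, hz, h'⟩ := (hQ' _).1 h
        exact ⟨z, hz, fun _ => h'⟩
      -- A negative answer needs no witness in `y`, but its slot must be filled with a string of the
      -- right length.
      · exact ⟨List.replicate (r.eval (c t).queryString.length) (zeroElt L), by simp, fun h' => absurd h' h⟩
    choose z hzl hz using hz
    classical
    have hcp : ∀ t ≤ T, path P (fun t => (c t).queryString ∈ Q) (start w) t = c t := by
      intro t ht
      rw [hc]
      exact path_eq_iterate (fun t _ _ => Iff.rfl) ht
    obtain ⟨y, hy, hyw, hyt⟩ := exists_slices (L := L) hm w hw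
      (fun t => boolElt L (decide ((c t).queryString ∈ Q))) z (by
        intro t ht
        have := hρ w hw (fun t => (c t).queryString ∈ Q) t ht
        rwa [hcp t ht.le, ← hzl] at this)
    have hb : ∀ t < T, guess L q ρ y t ↔ (c t).queryString ∈ Q := by
      intro t ht
      rw [guess, (hyt t ht).1]
      by_cases h : (c t).queryString ∈ Q <;> simp [h, boolElt, zeroElt_ne_oneElt (L := L)]
    have hyc : ∀ t ≤ T, guessedConfig L P start q ρ y t = c t := by
      intro t ht
      rw [guessedConfig, hyw, hc]
      exact path_eq_iterate (fun t ht _ => by rw [hb t ht, hc]) ht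
    refine ⟨y, hy, ?_, ?_⟩
    · rw [hyc T le_rfl, hc]
      exact hg
    · rw [alternates_consistent hm y (hρ' y)]
      intro t ht _
      rw [hyc t ht.le, hb t ht]
      refine ⟨fun hu => ?_, fun hu => (hQn _).1 hu⟩
      have := (hyt t ht).2
      rw [hzl] at this
      rw [this]
      exact hz t hu

end


/-! ### Checking one guessed answer with the machine for the oracle problem. -/

section

variable {L : FirstOrder.Language.{u, v}} {R : Type w} [L.Structure R] [Bipointed L R]

theorem Config.Bounded.stay {J B : ℕ} {c : Config R} {P : Program L} (h : c.Bounded L J B)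
    (hP : ∀ i ∈ P, i.WritesBelow J) (Q : Set (List R)) :
    (RMachine.stay Q P c).Bounded L J (B + 1) :=
  h.stay_iterate hP Q 1

theorem path_bounded {J B : ℕ} {c : Config R} {P : Program L} (h : c.Bounded L J B)
    (hP : ∀ i ∈ P, i.WritesBelow J) (b : ℕ → Prop) (t : ℕ) :
    (path P b c t).Bounded L J (B + t) := by
  induction t with
  | zero => exact h
  | succ t ih => exact ih.stay hP _

theorem Config.queryString_eq (c : Config R) :
    c.queryString = (List.range (c.idx 0 + 1)).map c.reg :=
  List.ext_getElem (by simp [Config.queryString]) fun i _ _ => by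
    rw [List.getElem_map, List.getElem_range]
    simp only [Config.queryString, List.getElem_ofFn]

namespace Stmt

/-- Resets the second machine after it has halted. -/
def reset (d J l : ℕ) : Stmt L Arr Var := .seqs
  [.times l (.decr .nPc), .seqs ((List.range J).map fun i => .clear d (.nIdx i)),
    .pow d (.seqs [.copy .nTape (.nIdx 0) .kon .zero, .incr (.nIdx 0)]), .clear d (.nIdx 0)]

/-- Compares the guessed answer with the result of the second machine. -/
def compare : Stmt L Arr Var := .testN (.ifEq (.tmp, 0) (.kon, 1) .skip (.incr .bad))
  (.ifEq (.tmp, 0) (.kon, 1) (.incr .bad) .skip)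

/-- Writes the query string to the input of the second machine, in the form of the first entry of
a tuple with `k` other entries. -/
def loadQuery (d k : ℕ) : Stmt L Arr Var := .upTo d .c (.mIdx 0)
  (if k = 0 then append .mTape .c else .seqs [append .kon .zero, append .mTape .c])

variable (R) in
/-- Checks the guessed answer to a query. -/
noncomputable def ask (d k J : ℕ) (r : Polynomial ℕ) (P' : Program L) : Stmt L Arr Var := .seqs
  [.incr (.mIdx 0), loadQuery d k, .addPoly d .cnt (.mIdx 0) .rr r,
    .ifEq (.tmp, 0) (.kon, 1) (blocks d k id) (blocks d k Nat.succ), .clear d .rr,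
    .decr (.mIdx 0), runN R d P', compare, reset d J P'.length]

variable {N : ℕ} (x : ℕ → R) (s : St R)

/-- The space bound tells what has to be cleared: only the index registers below `J` can be nonzero,
and all registers from `N ^ d` on are still zero. The label is known since the machine has halted.
-/
theorem exec_reset {d J l B : ℕ} (hl : s.nc.label = l) (hb : s.nc.Bounded L J B)
    (hB : B < N ^ d) (hJ : J ≤ N ^ d) :
    (reset d J l : Stmt L Arr Var).exec N (s.toMem L x) =
      St.toMem L x { s with nc := initConfig L [] } := by
  obtain ⟨idx, hidx⟩ : ∃ idx, s.nc.idx = idx := ⟨_, rfl⟩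
  obtain ⟨reg, hreg⟩ : ∃ reg, s.nc.reg = reg := ⟨_, rfl⟩
  have h₁ : (Stmt.times l (.decr .nPc) : Stmt L Arr Var).exec N (s.toMem L x) =
      St.toMem L x { s with nc := ⟨0, idx, reg⟩ } := by
    rw [exec_times_decr, St.setVar_nPc]
    simp [hl, hidx, hreg]
  have h₂ : ∀ K, (Stmt.seqs ((List.range K).map fun i => .clear d (.nIdx i)) :
      Stmt L Arr Var).exec N (St.toMem L x { s with nc := ⟨0, idx, reg⟩ }) =
      St.toMem L x { s with nc := ⟨0, fun i => if i < K then 0 else idx i, reg⟩ } := by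
    intro K
    induction K with
    | zero => simp [exec_seqs_nil]
    | succ K ih =>
      rw [List.range_succ, List.map_append, List.map_singleton, exec_seqs_concat, ih, exec_clear]
      · rw [St.setVar_nIdx]
        congr 3
        funext i
        simp only [Function.update_apply]
        split_ifs <;> first | rfl | omega
      · simp only [St.var_nIdx, lt_irrefl, if_false]
        exact hidx ▸ (hb.idx_le K).trans hB.le
  have e : (fun i => if i < J then 0 else idx i) = fun _ => 0 := by
    funext i
    split_ifs with h
    · rfl
    · exact hidx ▸ hb.idx_eq i (by omega)
  have h₃ : ∀ n, ((Stmt.seqs [.copy .nTape (.nIdx 0) .kon .zero, .incr (.nIdx 0)] :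
      Stmt L Arr Var).exec N)^[n] (St.toMem L x { s with nc := ⟨0, fun _ => 0, reg⟩ }) =
      St.toMem L x { s with nc := ⟨0, Function.update (fun _ => 0) 0 n,
        fun i => if i < n then zeroElt L else reg i⟩ } := by
    intro n
    induction n with
    | zero => simp
    | succ n ih =>
      rw [Function.iterate_succ_apply', ih]
      simp only [exec_seqs_cons, exec_seqs_nil, exec_copy, exec_incr, St.var_nIdx,
        St.setCell_nTape, St.setVar_nIdx, St.var_zero, St.arr_kon_zero, Function.update_self,
        Function.update_idem]
      congr 3
      funext i
      simp only [Function.update_apply]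
      split_ifs <;> first | rfl | omega
  have h₄ := h₃ (N ^ d)
  rw [← exec_pow] at h₄
  simp only [reset, exec_seqs_cons, exec_seqs_nil, h₁, h₂, e, h₄]
  rw [exec_clear (by simp), St.setVar_nIdx]
  congr 2
  simp only [Function.update_idem, Function.update_eq_self, initConfig, Config.mk.injEq, true_and]
  refine ⟨by simp, ?_⟩
  funext i
  split_ifs with h
  · simp
  · simpa using hreg ▸ hb.reg_eq i (by omega) (by omega)

open Classical in
theorem exec_compare :
    (compare : Stmt L Arr Var).exec N (s.toMem L x) = St.toMem L x { s with
      bad := s.bad + if s.nc.output = [oneElt L] ↔ s.tmp = oneElt L then 0 else 1 } := by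
  rw [compare]
  by_cases h : s.nc.output = [oneElt L]
  · rw [exec_testN_pos _ _ h]
    by_cases h' : s.tmp = oneElt L
    · rw [exec_ifEq_pos (by simpa using h'), exec_skip, if_pos (by simp [h, h'])]
      rfl
    · rw [exec_ifEq_neg (by simpa using h'), exec_incr, if_neg (by simp [h, h']), St.setVar_bad]
      rfl
  · rw [exec_testN_neg _ _ h]
    by_cases h' : s.tmp = oneElt L
    · rw [exec_ifEq_pos (by simpa using h'), exec_incr, if_neg (by simp [h, h']), St.setVar_bad]
      rfl
    · rw [exec_ifEq_neg (by simpa using h'), exec_skip, if_pos (by simp [h, h'])]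
      rfl

theorem exec_loadQuery {d k : ℕ} (hc : s.c = 0) (hs : s.nc = initConfig L [])
    (hd : s.mc.idx 0 ≤ N ^ d) :
    (loadQuery d k : Stmt L Arr Var).exec N (s.toMem L x) = St.toMem L x { s with
      nc := initConfig L (if k = 0 then (List.range (s.mc.idx 0)).map s.mc.reg else
        tagString L (zeroElt L) ((List.range (s.mc.idx 0)).map s.mc.reg)) } := by
  have h := exec_upTo (N := N) (d := d) (i := Var.c) (j := Var.mIdx 0) (k := s.mc.idx 0)
    (S := (if k = 0 then append .mTape .c else .seqs [append .kon .zero, append .mTape .c] :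
      Stmt L Arr Var))
    (fun j => St.toMem L x { s with
      nc := initConfig L (if k = 0 then (List.range j).map s.mc.reg else
        tagString L (zeroElt L) ((List.range j).map s.mc.reg)) }) hd (by simp)
    (fun _ => by simpa using hc) (fun _ => by simp) (by
      intro j hj
      simp only [St.setVar_c]
      by_cases hk : k = 0
      · simp only [hk, if_true]
        rw [exec_append _ _ rfl]
        simp [List.range_succ]
      · simp only [hk, if_false, exec_seqs_cons, exec_seqs_nil]
        rw [exec_append _ _ rfl, exec_append _ _ rfl, List.range_succ, List.map_append,
          List.map_singleton, tagString_append_singleton]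
        simp)
  have h0 : ({ s with
      nc := initConfig L (if k = 0 then (List.range 0).map s.mc.reg else
        tagString L (zeroElt L) ((List.range 0).map s.mc.reg)) } : St R) = s := by
    rw [List.range_zero, List.map_nil, tagString, ite_self, ← hs]
  simp only [h0] at h
  exact h

-- `I[0]` is raised by one during the check because a query string has `I[0] + 1` symbols. If the
-- guess is "yes", the witnesses come from the pointers `0, …, k - 1`, which include the first
-- string `y`; if it is "no", they come from `1, …, k`. Afterwards only `bad` has changed, so the
-- check can be repeated at every step.
open Classical in
theorem exec_ask {d k J : ℕ} {r p : Polynomial ℕ} {P' : Program L} (hP : P'.ConstantFree R)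
    (hQ : P'.QueryFree) (hJ : ∀ i ∈ P', i.WritesBelow J) (hJ0 : 0 < J)
    (hp : ∀ x : List R, ∃ t ≤ p.eval x.length, ∃ c, HaltsAt ∅ P' x t c)
    (hd : ∀ n ≤ N, n + p.eval n + J < N ^ d)
    (hc : s.c = 0) (hr : s.rr = 0) (hs : s.nc = initConfig L [])
    (hz : 2 * s.mc.queryString.length + 2 * r.eval s.mc.queryString.length * (k + 1) ≤ N) :
    (ask R d k J r P').exec N (s.toMem L x) = St.toMem L x { s with
      bad := s.bad + if Accepts ∅ P' (tupleString L s.mc.queryString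
        ((List.range k).map fun i => (List.range (r.eval s.mc.queryString.length)).map fun j =>
          x (s.p (if s.tmp = oneElt L then i else i + 1) + 2 * j))) ↔ s.tmp = oneElt L
        then 0 else 1 } := by
  have hdN : N ≤ N ^ d := by have := hd N le_rfl; omega
  obtain ⟨u, hu⟩ : ∃ u, u = s.mc.queryString := ⟨_, rfl⟩
  rw [← hu] at hz ⊢
  have hul : u.length = s.mc.idx 0 + 1 := by simp [hu, Config.queryString]
  obtain ⟨ys, hys⟩ : ∃ ys, ys = (List.range k).map fun i =>
    (List.range (r.eval u.length)).map fun j =>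
      x (s.p (if s.tmp = oneElt L then i else i + 1) + 2 * j) := ⟨_, rfl⟩
  rw [← hys]
  obtain ⟨z, hzd⟩ : ∃ z, z = tupleString L u ys := ⟨_, rfl⟩
  obtain ⟨l, hl⟩ : ∃ l, l = r.eval u.length := ⟨_, rfl⟩
  rw [← hl] at hz hys
  have hll : l ≤ N ^ d := by nlinarith
  -- For `k = 0` there are no tags; otherwise tags double the lengths, which `hz` takes into
  -- account.
  have hzl : z.length ≤ N := by
    rw [hzd]
    rcases Nat.eq_zero_or_pos k with rfl | hk
    · simp only [List.range_zero, List.map_nil] at hys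
      rw [hys, tupleString]
      omega
    · rw [length_tupleString u (m := l) (by simp [hys]) (by simp [hys]; omega), hys,
        List.length_map, List.length_range]
      nlinarith
  obtain ⟨t, ht, c, hh⟩ := hp z
  have ht' : t ≤ p.eval z.length := ht
  have hdz := hd _ hzl
  have hcb : c.Bounded L J (z.length + t) := by
    rw [← hh.stay_iterate le_rfl]
    exact (initConfig_bounded hJ0 z).stay_iterate hJ ∅ t
  obtain ⟨mc, hmc⟩ : ∃ mc : Config R, mc =
    ⟨s.mc.label, Function.update s.mc.idx 0 (s.mc.idx 0 + 1), s.mc.reg⟩ := ⟨_, rfl⟩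
  have h₁ : (Stmt.incr (.mIdx 0) : Stmt L Arr Var).exec N (s.toMem L x) =
      St.toMem L x { s with mc := mc } := by
    rw [exec_incr, St.setVar_mIdx, St.var_mIdx, hmc]
  have h₂ := exec_loadQuery (L := L) (N := N) (d := d) (k := k) x { s with mc := mc } hc hs (by
    simp only [hmc, Function.update_self]
    omega)
  have e₁ : (List.range (mc.idx 0)).map mc.reg = u := by
    simp [hu, hmc, Config.queryString_eq]
  simp only [e₁] at h₂
  obtain ⟨a, ha⟩ : ∃ a, a = if k = 0 then u else tagString L (zeroElt L) u := ⟨_, rfl⟩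
  rw [← ha] at h₂
  have h₃ : (Stmt.addPoly d .cnt (.mIdx 0) .rr r : Stmt L Arr Var).exec N
      (St.toMem L x { s with mc := mc, nc := initConfig L a }) =
      St.toMem L x { s with mc := mc, nc := initConfig L a, rr := l } := by
    rw [exec_addPoly (fun _ _ h => by simpa using h) (by simp) (by simp) (by simp) _
      (by simp only [St.var_mIdx, hmc, Function.update_self]; omega) (by simp), St.setVar_rr]
    simp [hr, hmc, hl, hul]
  have e₂ : a ++ ys.flatMap (tagString L (oneElt L)) = z := by
    rw [hzd, ha]
    rcases Nat.eq_zero_or_pos k with rfl | hk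
    · simp only [List.range_zero, List.map_nil] at hys
      simp [hys, tupleString]
    · rw [if_neg hk.ne', tupleString_of_ne_nil]
      simp [hys]
      omega
  have h₄ : (Stmt.ifEq (.tmp, 0) (.kon, 1) (blocks d k id) (blocks d k Nat.succ) :
      Stmt L Arr Var).exec N
      (St.toMem L x { s with mc := mc, nc := initConfig L a, rr := l }) =
      St.toMem L x { s with mc := mc, nc := initConfig L z, rr := l } := by
    rw [← e₂, hys]
    by_cases h : s.tmp = oneElt L
    · rw [exec_ifEq_pos (by simpa using h), exec_blocks (l := a) _ _ (by exact hc) (by exact hll) rfl]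
      simp [h]
    · rw [exec_ifEq_neg (by simpa using h), exec_blocks (l := a) _ _ (by exact hc) (by exact hll) rfl]
      simp [h]
  have h₅ : (Stmt.decr (.mIdx 0) : Stmt L Arr Var).exec N ((Stmt.clear d .rr :
      Stmt L Arr Var).exec N (St.toMem L x { s with mc := mc, nc := initConfig L z, rr := l })) =
      St.toMem L x { s with nc := initConfig L z } := by
    rw [exec_clear (by simpa using hll), St.setVar_rr, exec_decr, St.setVar_mIdx]
    simp [hmc, hr]
  simp only [ask, exec_seqs_cons, exec_seqs_nil, h₁, h₂, h₃, h₄, h₅, exec_runN _ _ hP hQ]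
  rw [hh.stay_iterate (by omega), exec_compare, exec_reset (B := z.length + t) _ _ (by exact hh.2)
    (by exact hcb) (by omega) (by omega), ← hzd]
  simp only [hh.accepts_iff]
  rw [← hs]

end Stmt

end


/-! ### One step of the oracle machine with a guessed answer. -/

section

variable {L : FirstOrder.Language.{u, v}} {R : Type w} [L.Structure R] [Bipointed L R]

namespace Stmt

variable (R) in
/-- Simulates a query with a guessed answer. -/
noncomputable def onQuery (d k J : ℕ) (r : Polynomial ℕ) (P' : Program L)
    (S T : Stmt L Arr Var) : Stmt L Arr Var :=
  .seqs [ask R d k J r P', .ifEq (.tmp, 0) (.kon, 1) S T]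

variable (R) in
/-- Simulates one step with a guessed answer. -/
noncomputable def guessStep (d k J : ℕ) (r : Polynomial ℕ) (P P' : Program L) :
    Stmt L Arr Var := .seqs
  [.copy .tmp .zero .inp (.p 0), shift (k + 1) fun _ => 2,
    mSlot.step R .t (onQuery R d k J r P') P, .upTo d .c .o (shift (k + 1) fun _ => 2)]

variable {N : ℕ} (x : ℕ → R) (s : St R)

-- All `k + 1` pointers move in lockstep: by `2` past the answer symbol, so that they point at the
-- witnesses for the current time, and by `2 * s.o` at the end, to the next block. They move whether
-- or not the instruction is a query, so the block belongs to the time and not to the number of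
-- queries.
open Classical in
theorem exec_guessStep {d k J : ℕ} {r p : Polynomial ℕ} {P P' : Program L}
    (hP : P.ConstantFree R) (hP' : P'.ConstantFree R)
    (hQ' : P'.QueryFree) (hJ : ∀ i ∈ P', i.WritesBelow J) (hJ0 : 0 < J)
    (hp : ∀ x : List R, ∃ t ≤ p.eval x.length, ∃ c, HaltsAt ∅ P' x t c)
    (hd : ∀ n ≤ N, n + p.eval n + J < N ^ d)
    (hc : s.c = 0) (hr : s.rr = 0) (hs : s.nc = initConfig L [])
    (hz : 2 * s.mc.queryString.length + 2 * r.eval s.mc.queryString.length * (k + 1) ≤ N)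
    (ho : s.o ≤ N) :
    (guessStep R d k J r P P').exec N (s.toMem L x) = St.toMem L x { s with
      tmp := x (s.p 0)
      p := fun i => if i < k + 1 then s.p i + 2 * (1 + s.o) else s.p i
      mc := stay (if x (s.p 0) = oneElt L then Set.univ else ∅) P s.mc
      bad := s.bad + if IsQuery P s.mc → (Accepts ∅ P' (tupleString L s.mc.queryString
        ((List.range k).map fun i => (List.range (r.eval s.mc.queryString.length)).map fun j =>
          x (s.p (if x (s.p 0) = oneElt L then i else i + 1) + 2 + 2 * j))) ↔
            x (s.p 0) = oneElt L) then 0 else 1 } := by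
  have hdN : N ≤ N ^ d := by have := hd N le_rfl; omega
  obtain ⟨b, hb⟩ : ∃ b, b = x (s.p 0) := ⟨_, rfl⟩
  rw [← hb]
  obtain ⟨p₁, hp₁⟩ : ∃ p₁, p₁ = fun i => if i < k + 1 then s.p i + 2 else s.p i := ⟨_, rfl⟩
  obtain ⟨s₁, hs₁⟩ : ∃ s₁, s₁ = { s with tmp := b, p := p₁ } := ⟨_, rfl⟩
  obtain ⟨C, hC⟩ : ∃ C : Prop, C = (Accepts ∅ P' (tupleString L s.mc.queryString
    ((List.range k).map fun i => (List.range (r.eval s.mc.queryString.length)).map fun j =>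
      x (s.p (if b = oneElt L then i else i + 1) + 2 + 2 * j))) ↔ b = oneElt L) := ⟨_, rfl⟩
  simp only [← hC]
  have h₁ : (shift (k + 1) fun _ => 2 : Stmt L Arr Var).exec N
      ((Stmt.copy .tmp .zero .inp (.p 0) : Stmt L Arr Var).exec N (s.toMem L x)) =
      s₁.toMem L x := by
    rw [exec_copy, St.var_zero, St.setCell_tmp, exec_shift, hs₁, hp₁, hb]
    rfl
  have h₂ : (mSlot.step R .t (onQuery R d k J r P') P).exec N (s₁.toMem L x) =
      St.toMem L x { s₁ with
        mc := stay (if b = oneElt L then Set.univ else ∅) P s.mc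
        bad := s.bad + if IsQuery P s.mc → C then 0 else 1 } := by
    have hmc : s₁.mc = s.mc := by rw [hs₁]
    have hbad : s₁.bad = s.bad := by rw [hs₁]
    have e₁ : mSlot.pc = Var.mPc := rfl
    rw [Slot.exec_step (by simp [mSlot]) _ _ (by simp), e₁, St.var_mPc, hmc, stay, step]
    cases e : P[s.mc.label]? with
    | none =>
      have hn : ¬ IsQuery P s.mc := by simp [IsQuery, e]
      rw [if_pos fun h => absurd h hn, add_zero, ← hmc, ← hbad]
      rfl
    | some i =>
      have hi := List.mem_of_getElem? e
      by_cases hq : IsQuery P s.mc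
      · obtain ⟨ℓ₁, ℓ₂, h⟩ := hq
        obtain rfl : i = .query ℓ₁ ℓ₂ := by simpa [e] using h
        have hq : IsQuery P s.mc := ⟨ℓ₁, ℓ₂, e⟩
        simp only [Slot.instr, onQuery, exec_seqs_cons, exec_seqs_nil]
        rw [exec_ask (p := p) x s₁ hP' hQ' hJ hJ0 hp hd (by rw [hs₁]; exact hc)
          (by rw [hs₁]; exact hr) (by rw [hs₁]; exact hs) (by rw [hmc]; exact hz)]
        have e₂ : s₁.tmp = b := by rw [hs₁]
        have e₃ : (Accepts ∅ P' (tupleString L s₁.mc.queryString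
            ((List.range k).map fun i => (List.range (r.eval s₁.mc.queryString.length)).map
              fun j => x (s₁.p (if s₁.tmp = oneElt L then i else i + 1) + 2 * j))) ↔
                s₁.tmp = oneElt L) ↔ C := by
          rw [hC, hmc, e₂]
          have : ((List.range k).map fun i => (List.range (r.eval s.mc.queryString.length)).map
              fun j => x (s₁.p (if b = oneElt L then i else i + 1) + 2 * j)) =
              (List.range k).map fun i => (List.range (r.eval s.mc.queryString.length)).map
              fun j => x (s.p (if b = oneElt L then i else i + 1) + 2 + 2 * j) := by
            refine List.map_congr_left fun i hi => List.map_congr_left fun j _ => ?_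
            have hi := List.mem_range.1 hi
            rw [hs₁, hp₁]
            simp only
            rw [if_pos (by split_ifs <;> omega)]
          rw [this]
        simp only [e₃]
        have h' := mSlot_isView (L := L) x { s₁ with bad := s₁.bad + if C then 0 else 1 }
        -- The check has altered only `bad`, so the simulated machine still stands at the query and
        -- can jump according to the guess.
        have h₃ : ∀ ℓ, (Stmt.seq (.times s.mc.label (.decr mSlot.pc))
            (.times ℓ (.incr mSlot.pc)) : Stmt L Arr Var).exec N
              (St.toMem L x { s₁ with bad := s₁.bad + if C then 0 else 1 }) =
            St.toMem L x { s₁ with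
              mc := ⟨ℓ, s.mc.idx, s.mc.reg⟩
              bad := s₁.bad + if C then 0 else 1 } := by
          intro ℓ
          have := h'.exec_jump (L := L) (N := N) s.mc ℓ
          rw [← this, ← hmc]
        have e₄ : (IsQuery P s.mc → C) ↔ C := by simp [hq]
        simp only [e₄, Option.map_some, Option.getD_some, Instr.exec]
        by_cases hb1 : b = oneElt L
        · rw [exec_ifEq_pos (by simpa [e₂] using hb1)]
          refine (h₃ ℓ₁).trans ?_
          simp [hb1, hbad]
        · rw [exec_ifEq_neg (by simpa [e₂] using hb1)]
          refine (h₃ ℓ₂).trans ?_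
          simp [hb1, hbad]
      · have := (mSlot_isView (L := L) x s₁).exec_instr (N := N) (onQuery R d k J r P')
          (if b = oneElt L then Set.univ else ∅) s.mc i
          (fun j a h => hP j a (h ▸ hi)) (fun ℓ₁ ℓ₂ h => hq ⟨ℓ₁, ℓ₂, h ▸ e⟩)
        have e₅ : ({ s₁ with mc := s.mc } : St R) = s₁ := by rw [← hmc]
        rw [e₅] at this
        simp only [this]
        rw [if_pos fun h => absurd h hq, add_zero, ← hbad]
        rfl
  obtain ⟨s₂, hs₂⟩ : ∃ s₂, s₂ = { s₁ with
    mc := stay (if b = oneElt L then Set.univ else ∅) P s.mc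
    bad := s.bad + if IsQuery P s.mc → C then 0 else 1 } := ⟨_, rfl⟩
  rw [← hs₂] at h₂
  have h₃ := exec_upTo (N := N) (d := d) (i := Var.c) (j := Var.o) (k := s.o)
    (S := (shift (k + 1) fun _ => 2 : Stmt L Arr Var))
    (fun j => St.toMem L x { s₂ with
      p := fun i => if i < k + 1 then s.p i + 2 * (1 + j) else s.p i }) (by omega) (by simp)
    (fun _ => by simpa [hs₂, hs₁] using hc) (fun _ => by simp [hs₂, hs₁]) (by
      intro j hj
      simp only [St.setVar_c, exec_shift]
      congr 2
      funext i
      split_ifs <;> ring)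
  have e : ({ s₂ with p := fun i => if i < k + 1 then s.p i + 2 * (1 + 0) else s.p i } : St R) =
      s₂ := by
    rw [hs₂, hs₁, hp₁]
  simp only [e] at h₃
  simp only [guessStep, exec_seqs_cons, exec_seqs_nil, h₁, h₂, h₃]
  rw [hs₂, hs₁]

end Stmt

end


/-! ### The complete simulation with guessed answers. -/

section

variable {L : FirstOrder.Language.{u, v}} {R : Type w} [L.Structure R] [Bipointed L R]

namespace Stmt

/-- Decides whether the first machine has accepted; if a guess was wrong, then the result is `f`. -/
def verdict (f : Bool) : Stmt L Arr Var :=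
  .ifIdx .bad .zero (.ifIdx (.mIdx 0) .one (.ifEq (.mTape, 0) (.kon, 1)
    (.const (.tmp, 0) true) (.const (.tmp, 0) false)) (.const (.tmp, 0) false))
    (.const (.tmp, 0) f)

variable (R) in
/-- Simulates an oracle machine with guessed answers. -/
noncomputable def simulate (d k J : ℕ) (q τ σ r : Polynomial ℕ) (P P' : Program L) (f : Bool) :
    Stmt L Arr Var := .seqs
  [parse (k + 1), .addPoly d .cnt .nn (.mIdx 0) (2 * Polynomial.X + 2 * q),
    .upTo d .c (.mIdx 0) (.copy .mTape .c .inp .c),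
    .seqs ((List.range (k + 1)).map fun i => .addPoly d .cnt .nn (.p i) (2 * q)),
    .clear d .h, .decr .g, .addPoly d .cnt .nn .g τ, .addPoly d .cnt .nn .o σ,
    .upTo d .h .g (guessStep R d k J r P P'), verdict f]

variable {N : ℕ} (x : ℕ → R) (s : St R)

theorem exec_verdict (f : Bool) :
    ((verdict f : Stmt L Arr Var).exec N (s.toMem L x)).arr .tmp 0 = oneElt L ↔
      (s.bad = 0 ∧ s.mc.output = [oneElt L]) ∨ (s.bad ≠ 0 ∧ f = true) := by
  rw [verdict, Config.output_eq_singleton]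
  by_cases h : s.bad = 0
  · rw [exec_ifIdx_pos (by simpa using h)]
    by_cases h₁ : s.mc.idx 0 = 1
    · rw [exec_ifIdx_pos (by simpa using h₁)]
      by_cases h₂ : s.mc.reg 0 = oneElt L
      · rw [exec_ifEq_pos (by simpa using h₂)]
        simp [exec, boolElt, h, h₁, h₂]
      · rw [exec_ifEq_neg (by simpa using h₂)]
        simp [exec, boolElt, h, h₂, zeroElt_ne_oneElt (L := L)]
    · rw [exec_ifIdx_neg (by simpa using h₁)]
      simp [exec, boolElt, h, h₁, zeroElt_ne_oneElt (L := L)]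
  · rw [exec_ifIdx_neg (by simpa using h)]
    cases f <;> simp [exec, boolElt, h, zeroElt_ne_oneElt (L := L)]

theorem exec_copyInput {d l : ℕ} (hc : s.c = 0) (hd : l ≤ N ^ d) (hs : s.mc = initConfig L []) :
    (Stmt.upTo d .c (.mIdx 0) (.copy .mTape .c .inp .c) : Stmt L Arr Var).exec N
      (St.toMem L x { s with mc := ⟨0, Function.update s.mc.idx 0 l, s.mc.reg⟩ }) =
      St.toMem L x { s with mc := initConfig L ((List.range l).map x) } := by
  have h := exec_upTo (N := N) (d := d) (i := Var.c) (j := Var.mIdx 0) (k := l)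
    (S := (.copy .mTape .c .inp .c : Stmt L Arr Var))
    (fun j => St.toMem L x { s with
      mc := ⟨0, Function.update s.mc.idx 0 l, fun i => if i < j then x i else zeroElt L⟩ }) hd
    (by simp) (fun _ => by simpa using hc) (fun _ => by simp) (by
      intro j hj
      simp only [St.setVar_c, exec_copy, St.var_c, St.arr_inp, St.setCell_mTape]
      congr 3
      funext i
      simp only [Function.update_apply]
      split_ifs <;> first | rfl | omega | (subst_vars; rfl))
  have e₁ : (fun i => if i < 0 then x i else zeroElt L) = s.mc.reg := by
    rw [hs]
    funext i
    simp [initConfig]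
  have e₂ : (⟨0, Function.update s.mc.idx 0 l, fun i => if i < l then x i else zeroElt L⟩ :
      Config R) = initConfig L ((List.range l).map x) := by
    rw [hs]
    simp only [initConfig, Config.mk.injEq, true_and]
    constructor
    · funext i
      by_cases h : i = 0 <;> simp [h]
    · funext i
      by_cases h : i < l <;> simp [h]
  simp only [e₁, e₂] at h
  exact h

theorem exec_addPoly_p {d K : ℕ} (q : Polynomial ℕ) (hn : s.nn ≤ N ^ d) :
    (Stmt.seqs ((List.range K).map fun i => .addPoly d .cnt .nn (.p i) q) :
      Stmt L Arr Var).exec N (s.toMem L x) =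
      St.toMem L x { s with p := fun i => if i < K then s.p i + q.eval s.nn else s.p i } := by
  induction K with
  | zero => simp [exec_seqs_nil]
  | succ K ih =>
    rw [List.range_succ, List.map_append, List.map_singleton, exec_seqs_concat, ih,
      exec_addPoly (fun _ _ h => by simpa using h) (by simp) (by simp) (by simp) _ (by exact hn)
        (by simp), St.setVar_p]
    congr 2
    funext i
    simp only [Function.update_apply, St.var_p, St.var_nn, lt_irrefl, if_false]
    split_ifs <;> first | rfl | omega | (subst_vars; rfl)

-- `bad` counts the times at which a guess is inconsistent, and is thus zero iff all checks succeed.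
-- A wrong guess does not stop the simulation, which keeps running for `T` steps.
open Classical in
theorem exec_guessStep_upTo {d k J n m q ρ T : ℕ} {r p : Polynomial ℕ} {P P' : Program L}
    (hP : P.ConstantFree R) (hP' : P'.ConstantFree R)
    (hQ' : P'.QueryFree) (hJ : ∀ i ∈ P', i.WritesBelow J) (hJ0 : 0 < J)
    (hp : ∀ x : List R, ∃ t ≤ p.eval x.length, ∃ c, HaltsAt ∅ P' x t c)
    (hd : ∀ n ≤ N, n + p.eval n + J < N ^ d)
    (start : List R → Config R) (y : List R) (ws : List (List R)) (hws : ws.length = k)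
    (hx : ∀ i ≤ k, ∀ j < m,
      x (2 * n + 2 * m * i + 2 * j + 1) = ((y :: ws).getD i []).getD j (zeroElt L))
    (hm : q + T * (1 + ρ) ≤ m)
    (hρ : ∀ t < T, r.eval (guessedConfig L P start q ρ y t).queryString.length ≤ ρ)
    (hz : ∀ t < T, 2 * (guessedConfig L P start q ρ y t).queryString.length +
      2 * r.eval (guessedConfig L P start q ρ y t).queryString.length * (k + 1) ≤ N)
    (hρN : ρ ≤ N) (hTN : T ≤ N)
    (hc : s.c = 0) (hr : s.rr = 0) (hnc : s.nc = initConfig L [])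
    (hmc : s.mc = start (slice L 0 q y)) (ho : s.o = ρ) (hg : s.g = T) (hh : s.h = 0)
    (hbad : s.bad = 0)
    (hsp : ∀ i ≤ k, s.p i = 2 * n + 2 * m * i + 1 + 2 * q) :
    ∃ tmp p, (Stmt.upTo d .h .g (guessStep R d k J r P P')).exec N (s.toMem L x) =
      St.toMem L x { s with
        tmp := tmp
        p := p
        mc := guessedConfig L P start q ρ y T
        bad := ∑ t ∈ Finset.range T,
          if Consistent P P' r k start q ρ y ws t then 0 else 1 } := by
  have hdN : N ≤ N ^ d := by have := hd N le_rfl; omega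
  have h := exec_upTo (N := N) (d := d) (i := Var.h) (j := Var.g) (k := T)
    (S := (guessStep R d k J r P P'))
    (fun t => St.toMem L x { s with
      tmp := if t = 0 then s.tmp else x (s.p 0 + 2 * ((t - 1) * (1 + ρ)))
      p := fun i => if i < k + 1 then s.p i + 2 * (t * (1 + ρ)) else s.p i
      mc := guessedConfig L P start q ρ y t
      bad := ∑ t ∈ Finset.range t,
          if Consistent P P' r k start q ρ y ws t then 0 else 1 }) (by omega) (by simp)
    (fun _ => by simpa using hh) (fun _ => by simpa using hg) (by
      intro t ht
      have hT := Nat.mul_le_mul_right (1 + ρ) (Nat.succ_le_of_lt ht)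
      rw [Nat.succ_mul] at hT
      obtain ⟨a, ha⟩ : ∃ a, a = q + t * (1 + ρ) := ⟨_, rfl⟩
      have hρt := hρ t ht
      have hzt := hz t ht
      obtain ⟨c, hcd⟩ : ∃ c, c = guessedConfig L P start q ρ y t := ⟨_, rfl⟩
      rw [← hcd] at hρt hzt
      simp only [St.setVar_h]
      rw [exec_guessStep (p := p) x _ hP hP' hQ' hJ hJ0 hp hd (by exact hc) (by exact hr)
        (by exact hnc) (by rw [← hcd]; exact hzt) (by simp only [ho]; exact hρN)]
      have hb : x (s.p 0 + 2 * (t * (1 + ρ))) = oneElt L ↔ guess L q ρ y t := by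
        rw [guess, hsp 0 (by omega)]
        have := hx 0 (by omega) a (by omega)
        rw [show 2 * n + 2 * m * 0 + 1 + 2 * q + 2 * (t * (1 + ρ)) =
          2 * n + 2 * m * 0 + 2 * a + 1 by rw [ha]; ring, this, ha]
        rfl
      have hys : ((List.range k).map fun i => (List.range (r.eval c.queryString.length)).map
          fun j => x ((if (if guess L q ρ y t then i else i + 1) < k + 1 then
            s.p (if guess L q ρ y t then i else i + 1) + 2 * (t * (1 + ρ)) else
            s.p (if guess L q ρ y t then i else i + 1)) + 2 + 2 * j)) =
          (if guess L q ρ y t then (y :: ws).take k else ws).map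
            (slice L (a + 1) (r.eval c.queryString.length)) := by
        refine List.ext_getElem (by split_ifs <;> simp [hws]) fun i hi hi' => ?_
        have hi : i < k := by simpa using hi
        simp only [List.getElem_map, List.getElem_range, slice]
        refine List.map_congr_left fun j hj => ?_
        have hj := List.mem_range.1 hj
        rw [if_pos (by split_ifs <;> omega), hsp _ (by split_ifs <;> omega)]
        have := hx (if guess L q ρ y t then i else i + 1) (by split_ifs <;> omega) (a + 1 + j)
          (by omega)
        rw [show 2 * n + 2 * m * (if guess L q ρ y t then i else i + 1) + 1 + 2 * q +
            2 * (t * (1 + ρ)) + 2 + 2 * j =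
          2 * n + 2 * m * (if guess L q ρ y t then i else i + 1) + 2 * (a + 1 + j) + 1 by
            rw [ha]; ring, this]
        congr 1
        by_cases hgt : guess L q ρ y t
        · simp only [hgt, if_true, List.getElem_take]
          rw [List.getD_eq_getElem _ _ (by simp; omega)]
        · simp only [hgt, if_false]
          rw [List.getD_eq_getElem _ _ (by simp; omega)]
          simp
      have hcons : (IsQuery P c → (Accepts ∅ P' (tupleString L c.queryString
          ((if guess L q ρ y t then (y :: ws).take k else ws).map
            (slice L (a + 1) (r.eval c.queryString.length)))) ↔ guess L q ρ y t)) ↔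
          Consistent P P' r k start q ρ y ws t := by
        rw [Consistent, ← hcd, ha]
      simp only [← hcd, Nat.zero_lt_succ, if_true, hb, hys, hcons, ho]
      congr 2
      · rw [guessedConfig, path, ← guessedConfig, ← hcd]
      · funext i
        split_ifs <;> ring
      · rw [Finset.sum_range_succ])
  have e : ({ s with
      tmp := if 0 = 0 then s.tmp else x (s.p 0 + 2 * ((0 - 1) * (1 + ρ)))
      p := fun i => if i < k + 1 then s.p i + 2 * (0 * (1 + ρ)) else s.p i
      mc := guessedConfig L P start q ρ y 0
      bad := ∑ t ∈ Finset.range 0,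
          if Consistent P P' r k start q ρ y ws t then 0 else 1 } : St R) = s := by
    have : guessedConfig L P start q ρ y 0 = s.mc := by rw [hmc]; rfl
    rw [this]
    ext <;> simp [hbad]
  exact ⟨_, _, (congrArg (fun s => exec N _ (St.toMem L x s)) e.symm).trans h⟩

end Stmt

end


section

variable {L : FirstOrder.Language.{u, v}} {R : Type w} [L.Structure R] [Bipointed L R]

/-- The encoding of `(v, w)`, where `w` is an initial part of `y`, is a prefix of the encoding of
the whole tuple. The input of the oracle machine can therefore be copied verbatim. -/
theorem map_range_tupleString {v y : List R} {ws : List (List R)} {m q : ℕ} (hy : y.length = m)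
    (hws : ∀ z ∈ ws, z.length = m) (hq : q ≤ m) :
    (List.range (2 * v.length + 2 * q)).map
        (fun i => (tupleString L v (y :: ws)).getD i (zeroElt L)) =
      tupleString L v [slice L 0 q y] := by
  have hl : (tupleString L v [slice L 0 q y]).length = 2 * v.length + 2 * q := by
    rw [length_tupleString v (m := q) (by simp [length_slice]) (by simp)]
    simp
  conv_rhs => rw [← map_range_getD (L := L) (tupleString L v [slice L 0 q y]), hl]
  refine List.map_congr_left fun i hi => ?_
  rw [List.mem_range] at hi
  have h₁ : ∀ j < v.length + q,
      (tupleString L v (y :: ws)).getD (2 * j) (zeroElt L) =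
        (tupleString L v [slice L 0 q y]).getD (2 * j) (zeroElt L) ∧
      (tupleString L v (y :: ws)).getD (2 * j + 1) (zeroElt L) =
        (tupleString L v [slice L 0 q y]).getD (2 * j + 1) (zeroElt L) := by
    intro j hj
    rcases Nat.lt_or_ge j v.length with h | h
    · have a₁ := tupleString_getD_left (L := L) v (ws := y :: ws) (by simp) (zeroElt L) h
      have a₂ := tupleString_getD_left (L := L) v (ws := [slice L 0 q y]) (by simp) (zeroElt L) h
      rw [a₁.1, a₁.2, a₂.1, a₂.2]
      exact ⟨rfl, rfl⟩
    · obtain ⟨j, rfl⟩ := Nat.exists_eq_add_of_le h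
      have hj : j < q := by omega
      have a₁ := tupleString_getD_right (L := L) v (m := m) (ws := y :: ws)
        (by simpa [hy] using hws) (by simp) (zeroElt L) (i := 0) (j := j) (by simp) (by omega)
      have a₂ := tupleString_getD_right (L := L) v (m := q) (ws := [slice L 0 q y])
        (by simp [length_slice]) (by simp) (zeroElt L) (i := 0) (j := j) (by simp) hj
      simp only [mul_zero, add_zero, ← mul_add] at a₁ a₂
      rw [a₁.1, a₁.2, a₂.1, a₂.2]
      refine ⟨rfl, ?_⟩
      simp only [List.getD_cons_zero]
      rw [List.getD_eq_getElem (slice L 0 q y) _ (by rwa [length_slice])]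
      simp [slice]
  have h₂ := h₁ (i / 2) (by omega)
  rcases Nat.mod_two_eq_zero_or_one i with h | h
  · rw [show 2 * (i / 2) = i by omega] at h₂
    exact h₂.1
  · rw [show 2 * (i / 2) + 1 = i by omega] at h₂
    exact h₂.2

namespace Stmt

/-- The hypotheses `hm`, `hσ`, `hτ` and `hz` make `m` so large that the slots fit into the
witnesses, and that all loop bounds and all simulated inputs stay below `N`. If a guess is
inconsistent, the result is `f`. -/
theorem exec_simulate {d k J m : ℕ} {q τ σ r p : Polynomial ℕ} {P P' : Program L} (f : Bool)
    (hP : P.ConstantFree R) (hP' : P'.ConstantFree R)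
    (hQ' : P'.QueryFree) (hJ : ∀ i ∈ P', i.WritesBelow J) (hJ0 : 0 < J)
    (hp : ∀ x : List R, ∃ t ≤ p.eval x.length, ∃ c, HaltsAt ∅ P' x t c)
    (hd : ∀ N, 2 ≤ N → ∀ n ≤ N, n + p.eval n + J < N ^ d)
    (v y : List R) (ws : List (List R)) (hk : ws.length = k) (hy : y.length = m)
    (hws : ∀ z ∈ ws, z.length = m) (hm0 : 0 < m)
    (hm : q.eval v.length + τ.eval v.length * (1 + σ.eval v.length) ≤ m)
    (hσ : σ.eval v.length ≤ m) (hτ : τ.eval v.length ≤ m)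
    (start : List R → Config R) (hstart : start = fun w => initConfig L (tupleString L v [w]))
    (hρ : ∀ t < τ.eval v.length, r.eval (guessedConfig L P start (q.eval v.length)
      (σ.eval v.length) y t).queryString.length ≤ σ.eval v.length)
    (hz : ∀ t < τ.eval v.length, (guessedConfig L P start (q.eval v.length)
      (σ.eval v.length) y t).queryString.length + r.eval (guessedConfig L P start
        (q.eval v.length) (σ.eval v.length) y t).queryString.length ≤ m) :
    ((simulate R d k J q τ σ r P P' f).exec ((tupleString L v (y :: ws)).length + 2)
      (initMem L .inp (tupleString L v (y :: ws)))).arr .tmp 0 = oneElt L ↔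
      ((∀ t < τ.eval v.length, Consistent P P' r k start (q.eval v.length) (σ.eval v.length) y ws
        t) ∧ (guessedConfig L P start (q.eval v.length) (σ.eval v.length) y
          (τ.eval v.length)).output = [oneElt L]) ∨
      (¬ (∀ t < τ.eval v.length, Consistent P P' r k start (q.eval v.length) (σ.eval v.length) y ws
        t) ∧ f = true) := by
  classical
  obtain ⟨n, hn⟩ : ∃ n, v.length = n := ⟨_, rfl⟩
  rw [hn] at hm hσ hτ hρ hz ⊢
  obtain ⟨X, hX⟩ : ∃ X, X = tupleString L v (y :: ws) := ⟨_, rfl⟩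
  have hall : ∀ z ∈ y :: ws, z.length = m := by simpa [hy] using hws
  rw [← hX]
  have hXl : X.length = 2 * (n + m * (k + 1)) := by
    rw [hX, length_tupleString v hall (by simp), hn, List.length_cons, hk]
    ring
  have hXv : ∀ j < n, X.getD (2 * j) (zeroElt L) = zeroElt L := by
    intro j hj
    rw [hX]
    exact (tupleString_getD_left v (by simp) _ (by omega)).1
  have hXw : ∀ i < k + 1, ∀ j < m, X.getD (2 * n + 2 * m * i + 2 * j) (zeroElt L) =
      (if j = 0 then oneElt L else zeroElt L) ∧
      X.getD (2 * n + 2 * m * i + 2 * j + 1) (zeroElt L) =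
        ((y :: ws).getD i []).getD j (zeroElt L) := by
    intro i hi j hj
    have := tupleString_getD_right (L := L) v hall (by simp) (zeroElt L) (i := i) (j := j)
      (by simp; omega) hj
    rwa [hn, ← hX] at this
  have htag : ∀ j < n + m * (k + 1),
      X.getD (2 * j) (zeroElt L) = oneElt L ↔ n ≤ j ∧ (j - n) % m = 0 := by
    intro j hj
    rcases Nat.lt_or_ge j n with h | h
    · rw [hXv j h]
      simp only [zeroElt_ne_oneElt (L := L), false_iff]
      omega
    · have hq := Nat.div_add_mod (j - n) m
      have hi : (j - n) / m < k + 1 := by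
        rw [Nat.div_lt_iff_lt_mul hm0, mul_comm]
        omega
      have := (hXw _ hi _ (Nat.mod_lt (j - n) hm0)).1
      rw [mul_assoc, ← mul_add, ← mul_add, add_assoc, hq, Nat.add_sub_cancel' h] at this
      rw [this]
      by_cases h' : (j - n) % m = 0
      · simp [h', h]
      · simp [h', zeroElt_ne_oneElt (L := L)]
  obtain ⟨tmp, g', h₁⟩ := exec_parse (K := k + 1) (n := n) (m := m) hm0 k.succ_pos X hXl htag
  obtain ⟨x, hx⟩ : ∃ x : ℕ → R, x = fun i => X.getD i (zeroElt L) := ⟨_, rfl⟩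
  obtain ⟨N, hN⟩ : ∃ N, N = X.length + 2 := ⟨_, rfl⟩
  rw [← hx, ← hN] at h₁
  rw [← hN]
  have hdN : N ≤ N ^ d := by have := hd N (by omega) N le_rfl; omega
  have hmk : m ≤ m * (k + 1) := Nat.le_mul_of_pos_right _ k.succ_pos
  obtain ⟨a, ha⟩ : ∃ a, q.eval n = a := ⟨_, rfl⟩
  obtain ⟨T, hT⟩ : ∃ T, τ.eval n = T := ⟨_, rfl⟩
  obtain ⟨ρ, hρd⟩ : ∃ ρ, σ.eval n = ρ := ⟨_, rfl⟩
  simp only [ha, hT, hρd] at hm hσ hτ hρ hz ⊢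
  obtain ⟨s, hs⟩ : ∃ s, s = { (St.init L X.length : St R) with
    tmp := tmp
    g' := g'
    g := 1
    h := X.length
    nn := n
    mm := m
    p := fun i => if i < k + 1 then 2 * n + 2 * m * i + 1 else 0 } := ⟨_, rfl⟩
  rw [← hs] at h₁
  have hcnt : Function.Injective Var.cnt := fun _ _ h => by simpa using h
  have hsn : s.nn = n := by rw [hs]
  have hmc : s.mc = initConfig L [] := by rw [hs]; rfl
  have h₂ : (Stmt.addPoly d .cnt .nn (.mIdx 0) (2 * Polynomial.X + 2 * q) :
      Stmt L Arr Var).exec N (s.toMem L x) = St.toMem L x { s with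
        mc := ⟨0, Function.update s.mc.idx 0 (2 * n + 2 * a), s.mc.reg⟩ } := by
    rw [exec_addPoly hcnt (by simp) (by simp) (by simp) _ (by simp only [St.var_nn, hsn]; omega)
      (by simp), St.setVar_mIdx]
    simp [hmc, hsn, initConfig, ha]
  have h₃ := exec_copyInput (L := L) (N := N) (d := d) (l := 2 * n + 2 * a) x s
    (by rw [hs]; rfl) (by omega) hmc
  have e₁ : (List.range (2 * n + 2 * a)).map x = tupleString L v [slice L 0 a y] := by
    rw [hx, hX, ← hn]
    exact map_range_tupleString hy hws (by omega)
  rw [e₁] at h₃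
  obtain ⟨s₁, hs₁⟩ : ∃ s₁, s₁ = { s with
    mc := initConfig L (tupleString L v [slice L 0 a y])
    p := fun i => if i < k + 1 then s.p i + (2 * q).eval s.nn else s.p i
    h := 0
    g := T
    o := ρ } := ⟨_, rfl⟩
  have h₄ : (Stmt.addPoly d .cnt .nn .o σ : Stmt L Arr Var).exec N
      ((Stmt.addPoly d .cnt .nn .g τ : Stmt L Arr Var).exec N
      ((Stmt.decr .g : Stmt L Arr Var).exec N ((Stmt.clear d .h : Stmt L Arr Var).exec N
      ((Stmt.seqs ((List.range (k + 1)).map fun i => .addPoly d .cnt .nn (.p i) (2 * q)) :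
        Stmt L Arr Var).exec N
        (St.toMem L x { s with mc := initConfig L (tupleString L v [slice L 0 a y]) }))))) =
      s₁.toMem L x := by
    have hg : s.g = 1 := by rw [hs]
    have ho : s.o = 0 := by rw [hs]; rfl
    rw [exec_addPoly_p _ _ _ (by simp only [hsn]; omega),
      exec_clear (by simp only [St.var_h, hs]; omega), St.setVar_h, exec_decr, St.setVar_g,
      exec_addPoly hcnt (y := Var.g) (by simp) (by simp) (by simp) _
        (by simp only [St.var_nn, hsn]; omega) (by simp), St.setVar_g,
      exec_addPoly hcnt (by simp) (by simp) (by simp) _ (by simp only [St.var_nn, hsn]; omega)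
        (by simp), St.setVar_o, hs₁]
    simp [hg, ho, hsn, hT, hρd]
  obtain ⟨tmp', p', h₅⟩ := exec_guessStep_upTo (N := N) (d := d) (k := k) (J := J) (n := n)
    (m := m) (q := a) (ρ := ρ) (T := T) (r := r) (p := p) x s₁ hP hP' hQ' hJ hJ0 hp
    (hd N (by omega)) start y ws hk
    (fun i hi j hj => by rw [hx]; exact (hXw i (by omega) j hj).2) hm hρ
    (fun t ht => by
      have h := hz t ht
      have := Nat.mul_le_mul_right (k + 1) h
      rw [add_mul] at this
      have := Nat.le_mul_of_pos_right (guessedConfig L P start a ρ y t).queryString.length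
        (show 0 < k + 1 from k.succ_pos)
      rw [mul_assoc]
      omega) (by omega) (by omega)
    (by rw [hs₁, hs]; rfl) (by rw [hs₁, hs]; rfl) (by rw [hs₁, hs]; rfl)
    (by rw [hs₁, hstart]) (by rw [hs₁]) (by rw [hs₁]) (by rw [hs₁]) (by rw [hs₁, hs]; rfl)
    (fun i hi => by
      rw [hs₁, hs]
      simp only
      rw [if_pos (by omega), if_pos (by omega)]
      simp [ha])
  simp only [simulate, exec_seqs_cons, exec_seqs_nil, h₁, h₂, h₃, h₄, h₅]
  rw [exec_verdict]
  simp only [Finset.sum_eq_zero_iff, Finset.mem_range, ite_eq_left_iff, Nat.one_ne_zero, imp_false,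
    not_not, ne_eq]

end Stmt

end


/-! ### Choice of the polynomials, and the equality of the classes. -/

section

variable {L : FirstOrder.Language.{u, v}} {R : Type w} [L.Structure R] [Bipointed L R]

/-- One exponent covers the running time on an input of length `n`, the registers reached in that
time, and the number `J` of registers that are written directly. -/
theorem exists_lt_pow (p : Polynomial ℕ) (J : ℕ) :
    ∃ d, ∀ N, 2 ≤ N → ∀ n ≤ N, n + p.eval n + J < N ^ d := by
  obtain ⟨d, hd⟩ := exists_eval_le_pow (Polynomial.X + p + Polynomial.C (J + 1))
  refine ⟨d, fun N hN n hn => ?_⟩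
  have := hd N hN
  have := eval_mono p hn
  simp only [Polynomial.eval_add, Polynomial.eval_X, Polynomial.eval_C] at *
  omega

/-- The oracle machine is run for a number of steps that is fixed by the length of `v`, so wrong
guesses cannot cause nontermination, although its time bound holds for the oracle `Q` only. -/
theorem constantFreeOracleLevel_subset_succ (q₀ : Quant) (k : ℕ) :
    constantFreeOracleLevel L R q₀ 1 (SigmaZero L R k) ⊆ constantFreeLevel L R q₀ (k + 1) := by
  rintro A ⟨Q, ⟨P', hQ', hP', ⟨p, hp⟩, r, hQ⟩, P, hP, ⟨pM, hpM⟩, q, hA⟩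
  obtain ⟨J, hJ0, hJ⟩ := Program.exists_writesBelow P'
  obtain ⟨JM, hJM0, hJM⟩ := Program.exists_writesBelow P
  obtain ⟨d, hd⟩ := exists_lt_pow p J
  -- In terms of `|v|`: `l` is the length of the encoding of `(v, w)`, `τ` bounds the running time
  -- of the oracle machine, and `σ` bounds the witnesses for its queries, whose length is at most `l
  -- + τ`.
  obtain ⟨l, hl⟩ : ∃ l : Polynomial ℕ, l = 2 * Polynomial.X + 2 * q := ⟨_, rfl⟩
  obtain ⟨τ, hτ⟩ : ∃ τ, τ = pM.comp l := ⟨_, rfl⟩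
  obtain ⟨σ, hσ⟩ : ∃ σ, σ = r.comp (l + τ) := ⟨_, rfl⟩
  obtain ⟨f, hf⟩ : ∃ f : Bool, f = true ↔ q₀ = .all := by
    cases q₀
    exacts [⟨false, by simp⟩, ⟨true, by simp⟩]
  obtain ⟨S, hS₁, hS₂, hS₃, hS⟩ := exists_program (R := R) Arr.inp .tmp
    (Stmt.simulate R d k J q τ σ r P P' f)
  -- The first two summands are the room for `w` and for the blocks. The others are padding that
  -- makes the input long enough to serve as a loop bound, and `1` makes the witnesses nonempty.
  refine ⟨S, hS₁, hS₂, hS₃, q + τ * (1 + σ) + l + τ + σ + 1, fun v => ?_⟩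
  obtain ⟨n, hn⟩ : ∃ n, v.length = n := ⟨_, rfl⟩
  obtain ⟨a, ha⟩ : ∃ a, q.eval n = a := ⟨_, rfl⟩
  obtain ⟨T, hT⟩ : ∃ T, τ.eval n = T := ⟨_, rfl⟩
  obtain ⟨ρ, hρd⟩ : ∃ ρ, σ.eval n = ρ := ⟨_, rfl⟩
  have hln : l.eval n = 2 * n + 2 * a := by simp [hl, ha]
  have hTl : pM.eval (2 * n + 2 * a) = T := by rw [← hT, hτ, Polynomial.eval_comp, hln]
  have hρT : r.eval (2 * n + 2 * a + T) = ρ := by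
    rw [← hρd, hσ, Polynomial.eval_comp, Polynomial.eval_add, hln, hT]
  obtain ⟨m, hm⟩ : ∃ m, m = a + T * (1 + ρ) + (2 * n + 2 * a) + T + ρ + 1 := ⟨_, rfl⟩
  have hmv : (q + τ * (1 + σ) + l + τ + σ + 1).eval v.length = m := by
    rw [hn]
    simp [ha, hT, hρd, hln, hm]
  rw [hmv, hA, hn, ha]
  obtain ⟨start, hstart⟩ : ∃ start : List R → Config R,
    start = fun w => initConfig L (tupleString L v [w]) := ⟨_, rfl⟩
  have hlen : ∀ w : List R, w.length = a → (tupleString L v [w]).length = 2 * n + 2 * a := by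
    intro w hw
    rw [length_tupleString v (m := a) (by simpa using hw) (by simp), hn]
    simp
  -- This must hold for arbitrary answers `b`. It uses only that `I[0]` grows by at most one per
  -- step; the additional symbol of the query string is absorbed by `t < T`.
  have hquery : ∀ w : List R, w.length = a → ∀ b, ∀ t < T,
      (path P b (start w) t).queryString.length ≤ 2 * n + 2 * a + T := by
    intro w hw b t ht
    have h : (start w).Bounded L JM (2 * n + 2 * a) := by
      rw [hstart, ← hlen w hw]
      exact initConfig_bounded hJM0 _
    have := (path_bounded h hJM b t).idx_le 0
    simp only [Config.queryString, List.length_ofFn]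
    omega
  have hρ : ∀ w : List R, w.length = a → ∀ b, ∀ t < T,
      r.eval (path P b (start w) t).queryString.length ≤ ρ := fun w hw b t ht =>
    hρT ▸ eval_mono r (hquery w hw b t ht)
  have hacc : ∀ w : List R, w.length = a → (Accepts Q P (tupleString L v [w]) ↔
      ((stay Q P)^[T] (start w)).output = [oneElt L]) := by
    intro w hw
    obtain ⟨t, ht, c, hc⟩ := hpM (tupleString L v [w])
    rw [hlen w hw, hTl] at ht
    rw [hc.accepts_iff, hstart, hc.stay_iterate ht]
  have hsim : ∀ ws : List (List R), ws.length = k + 1 → (∀ y ∈ ws, y.length = m) →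
      (Accepts ∅ S (tupleString L v ws) ↔
        ((∀ t < T, Consistent P P' r k start a ρ (ws.headD []) ws.tail t) ∧
          (guessedConfig L P start a ρ (ws.headD []) T).output = [oneElt L]) ∨
        (¬ (∀ t < T, Consistent P P' r k start a ρ (ws.headD []) ws.tail t) ∧ f = true)) := by
    intro ws hk hws
    cases ws with
    | nil => simp at hk
    | cons y ws =>
      simp only [List.mem_cons, forall_eq_or_imp] at hws
      have h := Stmt.exec_simulate (d := d) (k := k) (J := J) (m := m) (q := q) (τ := τ) (σ := σ)
        (r := r) (p := p) f hP hP' hQ' hJ hJ0 hp hd v y ws (by simpa using hk) hws.1 hws.2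
        (by omega) (by rw [hn, ha, hT, hρd]; omega) (by rw [hn, hρd]; omega)
        (by rw [hn, hT]; omega) start hstart (by
          rw [hn, ha, hT, hρd]
          exact fun t ht => hρ _ (length_slice _ _ _) _ t ht) (by
          rw [hn, ha, hT, hρd]
          intro t ht
          have h₁ := hρ _ (length_slice (L := L) 0 a y) (guess L a ρ y) t ht
          have h₂ := hquery _ (length_slice (L := L) 0 a y) (guess L a ρ y) t ht
          simp only [guessedConfig]
          omega)
      rw [hn, ha, hT, hρd] at h
      rw [hS, h]
      simp
  have key := fun g => alternates_simulation (L := L) (P := P) (P' := P') (r := r) (k := k)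
    (start := start) (q := a) (ρ := ρ) (m := m) (T := T) (Q := Q) (by omega) hρ hQ g
  rw [Alternates.congr hsim]
  cases q₀ with
  | ex =>
    have hf : f = false := by simpa using hf
    simp only [hf, Bool.false_eq_true, and_false, or_false]
    have := key fun c => c.output = [oneElt L]
    simp only [and_comm (a := (guessedConfig L P start a ρ _ T).output = [oneElt L])] at this
    rw [this]
    exact exists_congr fun w => and_congr_right fun hw => hacc w hw
  | all =>
    have hf : f = true := by simpa using hf
    -- A leading `∀` is treated through the complement: the negation of "all checks succeed and the
    -- machine does not accept" is "some check fails or the machine accepts", which is the verdict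
    -- for `f = true`.
    have := not_congr (key fun c => ¬ c.output = [oneElt L])
    rw [Alternates.not] at this
    simp only [hf, and_true]
    refine Iff.trans ?_ (this.symm.trans (Alternates.congr fun ws _ _ => by tauto))
    simp only [Alternates]
    push Not
    exact forall_congr' fun w => imp_congr_right fun hw => hacc w hw

theorem constantFreeLevel_succ (q₀ : Quant) (k : ℕ) :
    constantFreeLevel L R q₀ (k + 1) = constantFreeOracleLevel L R q₀ 1 (SigmaZero L R k) :=
  (constantFreeLevel_succ_subset q₀ k).antisymm (constantFreeOracleLevel_subset_succ q₀ k)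

end

end RMachine

theorem mainTheorem9 (L : FirstOrder.Language.{u, v}) (R : Type w) [L.Structure R]
    [RMachine.Bipointed L R] (k : ℕ) :
    RMachine.ExistsLevel L R (k + 1) =
        RMachine.ExistsLevelOracle L R 1 (RMachine.SigmaZero L R k) ∧
      RMachine.ForallLevel L R (k + 1) =
        RMachine.ForallLevelOracle L R 1 (RMachine.SigmaZero L R k) :=
  ⟨congrArg (RMachine.booleanPart L R '' ·) (RMachine.constantFreeLevel_succ .ex k),
    congrArg (RMachine.booleanPart L R '' ·) (RMachine.constantFreeLevel_succ .all k)⟩
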